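/- **Proposition 3.1.** Let $k$ be a field and let $m\ge 2$ and $n\ge 3$ be integers. Let $Q$ be the quiver with vertices $1',2',\dots,m'$ and $2,3,\dots,n$, with exactly one arrow $i'\to 2$ for each $1\le i\le m$, exactly one arrow $j\to j+1$ for each $2\le j\le n-1$, and no other arrows. Let $\Lambda'_m(n,n-1)=kQ/I$, where $kQ$ is the path algebra (paths are written $\alpha_l\cdots\alpha_1$ with $\alpha_1$ traversed first) and $I$ is the two-sided ideal generated by all paths of length $n-1$. For positive integers $p_1,\dots,p_r$ let $\mathbb{T}_{p_1,\dots,p_r}$ be the star quiver with one central vertex and $r$ arms, the $i$-th arm being a linearly oriented path of $p_i-1$ arrows starting at the centre and pointing away from it. Let $\mathbb{T}=\mathbb{T}_{2^{m+1},n-2}$ be the star quiver with $m+2$ arms and weight sequence $(2,\dots,2,n-2)$, where $2$ occurs $m+1$ times. Then $\Lambda'_m(n,n-1)$ is piecewise hereditary of type $\mathbb{T}_{2^{m+1},n-2}$. That is: $\Lambda'_m(n,n-1)$ is a finite-dimensional $k$-algebra, the abelian category $\operatorname{mod} k\mathbb{T}$ is hereditary ($\operatorname{Ext}^i=0$ for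 all $i\ge 2$), and there is a $k$-linear triangle equivalence $$\mathcal{D}^b(\operatorname{mod}\Lambda'_m(n,n-1))\simeq \mathcal{D}^b(\operatorname{mod} k\mathbb{T}),$$ where $\operatorname{mod} A$ denotes the category of finite-dimensional right $A$-modules and $\mathcal{D}^b$ the bounded derived category. -/

import Mathlib

open CategoryTheory

universe u

noncomputable section

namespace PiecewiseHereditary

/-! ### Path algebras and their quotients -/

section PathAlgebra

/-- All paths of a quiver (including the trivial ones): triples `⟨a, b, p⟩` with `p` a path
from `a` to `b`. -/
abbrev QPath (Q : Type) [Quiver.{0} Q] : Type := Σ a b : Q, Quiver.Path a b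

/-- The path algebra `kQ`: as a vector space it has the set of all paths of `Q` as basis. -/
def PathAlgebra (k : Type u) [Field k] (Q : Type) [Quiver.{0} Q] : Type u := QPath Q →₀ k

namespace PathAlgebra

variable (k : Type u) [Field k] {Q : Type} [Quiver.{0} Q]

instance : AddCommGroup (PathAlgebra k Q) := inferInstanceAs (AddCommGroup (QPath Q →₀ k))

instance : Module k (PathAlgebra k Q) := inferInstanceAs (Module k (QPath Q →₀ k))

/-- The basis vector of `kQ` given by a path. -/
def ofPath (p : QPath Q) : PathAlgebra k Q := Finsupp.single p 1

open Classical in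
/-- The product of two basis paths: `p · q` is the concatenation "first `q`, then `p`" if `q` ends
where `p` starts, and zero otherwise. So a path is written `αₘ ⋯ α₁`, with `α₁` traversed first. -/
def pathMul (p q : QPath Q) : PathAlgebra k Q :=
  if h : p.1 = q.2.1 then ofPath k ⟨q.1, p.2.1, q.2.2.comp (p.2.2.cast h rfl)⟩ else 0

/-- The multiplication of `kQ`, the bilinear extension of `pathMul`. -/
def mulHom : PathAlgebra k Q →ₗ[k] PathAlgebra k Q →ₗ[k] PathAlgebra k Q :=
  Finsupp.linearCombination k fun p => Finsupp.linearCombination k fun q => pathMul k p q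

instance : Mul (PathAlgebra k Q) := ⟨fun x y => mulHom k x y⟩

/-- The unit of `kQ` is the sum of the trivial paths. -/
instance [Fintype Q] : One (PathAlgebra k Q) := ⟨∑ a : Q, ofPath k ⟨a, a, Quiver.Path.nil⟩⟩

variable {k}

lemma mul_def (x y : PathAlgebra k Q) : x * y = mulHom k x y := rfl

lemma one_def [Fintype Q] :
    (1 : PathAlgebra k Q) = ∑ a : Q, ofPath k ⟨a, a, Quiver.Path.nil⟩ := rfl

lemma ofPath_mul_ofPath (p q : QPath Q) : ofPath k p * ofPath k q = pathMul k p q := by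
  have h1 : mulHom k (ofPath k p) = Finsupp.linearCombination k (pathMul k p) :=
    (Finsupp.linearCombination_single k (1 : k) p).trans (one_smul _ _)
  rw [mul_def, h1]
  exact (Finsupp.linearCombination_single k (1 : k) q).trans (one_smul _ _)

lemma ofPath_mul_ofPath_of_comp {a b c : Q} (q : Quiver.Path a b) (p : Quiver.Path b c) :
    ofPath k ⟨b, c, p⟩ * ofPath k ⟨a, b, q⟩ = ofPath k ⟨a, c, q.comp p⟩ := by
  rw [ofPath_mul_ofPath]
  simp [pathMul]

lemma ofPath_mul_ofPath_of_ne {a b c d : Q} (q : Quiver.Path a b) (p : Quiver.Path c d)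
    (h : c ≠ b) : ofPath k ⟨c, d, p⟩ * ofPath k ⟨a, b, q⟩ = 0 := by
  rw [ofPath_mul_ofPath]
  simp [pathMul, h]

@[elab_as_elim]
lemma induction_on {motive : PathAlgebra k Q → Prop} (x : PathAlgebra k Q) (zero : motive 0)
    (add : ∀ x y, motive x → motive y → motive (x + y))
    (smul : ∀ (c : k) (p : QPath Q), motive (c • ofPath k p)) : motive x := by
  refine Finsupp.induction_linear (motive := motive) x zero add fun p c => ?_
  have h : (Finsupp.single p c : QPath Q →₀ k) = c • Finsupp.single p 1 := by simp
  rw [h]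
  exact smul c p

protected lemma add_mul' (x y z : PathAlgebra k Q) : (x + y) * z = x * z + y * z := by
  simp [mul_def]

protected lemma mul_add' (x y z : PathAlgebra k Q) : x * (y + z) = x * y + x * z := by
  simp [mul_def]

protected lemma zero_mul' (x : PathAlgebra k Q) : 0 * x = 0 := by simp [mul_def]

protected lemma mul_zero' (x : PathAlgebra k Q) : x * 0 = 0 := by simp [mul_def]

protected lemma smul_mul' (c : k) (x y : PathAlgebra k Q) : (c • x) * y = c • (x * y) := by
  simp [mul_def]

protected lemma mul_smul' (c : k) (x y : PathAlgebra k Q) : x * (c • y) = c • (x * y) := by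
  simp [mul_def]

protected lemma mul_assoc' (x y z : PathAlgebra k Q) : x * y * z = x * (y * z) := by
  induction x using induction_on with
  | zero => simp only [PathAlgebra.zero_mul']
  | add x x' hx hx' => simp only [PathAlgebra.add_mul', hx, hx']
  | smul c p =>
  induction y using induction_on with
  | zero => simp only [PathAlgebra.zero_mul', PathAlgebra.mul_zero']
  | add y y' hy hy' => simp only [PathAlgebra.add_mul', PathAlgebra.mul_add', hy, hy']
  | smul d q =>
  induction z using induction_on with
  | zero => simp only [PathAlgebra.mul_zero']
  | add z z' hz hz' => simp only [PathAlgebra.mul_add', hz, hz']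
  | smul e r =>
  simp only [PathAlgebra.smul_mul', PathAlgebra.mul_smul']
  congr 3
  obtain ⟨a, b, p⟩ := p
  obtain ⟨a', b', q⟩ := q
  obtain ⟨a'', b'', r⟩ := r
  by_cases h : a = b'
  · subst h
    by_cases h' : a' = b''
    · subst h'
      simp only [ofPath_mul_ofPath_of_comp, Quiver.Path.comp_assoc]
    · rw [ofPath_mul_ofPath_of_comp, ofPath_mul_ofPath_of_ne _ _ h', ofPath_mul_ofPath_of_ne _ _ h',
        PathAlgebra.mul_zero']
  · rw [ofPath_mul_ofPath_of_ne _ _ h, PathAlgebra.zero_mul']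
    by_cases h' : a' = b''
    · subst h'
      rw [ofPath_mul_ofPath_of_comp, ofPath_mul_ofPath_of_ne _ _ h]
    · rw [ofPath_mul_ofPath_of_ne _ _ h', PathAlgebra.mul_zero']

protected lemma one_mul' [Fintype Q] (x : PathAlgebra k Q) : 1 * x = x := by
  induction x using induction_on with
  | zero => rw [PathAlgebra.mul_zero']
  | add x x' hx hx' => rw [PathAlgebra.mul_add', hx, hx']
  | smul c p =>
  rw [PathAlgebra.mul_smul']
  congr 1
  obtain ⟨a, b, p⟩ := p
  rw [one_def, mul_def, map_sum, LinearMap.sum_apply]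
  simp only [← mul_def]
  rw [Finset.sum_eq_single b]
  · rw [ofPath_mul_ofPath_of_comp, Quiver.Path.comp_nil]
  · intro c _ hc
    exact ofPath_mul_ofPath_of_ne _ _ hc
  · simp

protected lemma mul_one' [Fintype Q] (x : PathAlgebra k Q) : x * 1 = x := by
  induction x using induction_on with
  | zero => rw [PathAlgebra.zero_mul']
  | add x x' hx hx' => rw [PathAlgebra.add_mul', hx, hx']
  | smul c p =>
  rw [PathAlgebra.smul_mul']
  congr 1
  obtain ⟨a, b, p⟩ := p
  rw [one_def, mul_def, map_sum]
  simp only [← mul_def]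
  rw [Finset.sum_eq_single a]
  · rw [ofPath_mul_ofPath_of_comp, Quiver.Path.nil_comp]
  · intro c _ hc
    exact ofPath_mul_ofPath_of_ne _ _ hc.symm
  · simp

instance [Fintype Q] : Ring (PathAlgebra k Q) where
  __ := (inferInstance : AddCommGroup (PathAlgebra k Q))
  left_distrib := PathAlgebra.mul_add'
  right_distrib := PathAlgebra.add_mul'
  zero_mul := PathAlgebra.zero_mul'
  mul_zero := PathAlgebra.mul_zero'
  mul_assoc := PathAlgebra.mul_assoc'
  one_mul := PathAlgebra.one_mul'
  mul_one := PathAlgebra.mul_one'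

instance [Fintype Q] : Algebra k (PathAlgebra k Q) :=
  Algebra.ofModule PathAlgebra.smul_mul' PathAlgebra.mul_smul'

end PathAlgebra

/-- The two-sided ideal of `kQ` generated by all paths of length `r`. -/
def lengthIdeal (k : Type u) [Field k] (Q : Type) [Quiver.{0} Q] [Fintype Q] (r : ℕ) :
    TwoSidedIdeal (PathAlgebra k Q) :=
  TwoSidedIdeal.span {x | ∃ p : QPath Q, p.2.2.length = r ∧ x = PathAlgebra.ofPath k p}

/-- The algebra given by the quiver `Q` with relations all paths of length `r`. -/
abbrev TruncatedPathAlgebra (k : Type u) [Field k] (Q : Type) [Quiver.{0} Q] [Fintype Q]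
    (r : ℕ) : Type u :=
  (lengthIdeal k Q r).ringCon.Quotient

end PathAlgebra

/-! ### The two families of quivers -/

/-- The vertices of the extended linear quiver: `source i` for the `m` vertices `1', …, m'` and
`arm j` for the vertices `j = 2, …, n`. -/
inductive ExtVertex (m n : ℕ) : Type
  | source (i : Fin m) : ExtVertex m n
  | arm (j : Finset.Icc 2 n) : ExtVertex m n
  deriving DecidableEq, Fintype

/-- Exactly one arrow `i' → 2` for every `i`, exactly one arrow `j → j + 1` for `2 ≤ j < n`,
and no other arrows. -/
instance (m n : ℕ) : Quiver.{0} (ExtVertex m n) where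
  Hom
    | .source _, .arm j => PLift (j.1 = 2)
    | .arm i, .arm j => PLift (j.1 = i.1 + 1)
    | _, .source _ => Empty

/-- The algebra `Λ'_m(n, n-1)`. -/
abbrev LambdaPrime (k : Type u) [Field k] (m n : ℕ) : Type u :=
  TruncatedPathAlgebra k (ExtVertex m n) (n - 1)

/-- The vertices of the star with `r` arms, the `i`-th arm having `p i - 1` vertices besides the
centre: `centre`, and `arm i j`, the `(j + 1)`-st vertex on the `i`-th arm. -/
inductive StarVertex {r : ℕ} (p : Fin r → ℕ) : Type
  | centre : StarVertex p
  | arm (i : Fin r) (j : Fin (p i - 1)) : StarVertex p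
  deriving DecidableEq, Fintype

/-- The star quiver `𝕋_{p_1,…,p_r}`, with arms oriented away from the centre: one arrow
from the centre to the first vertex of each (nonempty) arm and one arrow from each vertex of an
arm to the next one, so that the `i`-th arm has `p i - 1` arrows. -/
instance {r : ℕ} (p : Fin r → ℕ) : Quiver.{0} (StarVertex p) where
  Hom
    | .centre, .arm _ j => PLift (j.1 = 0)
    | .arm i j, .arm i' j' => PLift (i = i' ∧ j'.1 = j.1 + 1)
    | _, .centre => Empty

/-- The weight sequence `(2, …, 2, n - 2)` with `m + 1` entries equal to `2`. -/
def starWeights (m n : ℕ) (i : Fin (m + 2)) : ℕ := if i = Fin.last (m + 1) then n - 2 else 2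

/-! ### Finite-dimensional right modules -/

section Modules

variable (k : Type u) [Field k] (A : Type u) [Ring A] [Algebra k A]

open scoped ModuleCat in
/-- Finite-dimensionality over `k`, as a property of right `A`-modules, that is, of
modules over `Aᵐᵒᵖ`. -/
def isFinDim : ObjectProperty (ModuleCat.{u} Aᵐᵒᵖ) := fun M => Module.Finite k M

/-- The category `mod A` of finite-dimensional right `A`-modules. -/
abbrev FDMod : Type (u + 1) := (isFinDim k A).FullSubcategory

open scoped ModuleCat in
instance : (isFinDim k A).IsSerreClass where
  exists_zero := ⟨.of _ PUnit.{u + 1}, ModuleCat.isZero_of_subsingleton _, by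
    have : Finite (ModuleCat.of Aᵐᵒᵖ PUnit.{u + 1}) := inferInstanceAs (Finite PUnit)
    exact Module.Finite.of_finite⟩
  prop_of_mono {M N} f hf hN := by
    have hN' : Module.Finite k N := hN
    exact Module.Finite.of_injective (f.hom.restrictScalars k)
      ((ModuleCat.mono_iff_injective f).1 hf)
  prop_of_epi {M N} f hf hM := by
    have hM' : Module.Finite k M := hM
    exact Module.Finite.of_surjective (f.hom.restrictScalars k)
      ((ModuleCat.epi_iff_surjective f).1 hf)
  prop_X₂_of_shortExact {S} hS h₁ h₃ := by
    have h₁' : Module.Finite k S.X₁ := h₁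
    have h₃' : Module.Finite k S.X₃ := h₃
    have hex : Function.Exact (S.f.hom.restrictScalars k) (S.g.hom.restrictScalars k) :=
      (ShortComplex.ShortExact.moduleCat_exact_iff_function_exact S).1 hS.exact
    exact Module.Finite.of_exact hex ((ModuleCat.epi_iff_surjective S.g).1 hS.epi_g)

instance : (isFinDim k A).IsClosedUnderFiniteProducts := by
  have : (isFinDim k A).IsClosedUnderBinaryProducts := ⟨by
    rintro X ⟨p⟩
    let e := (Limits.HasLimit.isoOfNatIso (Limits.diagramIsoPair p.diag)).symm ≪≫
      Limits.limit.isoLimitCone ⟨_, p.isLimit⟩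
    exact (isFinDim k A).prop_of_iso ((Limits.biprod.isoProd _ _) ≪≫ e)
      ((isFinDim k A).prop_biprod (p.prop_diag_obj _) (p.prop_diag_obj _))⟩
  exact ObjectProperty.IsClosedUnderFiniteProducts.mk'

end Modules

/-! ### Derived categories and piecewise hereditary algebras -/

section Derived

/-- Two `k`-linear triangulated categories are triangle equivalent: there is a `k`-linear
triangulated functor between them which is an equivalence of categories. -/
def TriangleEquivalent (k : Type*) [Field k] (C D : Type*) [Category* C] [Category* D]
    [Preadditive C] [Preadditive D] [Linear k C] [Linear k D]
    [Limits.HasZeroObject C] [Limits.HasZeroObject D] [HasShift C ℤ] [HasShift D ℤ]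
    [∀ n : ℤ, (shiftFunctor C n).Additive] [∀ n : ℤ, (shiftFunctor D n).Additive]
    [Pretriangulated C] [Pretriangulated D] : Prop :=
  ∃ (F : C ⥤ D) (_ : F.CommShift ℤ), F.IsTriangulated ∧ F.Linear k ∧ F.IsEquivalence

/-- An abelian category is hereditary if `Extⁱ(X, Y) = 0` for all objects `X`, `Y`
and all `i ≥ 2`. -/
def IsHereditaryCategory (H : Type*) [Category* H] [Abelian H] : Prop :=
  ∀ X : H, HasProjectiveDimensionLE X 1

/-- `A` is a finite-dimensional `k`-algebra which is piecewise hereditary of type `H`: the abelian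
category `H` is hereditary and the bounded derived categories of `mod A` and of `H` are triangle
equivalent. -/
def IsPiecewiseHereditaryOfType (k : Type u) [Field k] (A : Type u) [Ring A] [Algebra k A]
    (H : Type*) [Category* H] [Abelian H] [Linear k H] : Prop :=
  letI : HasDerivedCategory (FDMod k A) := HasDerivedCategory.standard _
  letI : HasDerivedCategory H := HasDerivedCategory.standard _
  Module.Finite k A ∧ IsHereditaryCategory H ∧
    TriangleEquivalent k (DerivedCategory.Bounded (FDMod k A)) (DerivedCategory.Bounded H)

end Derived

end PiecewiseHereditary

end

/-! Write n = N + 3. A finite-dimensional right module over Λ' is a chain of spaces C_⊤ → … → C_⊥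
indexed by `Fin (N + 2)` (the vertices n, …, 2), together with maps C_⊥ → Y_i for the m sources,
such that every composite C_⊤ → C_⊥ → Y_i vanishes: the only paths of length n - 1 are those from a
source to the vertex n. A right module over the path algebra of the star is a chain shorter by one
space, here indexed by the same `Fin (N + 2)` with the zero space at ⊤, together with m + 1 maps
into the space D_⊥ at the centre; the label `none` singles out one of these short arms.

The two kinds of data are matched by linear algebra. If C_⊤ → C_⊥ is injective and all C_⊥ → Y_i are
surjective, form the chain D_j = C_j / C_⊤, put C_⊥ with its projection to D_⊥ on the exceptional
short arm, and put B_i = ker (D_⊥ → Y_i) on the others. This produces exactly the star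
representations for which the exceptional map A → D_⊥ is surjective and the other maps B_i → D_⊥ are
injective. The data are recovered as the pullbacks C_j = D_j ×_{D_⊥} A and the cokernels Y_i = D_⊥ /
B_i. So `reduction` is a linear equivalence between two additive subcategories, although the ambient
abelian categories differ.

These subcategories are large enough to compute the derived categories. On each side a functorial
left resolution with two terms achieves the injectivity condition, and then a functorial right
resolution with two terms achieves the surjectivity condition
(`isLocalizedEquivalence_topInjective`, `isLocalizedEquivalence_leafSurjective`,
`isLocalizedEquivalence_rootInjective`, `isLocalizedEquivalence_rootSurjective`). Applied termwise
to a complex and followed by a cone or cocone, such a resolution replaces the complex by a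
quasi-isomorphic one with terms in the subcategory. Hence complexes in the subcategory, localized at
vertexwise quasi-isomorphisms, give the derived category.

Finally, the notions of acyclicity on the two sides agree. The sequences 0 → C_⊤ → C_j → D_j → 0 and
0 → B_i → D_⊥ → Y_i → 0 are exact, so a property of complexes with two-out-of-three in short exact
sequences holds at all vertices on one side if and only if it does on the other
(`isThick_iff_reduction`). For acyclicity this says that both derived categories localize one
homotopy category at the same morphisms; for bounded cohomology it says that the bounded parts
correspond. This is assembled in `triangleEquivalent_bounded_of_resolutions`.

Heredity of the star side is the standard resolution of a representation by a free one: the kernel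
of the projection is again projective, because its chain maps are injective and it vanishes on the
short arms (`isHereditaryCategory_of_presentation`). -/

noncomputable section

/-! ### Functoriality of mapping cocones -/

namespace CochainComplex

open Limits HomComplex Pretriangulated

section Cone

variable {C : Type*} [Category* C] [Preadditive C] [HasBinaryBiproducts C]

namespace mappingCocone

variable {K L : CochainComplex C ℤ} (φ : K ⟶ L)

/-- The cocone is the cone shifted by -1, and this is the shifted form of `mappingCone.δ_snd`, with
its signs. It supplies the cocycle condition needed to define a morphism into a cocone by
components. -/
lemma δ_snd : δ (-1) 0 (snd φ) + Cochain.ofHom (fst φ ≫ φ) = 0 := by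
  have h₁ : δ (-1) 0 ((mappingCone.snd φ).leftShift (-1) (-1) (zero_add _)) =
      ((mappingCone.fst φ).1.leftShift (-1) 0 (add_neg_cancel 1)).comp (Cochain.ofHom φ)
        (add_zero 0) := by
    rw [Cochain.δ_leftShift (mappingCone.snd φ) (-1) (-1) 0 (zero_add _) 1 (by lia),
      mappingCone.δ_snd, Cochain.leftShift_neg, Cochain.leftShift_comp_zero_cochain]
    simp
  have h₂ : ∀ p, (fst φ).f p = -(((mappingCone.fst φ).1.leftShift (-1) 0
    (add_neg_cancel 1)).v p p (add_zero p)) := fun p ↦ rfl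
  have h₃ : ∀ p, (δ (-1) 0 (snd φ)).v p p (add_zero p) =
      ((mappingCone.fst φ).1.leftShift (-1) 0 (add_neg_cancel 1)).v p p (add_zero p) ≫ φ.f p := by
    intro p
    have := Cochain.congr_v h₁ p p (add_zero p)
    rw [Cochain.comp_zero_cochain_v, Cochain.ofHom_v] at this
    exact this
  ext p
  rw [Cochain.add_v, h₃, Cochain.ofHom_v, HomologicalComplex.comp_f, h₂]
  exact (congr_arg _ (Preadditive.neg_comp _ _)).trans (add_neg_cancel _)

lemma ext_to (p q : ℤ) (hpq : p + -1 = q) {A : C} {f g : A ⟶ (mappingCocone φ).X p}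
    (h₁ : f ≫ (fst φ).f p = g ≫ (fst φ).f p)
    (h₂ : f ≫ (snd φ).v p q hpq = g ≫ (snd φ).v p q hpq) : f = g := by
  rw [← Category.comp_id f, ← Category.comp_id g, ← id_X φ p q hpq, Preadditive.comp_add,
    Preadditive.comp_add, reassoc_of% h₁, reassoc_of% h₂]

variable {K' L' : CochainComplex C ℤ} (φ' : K' ⟶ L') {K'' L'' : CochainComplex C ℤ}
  (φ'' : K'' ⟶ L'')

/-- The morphism of mapping cocones induced by a commutative square. -/
def map (a : K ⟶ K') (b : L ⟶ L') (comm : φ ≫ b = a ≫ φ') :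
    mappingCocone φ ⟶ mappingCocone φ' :=
  lift φ' (fst φ ≫ a) ((snd φ).comp (Cochain.ofHom b) (add_zero _)) (by
    have := δ_snd φ
    rw [add_eq_zero_iff_eq_neg] at this
    rw [δ_comp_ofHom, this]
    simp [← Cochain.ofHom_comp, comm])

@[simp]
lemma map_f_fst_f (a : K ⟶ K') (b : L ⟶ L') (comm : φ ≫ b = a ≫ φ') (p : ℤ) :
    (map φ φ' a b comm).f p ≫ (fst φ').f p = (fst φ).f p ≫ a.f p := by
  simp [map]

@[simp]
lemma map_f_snd_v (a : K ⟶ K') (b : L ⟶ L') (comm : φ ≫ b = a ≫ φ') (p q : ℤ)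
    (hpq : p + -1 = q) :
    (map φ φ' a b comm).f p ≫ (snd φ').v p q hpq = (snd φ).v p q hpq ≫ b.f q := by
  simp [map]

lemma map_id : map φ φ (𝟙 _) (𝟙 _) (by simp) = 𝟙 _ := by
  ext p
  apply ext_to φ p _ rfl <;> simp

lemma map_comp (a : K ⟶ K') (b : L ⟶ L') (comm : φ ≫ b = a ≫ φ')
    (a' : K' ⟶ K'') (b' : L' ⟶ L'') (comm' : φ' ≫ b' = a' ≫ φ'') :
    map φ φ'' (a ≫ a') (b ≫ b') (by rw [reassoc_of% comm, comm', Category.assoc]) =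
      map φ φ' a b comm ≫ map φ' φ'' a' b' comm' := by
  ext p
  refine ext_to φ'' p _ rfl ?_ ?_
  · simp [reassoc_of% map_f_fst_f φ φ' a b comm p]
  · simp [reassoc_of% map_f_snd_v φ φ' a b comm p _ rfl]

end mappingCocone

end Cone

end CochainComplex

/-! ### Acyclic complexes, contractible cones and joint quasi-isomorphisms -/

namespace CochainComplex

open Limits HomComplex Pretriangulated

section Acyclic

variable {𝒱 : Type*} [Category* 𝒱] [Abelian 𝒱]

lemma isZero_Q_obj_of_acyclic [HasDerivedCategory 𝒱] {K : CochainComplex 𝒱 ℤ}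
    (h : K.Acyclic) : IsZero (DerivedCategory.Q.obj K) := by
  have : QuasiIso (0 : K ⟶ K) :=
    ⟨fun n ↦ (quasiIsoAt_iff_exactAt _ n (h n)).2 (h n)⟩
  have : IsIso (DerivedCategory.Q.map (0 : K ⟶ K)) := inferInstance
  rw [CategoryTheory.Functor.map_zero] at this
  rw [IsZero.iff_id_eq_zero, ← IsIso.hom_inv_id (0 : DerivedCategory.Q.obj K ⟶ DerivedCategory.Q.obj K), zero_comp]

/-- A short exact sequence of complexes becomes a distinguished triangle, and a triangle with one
zero object has an isomorphism opposite to it. -/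
lemma quasiIso_g_of_acyclic {S : ShortComplex (CochainComplex 𝒱 ℤ)} (hS : S.ShortExact)
    (h : S.X₁.Acyclic) : QuasiIso S.g := by
  let _ : HasDerivedCategory 𝒱 := HasDerivedCategory.standard _
  rw [← DerivedCategory.isIso_Q_map_iff_quasiIso]
  exact (Triangle.isZero₁_iff_isIso₂ _ (DerivedCategory.triangleOfSES_distinguished hS)).1
    (isZero_Q_obj_of_acyclic h)

lemma quasiIso_f_of_acyclic {S : ShortComplex (CochainComplex 𝒱 ℤ)} (hS : S.ShortExact)
    (h : S.X₃.Acyclic) : QuasiIso S.f := by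
  let _ : HasDerivedCategory 𝒱 := HasDerivedCategory.standard _
  rw [← DerivedCategory.isIso_Q_map_iff_quasiIso]
  exact (Triangle.isZero₃_iff_isIso₁ _ (DerivedCategory.triangleOfSES_distinguished hS)).1
    (isZero_Q_obj_of_acyclic h)

lemma acyclic_of_homotopy_id_zero {K : CochainComplex 𝒱 ℤ} (h : Homotopy (𝟙 K) 0) :
    K.Acyclic := by
  intro n
  rw [HomologicalComplex.exactAt_iff_isZero_homology, IsZero.iff_id_eq_zero,
    ← HomologicalComplex.homologyMap_id, h.homologyMap_eq, HomologicalComplex.homologyMap_zero]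

end Acyclic

section Resolution

variable {C : Type*} [Category* C] [Preadditive C] [HasBinaryBiproducts C]
  {𝒱 : Type*} [Category* 𝒱] [Abelian 𝒱]

/-- The cone of an identity has a contracting homotopy, and any additive functor preserves it. No
exactness of `F` is involved, and `C` need not be abelian. -/
lemma acyclic_map_mappingCone_id (F : C ⥤ 𝒱) [F.Additive] (K : CochainComplex C ℤ) :
    ((F.mapHomologicalComplex (ComplexShape.up ℤ)).obj (mappingCone (𝟙 K))).Acyclic :=
  acyclic_of_homotopy_id_zero (by
    simpa using F.mapHomotopy (mappingCone.homotopyToZeroOfId K))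

lemma acyclic_map_mappingCocone_id (F : C ⥤ 𝒱) [F.Additive] (K : CochainComplex C ℤ) :
    ((F.mapHomologicalComplex (ComplexShape.up ℤ)).obj (mappingCocone (𝟙 K))).Acyclic := by
  have h : Homotopy (𝟙 (mappingCocone (𝟙 K))) 0 :=
    (Homotopy.ofEq (CategoryTheory.Functor.map_id _ _).symm).trans
      (((mappingCone.homotopyToZeroOfId K).shift (-1)).trans (Homotopy.ofEq (CategoryTheory.Functor.map_zero _ _ _)))
  exact acyclic_of_homotopy_id_zero (by simpa using F.mapHomotopy h)

/-- The morphisms of complexes which become quasi-isomorphisms after applying each functor in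
a given family. -/
def jointQuasiIso {ι : Type*} (ev : ι → C ⥤ 𝒱) [∀ v, (ev v).Additive] :
    MorphismProperty (CochainComplex C ℤ) := fun _ _ f ↦
  ∀ v, QuasiIso (((ev v).mapHomologicalComplex (ComplexShape.up ℤ)).map f)

variable {ι : Type*} (ev : ι → C ⥤ 𝒱) [∀ v, (ev v).Additive]

instance : (jointQuasiIso ev).HasTwoOutOfThreeProperty where
  comp_mem f g hf hg v := by
    have := hf v
    have := hg v
    rw [Functor.map_comp]
    exact quasiIso_comp _ _
  of_postcomp f g hg hfg v := by
    have := hg v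
    have := hfg v
    rw [Functor.map_comp] at this
    exact quasiIso_of_comp_right _ (((ev v).mapHomologicalComplex _).map g)
  of_precomp f g hf hfg v := by
    have := hf v
    have := hfg v
    rw [Functor.map_comp] at this
    exact quasiIso_of_comp_left (((ev v).mapHomologicalComplex _).map f) _

/-- The mapping cone of a natural transformation between functors, as a functor on complexes. -/
def coneFunctor {D : Type*} [Category* D] [Preadditive D] {F G : D ⥤ C} [F.Additive] [G.Additive] (α : F ⟶ G) :
    CochainComplex D ℤ ⥤ CochainComplex C ℤ where
  obj K := mappingCone ((NatTrans.mapHomologicalComplex α (ComplexShape.up ℤ)).app K)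
  map f := mappingCone.map _ _ ((F.mapHomologicalComplex _).map f)
    ((G.mapHomologicalComplex _).map f)
    ((NatTrans.mapHomologicalComplex α _).naturality f).symm
  map_id K := by
    simp only [CategoryTheory.Functor.map_id]
    exact mappingCone.map_id _
  map_comp f g := by
    simp only [CategoryTheory.Functor.map_comp]
    exact mappingCone.map_comp _ _ _ _ _ _ _ _ _

/-- The mapping cocone of a natural transformation between functors, as a functor on complexes. -/
def coconeFunctor {D : Type*} [Category* D] [Preadditive D] {F G : D ⥤ C} [F.Additive] [G.Additive] (α : F ⟶ G) :
    CochainComplex D ℤ ⥤ CochainComplex C ℤ where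
  obj K := mappingCocone ((NatTrans.mapHomologicalComplex α (ComplexShape.up ℤ)).app K)
  map f := mappingCocone.map _ _ ((F.mapHomologicalComplex _).map f)
    ((G.mapHomologicalComplex _).map f)
    ((NatTrans.mapHomologicalComplex α _).naturality f).symm
  map_id K := by
    simp only [CategoryTheory.Functor.map_id]
    exact mappingCocone.map_id _
  map_comp f g := by
    simp only [CategoryTheory.Functor.map_comp]
    exact mappingCocone.map_comp _ _ _ _ _ _ _ _ _

end Resolution

end CochainComplex

/-! ### Cones and cocones of degreewise short exact sequences -/

namespace CochainComplex

open Limits HomComplex Pretriangulated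

section Resolution

variable {C : Type*} [Category* C] [Preadditive C] [HasBinaryBiproducts C]
  {𝒱 : Type*} [Category* 𝒱] [Abelian 𝒱] (F : C ⥤ 𝒱) [F.Additive]

section

variable {K L : CochainComplex C ℤ} (φ : K ⟶ L)

lemma mappingCone.map_obj_ext_to (i j : ℤ) (hij : i + 1 = j) {A : 𝒱}
    {f g : A ⟶ F.obj ((mappingCone φ).X i)}
    (h₁ : f ≫ F.map ((mappingCone.fst φ).1.v i j hij) =
      g ≫ F.map ((mappingCone.fst φ).1.v i j hij))
    (h₂ : f ≫ F.map ((mappingCone.snd φ).v i i (add_zero i)) =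
      g ≫ F.map ((mappingCone.snd φ).v i i (add_zero i))) : f = g := by
  rw [← Category.comp_id f, ← Category.comp_id g, ← F.map_id, ← mappingCone.id_X φ i j hij,
    F.map_add, F.map_comp, F.map_comp, Preadditive.comp_add,
    Preadditive.comp_add, reassoc_of% h₁, reassoc_of% h₂]

lemma mappingCocone.map_obj_ext_to (p q : ℤ) (hpq : p + -1 = q) {A : 𝒱}
    {f g : A ⟶ F.obj ((mappingCocone φ).X p)}
    (h₁ : f ≫ F.map ((mappingCocone.fst φ).f p) = g ≫ F.map ((mappingCocone.fst φ).f p))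
    (h₂ : f ≫ F.map ((mappingCocone.snd φ).v p q hpq) =
      g ≫ F.map ((mappingCocone.snd φ).v p q hpq)) : f = g := by
  rw [← Category.comp_id f, ← Category.comp_id g, ← F.map_id, ← mappingCocone.id_X φ p q hpq,
    F.map_add, F.map_comp, F.map_comp, Preadditive.comp_add,
    Preadditive.comp_add, reassoc_of% h₁, reassoc_of% h₂]

end

/-- If `0 ⟶ X ⟶ Y ⟶ K ⟶ 0` becomes degreewise short exact after applying an additive functor,
then the morphism from the mapping cone of `X ⟶ Y` to `K` becomes a quasi-isomorphism. -/
lemma quasiIso_map_desc {X Y K : CochainComplex C ℤ} (α : X ⟶ Y) (π : Y ⟶ K) (w : α ≫ π = 0)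
    (h : ∀ n, (ShortComplex.mk (F.map (α.f n)) (F.map (π.f n))
      (by rw [← F.map_comp, ← HomologicalComplex.comp_f, w]; simp)).ShortExact) :
    QuasiIso ((F.mapHomologicalComplex (ComplexShape.up ℤ)).map
      (mappingCone.desc α 0 π (by simp [w]))) := by
  -- After applying `F`, the sequence cone(𝟙 X) → cone(α) → K is degreewise short exact, and its
  -- first term is contractible; so the second map is a quasi-isomorphism.
  let σ : mappingCone (𝟙 X) ⟶ mappingCone α := mappingCone.map _ _ (𝟙 X) α rfl
  let τ : mappingCone α ⟶ K := mappingCone.desc α 0 π (by simp [w])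
  have hστ : σ ≫ τ = 0 := by
    ext n
    have hw : α.f n ≫ π.f n = 0 := by rw [← HomologicalComplex.comp_f, w]; rfl
    simp [mappingCone.ext_from_iff _ (n + 1) n rfl, σ, τ, mappingCone.map, hw]
  have hσ₁ (n : ℤ) : σ.f n ≫ (mappingCone.fst α).1.v n (n + 1) rfl =
      (mappingCone.fst (𝟙 X)).1.v n (n + 1) rfl := by
    simp [mappingCone.ext_from_iff _ (n + 1) n rfl, σ, mappingCone.map]
  have hσ₂ (n : ℤ) : σ.f n ≫ (mappingCone.snd α).v n n (add_zero n) =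
      (mappingCone.snd (𝟙 X)).v n n (add_zero n) ≫ α.f n := by
    simp [mappingCone.ext_from_iff _ (n + 1) n rfl, σ, mappingCone.map]
  have hτ (n : ℤ) : τ.f n = (mappingCone.snd α).v n n (add_zero n) ≫ π.f n := by
    simp [mappingCone.ext_from_iff _ (n + 1) n rfl, τ]
  let S : ShortComplex (CochainComplex 𝒱 ℤ) :=
    ShortComplex.mk ((F.mapHomologicalComplex _).map σ) ((F.mapHomologicalComplex _).map τ)
      (by rw [← Functor.map_comp, hστ, CategoryTheory.Functor.map_zero])
  have hS : S.ShortExact := by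
    refine HomologicalComplex.shortExact_of_degreewise_shortExact _ fun n ↦ ?_
    have : Mono (F.map (α.f n)) := (h n).mono_f
    have : Epi (F.map (π.f n)) := (h n).epi_g
    refine ShortComplex.ShortExact.mk' ?_ ?_ ?_
    · rw [ShortComplex.exact_iff_exact_up_to_refinements]
      intro A (x : A ⟶ F.obj ((mappingCone α).X n)) (hx : x ≫ F.map (τ.f n) = 0)
      rw [hτ, F.map_comp] at hx
      obtain ⟨A', p, hp, (y : A' ⟶ F.obj (X.X n)), hy⟩ := (h n).exact.exact_up_to_refinements
        (x ≫ F.map ((mappingCone.snd α).v n n (add_zero n))) (by simpa using hx)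
      have hy' : p ≫ x ≫ F.map ((mappingCone.snd α).v n n (add_zero n)) = y ≫ F.map (α.f n) := hy
      -- The preimage keeps the first component of `x`, on which `σ` is the identity, and uses the
      -- lift `y` through `α` as its second component.
      have key : p ≫ x = (p ≫ x ≫ F.map ((mappingCone.fst α).1.v n (n + 1) rfl) ≫
          F.map ((mappingCone.inl (𝟙 X)).v (n + 1) n (by lia)) +
            y ≫ F.map ((mappingCone.inr (𝟙 X)).f n)) ≫ F.map (σ.f n) := by
        refine mappingCone.map_obj_ext_to F α n (n + 1) rfl ?_ ?_
        · simp only [Category.assoc, ← F.map_comp, hσ₁, Preadditive.add_comp]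
          simp
        · simp only [Category.assoc, ← F.map_comp, hσ₂, Preadditive.add_comp]
          simpa using hy'
      exact ⟨A', p, hp, _, key⟩
    · change Mono (F.map (σ.f n))
      rw [Preadditive.mono_iff_cancel_zero]
      intro A x hx
      refine mappingCone.map_obj_ext_to F _ n (n + 1) rfl ?_ ?_
      · have := hx =≫ F.map ((mappingCone.fst α).1.v n (n + 1) rfl)
        rwa [Category.assoc, ← F.map_comp, hσ₁, zero_comp, ← zero_comp] at this
      · have := hx =≫ F.map ((mappingCone.snd α).v n n (add_zero n))
        rw [Category.assoc, ← F.map_comp, hσ₂, zero_comp, F.map_comp, ← Category.assoc,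
          ← zero_comp, cancel_mono] at this
        rw [this, zero_comp]
    · change Epi (F.map (τ.f n))
      have : F.map ((mappingCone.inr α).f n) ≫ F.map (τ.f n) = F.map (π.f n) := by
        rw [hτ, ← F.map_comp]
        simp
      exact epi_of_epi_fac this
  exact quasiIso_g_of_acyclic hS (acyclic_map_mappingCone_id F X)

/-- If `0 ⟶ K ⟶ X ⟶ Y ⟶ 0` becomes degreewise short exact after applying an additive functor,
then the morphism from `K` to the mapping cocone of `X ⟶ Y` becomes a quasi-isomorphism. -/
lemma quasiIso_map_lift {K X Y : CochainComplex C ℤ} (β : K ⟶ X) (γ : X ⟶ Y) (w : β ≫ γ = 0)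
    (h : ∀ n, (ShortComplex.mk (F.map (β.f n)) (F.map (γ.f n))
      (by rw [← F.map_comp, ← HomologicalComplex.comp_f, w]; simp)).ShortExact) :
    QuasiIso ((F.mapHomologicalComplex (ComplexShape.up ℤ)).map
      (mappingCocone.lift γ β 0 (by simp [w]))) := by
  -- Dually, K → cocone(γ) → cocone(𝟙 Y) is degreewise short exact after `F`, with contractible
  -- third term.
  let σ : K ⟶ mappingCocone γ := mappingCocone.lift γ β 0 (by simp [w])
  let τ : mappingCocone γ ⟶ mappingCocone (𝟙 Y) := mappingCocone.map _ _ γ (𝟙 Y) (by simp)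
  have hστ : σ ≫ τ = 0 := by
    ext n
    refine mappingCocone.ext_to (𝟙 Y) n _ rfl ?_ ?_
    · have hw : β.f n ≫ γ.f n = 0 := by rw [← HomologicalComplex.comp_f, w]; rfl
      rw [HomologicalComplex.comp_f, Category.assoc, mappingCocone.map_f_fst_f]
      simp [σ, hw]
    · simp [σ, τ]
  let S : ShortComplex (CochainComplex 𝒱 ℤ) :=
    ShortComplex.mk ((F.mapHomologicalComplex _).map σ) ((F.mapHomologicalComplex _).map τ)
      (by rw [← Functor.map_comp, hστ, CategoryTheory.Functor.map_zero])
  have hσ₁ (n : ℤ) : σ.f n ≫ (mappingCocone.fst γ).f n = β.f n := by simp [σ]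
  have hσ₂ (n : ℤ) : σ.f n ≫ (mappingCocone.snd γ).v n (n + -1) rfl = 0 := by simp [σ]
  have hτ₁ (n : ℤ) : τ.f n ≫ (mappingCocone.fst (𝟙 Y)).f n =
      (mappingCocone.fst γ).f n ≫ γ.f n := by simp [τ]
  have hτ₂ (n : ℤ) : τ.f n ≫ (mappingCocone.snd (𝟙 Y)).v n (n + -1) rfl =
      (mappingCocone.snd γ).v n (n + -1) rfl := by simp [τ]
  have hS : S.ShortExact := by
    refine HomologicalComplex.shortExact_of_degreewise_shortExact _ fun n ↦ ?_
    have : Mono (F.map (β.f n)) := (h n).mono_f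
    have : Epi (F.map (γ.f n)) := (h n).epi_g
    refine ShortComplex.ShortExact.mk' ?_ ?_ ?_
    · rw [ShortComplex.exact_iff_exact_up_to_refinements]
      intro A (x : A ⟶ F.obj ((mappingCocone γ).X n)) (hx : x ≫ F.map (τ.f n) = 0)
      have hx₁ := hx =≫ F.map ((mappingCocone.fst (𝟙 Y)).f n)
      have hx₂ := hx =≫ F.map ((mappingCocone.snd (𝟙 Y)).v n (n + -1) rfl)
      rw [Category.assoc, ← F.map_comp, hτ₁, zero_comp, F.map_comp, ← Category.assoc] at hx₁
      rw [Category.assoc, ← F.map_comp, hτ₂, zero_comp] at hx₂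
      obtain ⟨A', p, hp, (y : A' ⟶ F.obj (K.X n)), hy⟩ := (h n).exact.exact_up_to_refinements
        (x ≫ F.map ((mappingCocone.fst γ).f n)) hx₁
      have hy' : p ≫ x ≫ F.map ((mappingCocone.fst γ).f n) = y ≫ F.map (β.f n) := hy
      have key : p ≫ x = y ≫ F.map (σ.f n) := by
        refine mappingCocone.map_obj_ext_to F γ n _ rfl ?_ ?_
        · rw [Category.assoc, Category.assoc, ← F.map_comp (σ.f n), hσ₁, hy']
        · rw [Category.assoc, Category.assoc, ← F.map_comp (σ.f n), hσ₂, hx₂]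
          simp
      exact ⟨A', p, hp, _, key⟩
    · change Mono (F.map (σ.f n))
      have : F.map (σ.f n) ≫ F.map ((mappingCocone.fst γ).f n) = F.map (β.f n) := by
        rw [← F.map_comp, hσ₁]
      exact mono_of_mono_fac this
    · change Epi (F.map (τ.f n))
      rw [epi_iff_surjective_up_to_refinements]
      intro A y
      obtain ⟨A', p, hp, x, hx⟩ := surjective_up_to_refinements_of_epi (F.map (γ.f n))
        (y ≫ F.map ((mappingCocone.fst (𝟙 Y)).f n))
      -- The first component of `y` is lifted through the epimorphism `γ`; the second one needs no
      -- lifting, since `τ` is the identity there.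
      refine ⟨A', p, hp, x ≫ F.map ((mappingCocone.inl γ).v n n (add_zero n)) +
        p ≫ y ≫ F.map ((mappingCocone.snd (𝟙 Y)).v n (n + -1) rfl) ≫
          F.map ((mappingCocone.inr γ).1.v (n + -1) n (by lia)), ?_⟩
      refine mappingCocone.map_obj_ext_to F _ n _ rfl ?_ ?_
      · simp only [Category.assoc, ← F.map_comp, hτ₁, Preadditive.add_comp]
        simp [hx]
      · simp only [Category.assoc, ← F.map_comp, hτ₂, Preadditive.add_comp]
        simp
  exact quasiIso_f_of_acyclic hS (acyclic_map_mappingCocone_id F Y)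

end Resolution

end CochainComplex

/-! ### Equivalences of localizations from functorial resolutions -/

namespace CategoryTheory.LocalizerMorphism

open CategoryTheory.Localization CategoryTheory.Functor

variable {C₁ C₂ : Type*} [Category* C₁] [Category* C₂]
  {W₁ : MorphismProperty C₁} {W₂ : MorphismProperty C₂} (Φ : LocalizerMorphism W₁ W₂)

/-- Both transformations become isomorphisms after localization, so the two localized functors are
mutually inverse. No adjunction or triangle identity is required. -/
lemma isLocalizedEquivalence_of_counit_of_counit (Ψ : LocalizerMorphism W₂ W₁)
    (ε₁ : Φ.functor ⋙ Ψ.functor ⟶ 𝟭 C₁) (ε₂ : Ψ.functor ⋙ Φ.functor ⟶ 𝟭 C₂)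
    (hε₁ : ∀ X₁, W₁ (ε₁.app X₁)) (hε₂ : ∀ X₂, W₂ (ε₂.app X₂)) :
    Φ.IsLocalizedEquivalence where
  isEquivalence := by
    have : IsIso (whiskerRight ε₁ W₁.Q) := by
      rw [NatTrans.isIso_iff_isIso_app]
      exact fun _ ↦ Localization.inverts W₁.Q W₁ _ (hε₁ _)
    have : IsIso (whiskerRight ε₂ W₂.Q) := by
      rw [NatTrans.isIso_iff_isIso_app]
      exact fun _ ↦ Localization.inverts W₂.Q W₂ _ (hε₂ _)
    refine (Localization.equivalence W₁.Q W₁ W₂.Q W₂ (Φ.functor ⋙ W₂.Q)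
      (Φ.localizedFunctor W₁.Q W₂.Q)
      (Ψ.functor ⋙ W₁.Q) (Ψ.localizedFunctor W₂.Q W₁.Q) ?_ ?_).isEquivalence_functor
    · exact Functor.associator _ _ _ ≪≫
        isoWhiskerLeft _ (CatCommSq.iso Ψ.functor W₂.Q W₁.Q _).symm ≪≫
        (Functor.associator _ _ _).symm ≪≫
        asIso (whiskerRight ε₁ W₁.Q) ≪≫ Functor.leftUnitor _
    · exact Functor.associator _ _ _ ≪≫
        isoWhiskerLeft _ (CatCommSq.iso Φ.functor W₁.Q W₂.Q _).symm ≪≫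
        (Functor.associator _ _ _).symm ≪≫
        asIso (whiskerRight ε₂ W₂.Q) ≪≫ Functor.leftUnitor _

/-- A fully faithful functor such that every object has a functorial left resolution by objects
of the source induces an equivalence after localization. -/
lemma isLocalizedEquivalence_of_functorial_left_resolutions [Φ.functor.Full] [Φ.functor.Faithful]
    [W₂.HasTwoOutOfThreeProperty] (hW₁ : W₁ = W₂.inverseImage Φ.functor) {ρ : C₂ ⥤ C₁}
    (p : ρ ⋙ Φ.functor ⟶ 𝟭 C₂) (hp : ∀ X₂, W₂ (p.app X₂)) :
    Φ.IsLocalizedEquivalence := by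
  let Ψ : LocalizerMorphism W₂ W₁ :=
    { functor := ρ
      map := by
        rw [hW₁]
        intro X Y f hf
        have := p.naturality f
        dsimp at this
        simp only [MorphismProperty.inverseImage_iff]
        rw [← W₂.postcomp_iff _ _ (hp Y), this]
        exact W₂.comp_mem _ _ (hp X) hf }
  -- Full faithfulness of `Φ.functor` turns `p`, restricted to objects in its image, into a
  -- resolution map inside `C₁`.
  let q : Φ.functor ⋙ ρ ⟶ 𝟭 C₁ :=
    ((whiskeringRight C₁ C₁ C₂).obj Φ.functor).preimage
      (X := Φ.functor ⋙ ρ) (Y := 𝟭 C₁) (whiskerLeft Φ.functor p)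
  have hq (X : C₁) : Φ.functor.map (q.app X) = p.app (Φ.functor.obj X) :=
    NatTrans.congr_app (((whiskeringRight C₁ C₁ C₂).obj Φ.functor).map_preimage
      (X := Φ.functor ⋙ ρ) (Y := 𝟭 C₁) (whiskerLeft Φ.functor p)) X
  refine Φ.isLocalizedEquivalence_of_counit_of_counit Ψ q p (fun X ↦ ?_) hp
  have : W₂.inverseImage Φ.functor (q.app X) := by
    rw [MorphismProperty.inverseImage_iff, hq]
    exact hp _
  exact (congr_fun (congr_fun (congr_fun hW₁ _) _) _).mpr this

end CategoryTheory.LocalizerMorphism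

/-! ### Two-term resolutions of complexes in full subcategories -/

namespace CochainComplex

open Limits HomComplex Pretriangulated

section Functoriality

variable {C : Type*} [Category* C] [Preadditive C] [HasBinaryBiproducts C]

lemma mappingCone.map_desc_zero {X Y X' Y' K K' : CochainComplex C ℤ} (φ : X ⟶ Y) (φ' : X' ⟶ Y')
    (a : X ⟶ X') (b : Y ⟶ Y') (comm : φ ≫ b = a ≫ φ') (π : Y ⟶ K) (π' : Y' ⟶ K')
    (f : K ⟶ K') (w : φ ≫ π = 0) (w' : φ' ≫ π' = 0) (h : b ≫ π' = π ≫ f) :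
    mappingCone.map φ φ' a b comm ≫ mappingCone.desc φ' 0 π' (by simp [w']) =
      mappingCone.desc φ 0 π (by simp [w]) ≫ f := by
  ext n
  have := HomologicalComplex.congr_hom h n
  simp only [HomologicalComplex.comp_f] at this
  simp [mappingCone.ext_from_iff _ (n + 1) n rfl, mappingCone.map, this]

lemma mappingCocone.lift_zero_map {K K' X Y X' Y' : CochainComplex C ℤ} (φ : X ⟶ Y) (φ' : X' ⟶ Y')
    (a : X ⟶ X') (b : Y ⟶ Y') (comm : φ ≫ b = a ≫ φ') (β : K ⟶ X) (β' : K' ⟶ X')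
    (f : K ⟶ K') (w : β ≫ φ = 0) (w' : β' ≫ φ' = 0) (h : β ≫ a = f ≫ β') :
    mappingCocone.lift φ β 0 (by simp [w]) ≫ mappingCocone.map φ φ' a b comm =
      f ≫ mappingCocone.lift φ' β' 0 (by simp [w']) := by
  ext n
  have := HomologicalComplex.congr_hom h n
  simp only [HomologicalComplex.comp_f] at this
  refine mappingCocone.ext_to _ n _ rfl ?_ ?_
  · rw [HomologicalComplex.comp_f, Category.assoc, mappingCocone.map_f_fst_f]
    simp [this]
  · rw [HomologicalComplex.comp_f, Category.assoc, mappingCocone.map_f_snd_v]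
    simp

variable {D : Type*} [Category* D] [Preadditive D]

omit [HasBinaryBiproducts C] in
lemma mapHomologicalComplex_app_comp {Q₁ Q₀ I : D ⥤ C} [Q₁.Additive] [Q₀.Additive] [I.Additive] (α : Q₁ ⟶ Q₀)
    (π : Q₀ ⟶ I) (w : ∀ X, α.app X ≫ π.app X = 0) (K : CochainComplex D ℤ) :
    (NatTrans.mapHomologicalComplex α (ComplexShape.up ℤ)).app K ≫
      (NatTrans.mapHomologicalComplex π (ComplexShape.up ℤ)).app K = 0 := by
  ext n
  exact w _

omit [HasBinaryBiproducts C] in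
lemma comp_mapHomologicalComplex_app {Q₀ Q₁ I : D ⥤ C} [Q₀.Additive] [Q₁.Additive] [I.Additive] (β : I ⟶ Q₀)
    (γ : Q₀ ⟶ Q₁) (w : ∀ X, β.app X ≫ γ.app X = 0) (K : CochainComplex D ℤ) :
    (NatTrans.mapHomologicalComplex β (ComplexShape.up ℤ)).app K ≫
      (NatTrans.mapHomologicalComplex γ (ComplexShape.up ℤ)).app K = 0 := by
  ext n
  exact w _

/-- The morphism from the mapping cone of `α : Q₁ ⟶ Q₀` induced by `π : Q₀ ⟶ I`, when
`α ≫ π = 0`. -/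
def coneFunctorDesc {Q₁ Q₀ I : D ⥤ C} [Q₁.Additive] [Q₀.Additive] [I.Additive] (α : Q₁ ⟶ Q₀) (π : Q₀ ⟶ I)
    (w : ∀ X, α.app X ≫ π.app X = 0) : 
    coneFunctor α ⟶ I.mapHomologicalComplex (ComplexShape.up ℤ) where
  app K := mappingCone.desc _ 0
    ((NatTrans.mapHomologicalComplex π (ComplexShape.up ℤ)).app K) (by
      simp [mapHomologicalComplex_app_comp α π w])
  naturality K L f := by
    refine mappingCone.map_desc_zero _ _ _ _
      ((NatTrans.mapHomologicalComplex α _).naturality f).symm _ _ _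
      (mapHomologicalComplex_app_comp α π w K) (mapHomologicalComplex_app_comp α π w L) ?_
    ext n
    exact π.naturality (f.f n)

/-- The morphism to the mapping cocone of `γ : Q₀ ⟶ Q₁` induced by `β : I ⟶ Q₀`, when
`β ≫ γ = 0`. -/
def coconeFunctorLift {Q₀ Q₁ I : D ⥤ C} [Q₀.Additive] [Q₁.Additive] [I.Additive] (β : I ⟶ Q₀) (γ : Q₀ ⟶ Q₁)
    (w : ∀ X, β.app X ≫ γ.app X = 0) : 
    I.mapHomologicalComplex (ComplexShape.up ℤ) ⟶ coconeFunctor γ where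
  app K := mappingCocone.lift _
    ((NatTrans.mapHomologicalComplex β (ComplexShape.up ℤ)).app K) 0 (by
      simp [comp_mapHomologicalComplex_app β γ w])
  naturality K L f := by
    refine (mappingCocone.lift_zero_map _ _ _ _
      ((NatTrans.mapHomologicalComplex γ _).naturality f).symm _ _ _
      (comp_mapHomologicalComplex_app β γ w K) (comp_mapHomologicalComplex_app β γ w L) ?_).symm
    ext n
    exact (β.naturality (f.f n)).symm

end Functoriality

section Resolution

variable {C : Type*} [Category* C] [Preadditive C] [HasBinaryBiproducts C]
  {𝒱 : Type*} [Category* 𝒱] [Abelian 𝒱] {ι : Type*} (ev : ι → C ⥤ 𝒱) [∀ v, (ev v).Additive]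

instance {P P' : ObjectProperty C} (h : P ≤ P') : (ObjectProperty.ιOfLE h).Additive where

omit [HasBinaryBiproducts C] in
lemma jointQuasiIso_eq_inverseImage {P P' : ObjectProperty C} (h : P ≤ P') :
    jointQuasiIso (fun v ↦ P.ι ⋙ ev v) =
      (jointQuasiIso (fun v ↦ P'.ι ⋙ ev v)).inverseImage
        ((ObjectProperty.ιOfLE h).mapHomologicalComplex (ComplexShape.up ℤ)) := rfl

/-- The inclusion of complexes in a full subcategory into complexes in a larger full
subcategory, as a morphism of localizers. -/
def localizerInclusion {P P' : ObjectProperty C} (h : P ≤ P') :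
    LocalizerMorphism (jointQuasiIso (fun v ↦ P.ι ⋙ ev v))
      (jointQuasiIso (fun v ↦ P'.ι ⋙ ev v)) :=
  .ofEq (jointQuasiIso_eq_inverseImage ev h)

variable {P P' : ObjectProperty C} (h : P ≤ P') [P.IsClosedUnderIsomorphisms]
  (hP : ∀ X Y, P X → P Y → P (X ⊞ Y))

include hP in
-- In degree n the cone is the biproduct of `K.X (n + 1)` and `L.X n`.
lemma prop_mappingCone_X {K L : CochainComplex C ℤ} (φ : K ⟶ L) (hK : ∀ n, P (K.X n))
    (hL : ∀ n, P (L.X n)) (n : ℤ) : P ((mappingCone φ).X n) :=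
  P.prop_of_iso (HomologicalComplex.homotopyCofiber.XIsoBiprod φ n (n + 1) rfl).symm
    (hP _ _ (hK _) (hL _))

include hP in
/-- If every object of a full subcategory has a functorial two-term left resolution by objects
of a smaller one, then complexes in both have the same localization. -/
lemma isLocalizedEquivalence_of_left_resolution {Q₁ Q₀ : P'.FullSubcategory ⥤ C} [Q₁.Additive] [Q₀.Additive]
    (h₁ : ∀ X, P (Q₁.obj X)) (h₀ : ∀ X, P (Q₀.obj X))
    (α : Q₁ ⟶ Q₀) (π : Q₀ ⟶ P'.ι) (w : ∀ X, α.app X ≫ π.app X = 0)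
    (hS : ∀ v X, (ShortComplex.mk ((ev v).map (α.app X)) ((ev v).map (π.app X))
      (by rw [← (ev v).map_comp, w, (ev v).map_zero])).ShortExact) :
    (localizerInclusion ev h).IsLocalizedEquivalence := by
  let J := P'.ι.mapHomologicalComplex (ComplexShape.up ℤ)
  let I := (ObjectProperty.ιOfLE h).mapHomologicalComplex (ComplexShape.up ℤ)
  -- A complex is resolved by the cone of `Q₁ K ⟶ Q₀ K`, the two functors being applied termwise.
  let ρ : CochainComplex P'.FullSubcategory ℤ ⥤ CochainComplex P.FullSubcategory ℤ :=
    HomologicalComplex.liftFunctorObjectProperty P (coneFunctor α) (fun K n ↦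
      prop_mappingCone_X hP _ (fun n ↦ h₁ (K.X n)) (fun n ↦ h₀ (K.X n)) n)
  -- The resolution map exists a priori only between complexes in `C`; it comes from
  -- `P'.FullSubcategory` because `J` is fully faithful.
  let p₀ : (ρ ⋙ I) ⋙ J ⟶ 𝟭 _ ⋙ J :=
    { app := fun K ↦ (coneFunctorDesc α π w).app K
      naturality := fun K L f ↦ (coneFunctorDesc α π w).naturality f }
  let p : ρ ⋙ I ⟶ 𝟭 _ := ((Functor.whiskeringRight _ _ _).obj J).preimage p₀
  have hp (K) : J.map (p.app K) = (coneFunctorDesc α π w).app K :=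
    NatTrans.congr_app (((Functor.whiskeringRight _ _ _).obj J).map_preimage p₀) K
  have : (localizerInclusion ev h).functor.Full := inferInstanceAs (I.Full)
  have : (localizerInclusion ev h).functor.Faithful := inferInstanceAs (I.Faithful)
  refine (localizerInclusion ev h).isLocalizedEquivalence_of_functorial_left_resolutions
    rfl (ρ := ρ) p fun K v ↦ ?_
  change QuasiIso (((ev v).mapHomologicalComplex _).map (J.map (p.app K)))
  rw [hp]
  exact quasiIso_map_desc (ev v) _ _
    (mapHomologicalComplex_app_comp α π w K) fun n ↦ hS v (K.X n)

include hP in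
/-- If every object of a full subcategory has a functorial two-term right resolution by objects
of a smaller one, then complexes in both have the same localization. -/
lemma isLocalizedEquivalence_of_right_resolution {Q₀ Q₁ : P'.FullSubcategory ⥤ C} [Q₁.Additive] [Q₀.Additive]
    (h₀ : ∀ X, P (Q₀.obj X)) (h₁ : ∀ X, P (Q₁.obj X))
    (β : P'.ι ⟶ Q₀) (γ : Q₀ ⟶ Q₁) (w : ∀ X, β.app X ≫ γ.app X = 0)
    (hS : ∀ v X, (ShortComplex.mk ((ev v).map (β.app X)) ((ev v).map (γ.app X))
      (by rw [← (ev v).map_comp, w, (ev v).map_zero])).ShortExact) :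
    (localizerInclusion ev h).IsLocalizedEquivalence := by
  let J := P'.ι.mapHomologicalComplex (ComplexShape.up ℤ)
  let I := (ObjectProperty.ιOfLE h).mapHomologicalComplex (ComplexShape.up ℤ)
  let ρ : CochainComplex P'.FullSubcategory ℤ ⥤ CochainComplex P.FullSubcategory ℤ :=
    HomologicalComplex.liftFunctorObjectProperty P (coconeFunctor γ) (fun K n ↦
      -- The terms of a cocone are terms of the cone in a shifted degree, so the lemma on cones
      -- applies.
      prop_mappingCone_X hP ((NatTrans.mapHomologicalComplex γ _).app K)
        (fun n ↦ h₀ (K.X n)) (fun n ↦ h₁ (K.X n)) _)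
  let p₀ : 𝟭 _ ⋙ J ⟶ (ρ ⋙ I) ⋙ J :=
    { app := fun K ↦ (coconeFunctorLift β γ w).app K
      naturality := fun K L f ↦ (coconeFunctorLift β γ w).naturality f }
  let p : 𝟭 _ ⟶ ρ ⋙ I := ((Functor.whiskeringRight _ _ _).obj J).preimage p₀
  have hp (K) : J.map (p.app K) = (coconeFunctorLift β γ w).app K :=
    NatTrans.congr_app (((Functor.whiskeringRight _ _ _).obj J).map_preimage p₀) K
  have : (localizerInclusion ev h).functor.Full := inferInstanceAs (I.Full)
  have : (localizerInclusion ev h).functor.Faithful := inferInstanceAs (I.Faithful)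
  refine (localizerInclusion ev h).isLocalizedEquivalence_of_functorial_right_resolutions
    (ρ := ρ) p (fun K v ↦ ?_) rfl
  change QuasiIso (((ev v).mapHomologicalComplex _).map (J.map (p.app K)))
  rw [hp]
  exact quasiIso_map_lift (ev v) _ _
    (comp_mapHomologicalComplex_app β γ w K) fun n ↦ hS v (K.X n)

end Resolution

end CochainComplex

/-! ### Comparing triangulated localizations and their bounded parts -/

namespace PiecewiseHereditary

open Limits Pretriangulated

section TriangulatedLocalization

variable {k : Type*} [Field k] {T D₁ D₂ : Type*} [Category* T] [Category* D₁] [Category* D₂]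
  [Preadditive T] [Preadditive D₁] [Preadditive D₂] [Linear k T] [Linear k D₁] [Linear k D₂]
  [HasZeroObject T] [HasZeroObject D₁] [HasZeroObject D₂]
  [HasShift T ℤ] [HasShift D₁ ℤ] [HasShift D₂ ℤ]
  [∀ n : ℤ, (shiftFunctor T n).Additive] [∀ n : ℤ, (shiftFunctor D₁ n).Additive]
  [∀ n : ℤ, (shiftFunctor D₂ n).Additive]
  [Pretriangulated T] [Pretriangulated D₁] [Pretriangulated D₂]

/-- Two triangulated localizations with respect to the same class of morphisms are triangle
equivalent, and so are triangulated subcategories which correspond to each other. -/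
lemma triangleEquivalent_fullSubcategory_of_isLocalization (L₁ : T ⥤ D₁) (L₂ : T ⥤ D₂)
    [L₁.CommShift ℤ] [L₂.CommShift ℤ] [L₁.IsTriangulated] [L₂.IsTriangulated]
    [L₁.Linear k] [L₂.Linear k] (W : MorphismProperty T) [W.IsCompatibleWithShift ℤ]
    [W.HasLeftCalculusOfFractions] [L₁.IsLocalization W] [L₂.IsLocalization W]
    (P₁ : ObjectProperty D₁) (P₂ : ObjectProperty D₂) [P₁.IsTriangulated] [P₂.IsTriangulated]
    [P₁.IsClosedUnderIsomorphisms] [P₂.IsClosedUnderIsomorphisms]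
    (h : ∀ X, P₁ (L₁.obj X) ↔ P₂ (L₂.obj X)) :
    TriangleEquivalent k P₁.FullSubcategory P₂.FullSubcategory := by
  let e : D₁ ≌ D₂ := Localization.uniq L₁ L₂ W
  let F : D₁ ⥤ D₂ := e.functor
  have : F.IsEquivalence := inferInstanceAs e.functor.IsEquivalence
  let iso : L₁ ⋙ F ≅ L₂ := Localization.compUniqFunctor L₁ L₂ W
  let _ : Localization.Lifting L₁ W L₂ F := ⟨iso⟩
  let _ : F.CommShift ℤ := Functor.commShiftOfLocalization L₁ W ℤ L₂ F
  have : NatTrans.CommShift iso.hom ℤ :=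
    NatTrans.commShift_iso_hom_of_localization L₁ W ℤ L₂ F
  -- By the calculus of fractions every arrow of `D₁` is, up to isomorphism, the image of an arrow
  -- of `T`. Thus every distinguished triangle of `D₁` comes from `T`, and it suffices that `L₁ ⋙ F
  -- ≅ L₂` is triangulated.
  have : L₁.mapArrow.EssSurj := Localization.essSurj_mapArrow L₁ W
  have : L₁.EssSurj := Localization.essSurj L₁ W
  have : L₂.EssSurj := Localization.essSurj L₂ W
  have : F.IsTriangulated := Functor.isTriangulated_of_precomp_iso iso
  have : F.Linear k := (Localization.functor_linear_iff L₁ W k L₂ F).1 inferInstance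
  -- Every object of `D₁` is isomorphic to some `L₁.obj X`, where the hypothesis `h` compares the
  -- two properties.
  have hF (Y : D₁) : P₁ Y ↔ P₂ (F.obj Y) := by
    let i := L₁.objObjPreimageIso Y
    rw [← P₁.prop_iff_of_iso i, h, ← P₂.prop_iff_of_iso (iso.app _), ← P₂.prop_iff_of_iso (F.mapIso i)]
    rfl
  let G : P₁.FullSubcategory ⥤ P₂.FullSubcategory := P₂.lift (P₁.ι ⋙ F) fun X ↦ (hF _).1 X.property
  have hG : G.FullyFaithful := .ofCompFaithful (G := P₂.ι)
    (P₁.fullyFaithfulι.comp (Functor.FullyFaithful.ofFullyFaithful F))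
  have := hG.full
  have := hG.faithful
  have : G.EssSurj := ⟨fun Y ↦ by
    let i := F.objObjPreimageIso Y.obj
    exact ⟨⟨F.objPreimage Y.obj, (hF _).2 ((P₂.prop_iff_of_iso i).2 Y.property)⟩,
      ⟨P₂.fullyFaithfulι.preimageIso i⟩⟩⟩
  refine ⟨G, inferInstance, inferInstance, ⟨fun f r ↦ ?_⟩, { }⟩
  apply P₂.ι.map_injective
  exact F.map_smul _ _

end TriangulatedLocalization

section Derived

open DerivedCategory.TStructure

variable {k : Type*} [Field k] {E 𝒜 ℬ : Type*} [Category* E] [Category* 𝒜] [Category* ℬ]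
  [Preadditive E] [HasZeroObject E] [HasBinaryBiproducts E] [Abelian 𝒜] [Abelian ℬ]
  [Linear k E] [Linear k 𝒜] [Linear k ℬ]
  [HasDerivedCategory 𝒜] [HasDerivedCategory ℬ]

/-- The homotopy category version of a presentation of a derived category as a localization. -/
lemma isLocalization_mapHomotopyCategory_comp_Qh (g : E ⥤ 𝒜) [g.Additive]
    [(g.mapHomologicalComplex (ComplexShape.up ℤ) ⋙ DerivedCategory.Q).IsLocalization
      ((HomologicalComplex.quasiIso 𝒜 (ComplexShape.up ℤ)).inverseImage
        (g.mapHomologicalComplex (ComplexShape.up ℤ)))] :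
    (g.mapHomotopyCategory (ComplexShape.up ℤ) ⋙ DerivedCategory.Qh).IsLocalization
      ((HomotopyCategory.subcategoryAcyclic 𝒜).inverseImage
        (g.mapHomotopyCategory (ComplexShape.up ℤ))).trW := by
  let W := (HomologicalComplex.quasiIso 𝒜 (ComplexShape.up ℤ)).inverseImage
        (g.mapHomologicalComplex (ComplexShape.up ℤ))
  let i : HomotopyCategory.quotient E (ComplexShape.up ℤ) ⋙
        g.mapHomotopyCategory (ComplexShape.up ℤ) ⋙ DerivedCategory.Qh ≅
      g.mapHomologicalComplex (ComplexShape.up ℤ) ⋙ DerivedCategory.Q :=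
    (Functor.associator _ _ _).symm ≪≫
      Functor.isoWhiskerRight (g.mapHomotopyCategoryFactors (ComplexShape.up ℤ)) _ ≪≫
      Functor.associator _ _ _ ≪≫
      Functor.isoWhiskerLeft _ (DerivedCategory.quotientCompQhIso 𝒜)
  have : (HomotopyCategory.quotient E (ComplexShape.up ℤ) ⋙
      g.mapHomotopyCategory (ComplexShape.up ℤ) ⋙ DerivedCategory.Qh).IsLocalization W :=
    Functor.IsLocalization.of_iso W i.symm
  -- The cone of a morphism becomes acyclic under `g` exactly when the morphism becomes a
  -- quasi-isomorphism.
  have key {K L : CochainComplex E ℤ} (f : K ⟶ L) :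
      ((HomotopyCategory.subcategoryAcyclic 𝒜).inverseImage
        (g.mapHomotopyCategory (ComplexShape.up ℤ))).trW
          ((HomotopyCategory.quotient E (ComplexShape.up ℤ)).map f) ↔ W f := by
    rw [ObjectProperty.inverseImage_trW_iff, ← HomotopyCategory.quasiIso_eq_trW_subcategoryAcyclic]
    exact HomotopyCategory.quotient_map_mem_quasiIso_iff _
  -- Localization in two stages: the homotopy category inverts homotopy equivalences, which belong
  -- to `W`, so the second functor is the localization at the images of the morphisms in `W`.
  refine Functor.IsLocalization.of_comp (HomotopyCategory.quotient E (ComplexShape.up ℤ)) _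
    (HomologicalComplex.homotopyEquivalences E (ComplexShape.up ℤ)) _ W ?_ ?_
  · intro K L f hf
    rw [← key]
    have : IsIso ((HomotopyCategory.quotient E (ComplexShape.up ℤ)).map f) :=
      Localization.inverts _ (HomologicalComplex.homotopyEquivalences E (ComplexShape.up ℤ)) _ hf
    exact MorphismProperty.of_isIso _ _
  · ext ⟨K⟩ ⟨L⟩ f
    obtain ⟨f, rfl⟩ := (HomotopyCategory.quotient E (ComplexShape.up ℤ)).map_surjective f
    constructor
    · intro hf
      exact MorphismProperty.map_mem_map _ _ _ ((key f).1 hf)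
    · rintro ⟨K', L', g, h, ⟨e⟩⟩
      rw [← key] at h
      exact (MorphismProperty.arrow_mk_iso_iff _ e).1 h

omit [HasZeroObject E] [HasBinaryBiproducts E] [HasDerivedCategory 𝒜] in
instance (g : E ⥤ 𝒜) [g.Additive] [g.Linear k] :
    (g.mapHomotopyCategory (ComplexShape.up ℤ)).Linear k where
  map_smul {K L} f r := by
    obtain ⟨f, rfl⟩ := (HomotopyCategory.quotient E (ComplexShape.up ℤ)).map_surjective f
    have h : (g.mapHomologicalComplex (ComplexShape.up ℤ)).map (r • f) =
        r • (g.mapHomologicalComplex (ComplexShape.up ℤ)).map f := by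
      ext n
      exact g.map_smul _ _
    have h' := (HomotopyCategory.quotient E (ComplexShape.up ℤ)).map_smul (X := K.as) (Y := L.as) r f
    refine (congr_arg (g.mapHomotopyCategory (ComplexShape.up ℤ)).map h'.symm).trans ?_
    exact (congr_arg (HomotopyCategory.quotient 𝒜 (ComplexShape.up ℤ)).map h).trans
      (CategoryTheory.Functor.map_smul _ _ _)

/-- If the derived categories of two abelian categories are presented by the same complexes
as localizations, then the bounded derived categories are triangle equivalent. -/
theorem triangleEquivalent_bounded (g : E ⥤ 𝒜) (h : E ⥤ ℬ) [g.Additive] [h.Additive]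
    [g.Linear k] [h.Linear k]
    [(g.mapHomologicalComplex (ComplexShape.up ℤ) ⋙ DerivedCategory.Q).IsLocalization
      ((HomologicalComplex.quasiIso 𝒜 (ComplexShape.up ℤ)).inverseImage
        (g.mapHomologicalComplex (ComplexShape.up ℤ)))]
    [(h.mapHomologicalComplex (ComplexShape.up ℤ) ⋙ DerivedCategory.Q).IsLocalization
      ((HomologicalComplex.quasiIso ℬ (ComplexShape.up ℤ)).inverseImage
        (h.mapHomologicalComplex (ComplexShape.up ℤ)))]
    (hac : ∀ K : CochainComplex E ℤ,
      ((g.mapHomologicalComplex (ComplexShape.up ℤ)).obj K).Acyclic ↔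
        ((h.mapHomologicalComplex (ComplexShape.up ℤ)).obj K).Acyclic)
    (hbd : ∀ K : CochainComplex E ℤ,
      (t (C := 𝒜)).bounded
          (DerivedCategory.Q.obj ((g.mapHomologicalComplex (ComplexShape.up ℤ)).obj K)) ↔
        (t (C := ℬ)).bounded
          (DerivedCategory.Q.obj ((h.mapHomologicalComplex (ComplexShape.up ℤ)).obj K))) :
    TriangleEquivalent k (DerivedCategory.Bounded 𝒜) (DerivedCategory.Bounded ℬ) := by
  have h₁ := isLocalization_mapHomotopyCategory_comp_Qh g
  have h₂ := isLocalization_mapHomotopyCategory_comp_Qh h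
  -- By `hac` the two classes of acyclic complexes in the homotopy category of `E` coincide, so both
  -- functors localize at the same morphisms.
  have : (HomotopyCategory.subcategoryAcyclic 𝒜).inverseImage
        (g.mapHomotopyCategory (ComplexShape.up ℤ)) =
      (HomotopyCategory.subcategoryAcyclic ℬ).inverseImage
        (h.mapHomotopyCategory (ComplexShape.up ℤ)) := by
    ext ⟨K⟩
    exact (HomotopyCategory.quotient_obj_mem_subcategoryAcyclic_iff_acyclic _).trans
      ((hac K).trans (HomotopyCategory.quotient_obj_mem_subcategoryAcyclic_iff_acyclic _).symm)
  rw [← this] at h₂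
  refine triangleEquivalent_fullSubcategory_of_isLocalization
    (g.mapHomotopyCategory (ComplexShape.up ℤ) ⋙ DerivedCategory.Qh)
    (h.mapHomotopyCategory (ComplexShape.up ℤ) ⋙ DerivedCategory.Qh)
    ((HomotopyCategory.subcategoryAcyclic 𝒜).inverseImage
      (g.mapHomotopyCategory (ComplexShape.up ℤ))).trW _ _ ?_
  rintro ⟨K⟩
  exact (ObjectProperty.prop_iff_of_iso _ ((DerivedCategory.quotientCompQhIso 𝒜).app _)).trans
    ((hbd K).trans
      (ObjectProperty.prop_iff_of_iso _ ((DerivedCategory.quotientCompQhIso ℬ).app _)).symm)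

end Derived

end PiecewiseHereditary

/-! ### Testing complexes at the vertices -/

namespace CochainComplex

open Limits

section JointlyConservative

variable {𝒜 𝒱 : Type*} [Category* 𝒜] [Category* 𝒱] [Abelian 𝒜] [Abelian 𝒱] {ι : Type*}
  (ev : ι → 𝒜 ⥤ 𝒱) [∀ v, (ev v).Additive] [∀ v, (ev v).PreservesHomology]
  (hev : ∀ ⦃X Y : 𝒜⦄ (f : X ⟶ Y), (∀ v, IsIso ((ev v).map f)) → IsIso f)

include hev

/-- Exact functors commute with homology, and a jointly conservative family detects whether the
induced map on homology is an isomorphism. -/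
lemma quasiIso_iff_forall_map {K L : CochainComplex 𝒜 ℤ} (φ : K ⟶ L) :
    QuasiIso φ ↔ ∀ v, QuasiIso (((ev v).mapHomologicalComplex (ComplexShape.up ℤ)).map φ) := by
  refine ⟨fun _ v ↦ inferInstance, fun h ↦ ⟨fun n ↦ ?_⟩⟩
  rw [quasiIsoAt_iff]
  let γ : ShortComplex.LeftHomologyMapData
    ((HomologicalComplex.shortComplexFunctor 𝒜 (ComplexShape.up ℤ) n).map φ)
    (K.sc n).leftHomologyData (L.sc n).leftHomologyData := default
  rw [γ.quasiIso_iff]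
  refine hev _ fun v ↦ ?_
  have h' := (h v).quasiIsoAt n
  rw [quasiIsoAt_iff] at h'
  exact ((γ.map (ev v)).quasiIso_iff).1 h'

lemma exactAt_iff_forall_map (K : CochainComplex 𝒜 ℤ) (n : ℤ) :
    K.ExactAt n ↔
      ∀ v, (((ev v).mapHomologicalComplex (ComplexShape.up ℤ)).obj K).ExactAt n := by
  refine ⟨fun h v ↦ h.map (ev v), fun h ↦ ?_⟩
  rw [HomologicalComplex.exactAt_iff, ShortComplex.exact_iff_isZero_leftHomology]
  -- The homology is killed by every evaluation, so its zero endomorphism is an isomorphism after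
  -- each of them, hence already before; this forces the homology to be zero.
  have h₀ : IsIso (0 : (K.sc n).leftHomology ⟶ (K.sc n).leftHomology) := by
    refine hev _ fun v ↦ ?_
    have : IsZero ((ev v).obj (K.sc n).leftHomology) := by
      have h' := h v
      rw [HomologicalComplex.exactAt_iff] at h'
      exact (((K.sc n).leftHomologyData.map (ev v)).exact_iff).1 h'
    exact ⟨0, this.eq_of_src _ _, this.eq_of_src _ _⟩
  rw [IsZero.iff_id_eq_zero, ← IsIso.hom_inv_id (0 : (K.sc n).leftHomology ⟶ (K.sc n).leftHomology), zero_comp]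

lemma acyclic_iff_forall_map (K : CochainComplex 𝒜 ℤ) :
    K.Acyclic ↔ ∀ v, (((ev v).mapHomologicalComplex (ComplexShape.up ℤ)).obj K).Acyclic := by
  simp only [HomologicalComplex.Acyclic, exactAt_iff_forall_map ev hev]
  exact ⟨fun h v n ↦ h n v, fun h n v ↦ h v n⟩

open DerivedCategory.TStructure in
omit hev in
lemma bounded_Q_obj_iff [HasDerivedCategory 𝒜] (K : CochainComplex 𝒜 ℤ) :
    (t (C := 𝒜)).bounded (DerivedCategory.Q.obj K) ↔ (∃ a, K.IsGE a) ∧ ∃ b, K.IsLE b := by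
  simp only [← DerivedCategory.isGE_Q_obj_iff, ← DerivedCategory.isLE_Q_obj_iff]
  rfl

open DerivedCategory.TStructure in
-- Exactness in each degree is tested vertexwise; finiteness of `ι` turns the bounds at the separate
-- vertices into common ones.
lemma bounded_iff_forall_map [Finite ι] [HasDerivedCategory 𝒜] [HasDerivedCategory 𝒱]
    (K : CochainComplex 𝒜 ℤ) :
    (t (C := 𝒜)).bounded (DerivedCategory.Q.obj K) ↔ ∀ v, (t (C := 𝒱)).bounded
      (DerivedCategory.Q.obj (((ev v).mapHomologicalComplex (ComplexShape.up ℤ)).obj K)) := by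
  have := Fintype.ofFinite ι
  simp only [bounded_Q_obj_iff, isGE_iff, isLE_iff, exactAt_iff_forall_map ev hev]
  constructor
  · rintro ⟨⟨a, ha⟩, ⟨b, hb⟩⟩ v
    exact ⟨⟨a, fun i hi ↦ ha i hi v⟩, ⟨b, fun i hi ↦ hb i hi v⟩⟩
  · intro h
    choose a ha using fun v ↦ (h v).1
    choose b hb using fun v ↦ (h v).2
    obtain ⟨a₀, ha₀⟩ := (Set.finite_range a).bddBelow
    obtain ⟨b₀, hb₀⟩ := (Set.finite_range b).bddAbove
    exact ⟨⟨a₀, fun i hi v ↦ ha v i (hi.trans_le (ha₀ ⟨v, rfl⟩))⟩,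
      ⟨b₀, fun i hi v ↦ hb v i ((hb₀ ⟨v, rfl⟩).trans_lt hi)⟩⟩

end JointlyConservative

section TwoOutOfThree

variable {𝒱 : Type*} [Category* 𝒱] [Abelian 𝒱]

/-- A property of complexes which holds for all three terms of a short exact sequence as soon as
it holds for two of them. -/
structure IsThick (P : ObjectProperty (CochainComplex 𝒱 ℤ)) : Prop where
  prop₁ {S : ShortComplex (CochainComplex 𝒱 ℤ)} (hS : S.ShortExact) (h₂ : P S.X₂) (h₃ : P S.X₃) :
    P S.X₁
  prop₂ {S : ShortComplex (CochainComplex 𝒱 ℤ)} (hS : S.ShortExact) (h₁ : P S.X₁) (h₃ : P S.X₃) :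
    P S.X₂
  prop₃ {S : ShortComplex (CochainComplex 𝒱 ℤ)} (hS : S.ShortExact) (h₁ : P S.X₁) (h₂ : P S.X₂) :
    P S.X₃

open DerivedCategory.TStructure Pretriangulated

variable [HasDerivedCategory 𝒱]

/-- Short exact sequences give distinguished triangles, and the bounded objects form a triangulated
subcategory. Together with acyclicity this is one of the two properties to be transferred between
the two algebras. -/
lemma isThick_bounded : IsThick (fun K : CochainComplex 𝒱 ℤ ↦
    (t (C := 𝒱)).bounded (DerivedCategory.Q.obj K)) where
  prop₁ hS h₂ h₃ := (t (C := 𝒱)).bounded.ext_of_isTriangulatedClosed₁ _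
    (DerivedCategory.triangleOfSES_distinguished hS) h₂ h₃
  prop₂ hS h₁ h₃ := (t (C := 𝒱)).bounded.ext_of_isTriangulatedClosed₂ _
    (DerivedCategory.triangleOfSES_distinguished hS) h₁ h₃
  prop₃ hS h₁ h₂ := (t (C := 𝒱)).bounded.ext_of_isTriangulatedClosed₃ _
    (DerivedCategory.triangleOfSES_distinguished hS) h₁ h₂

lemma isZero_Q_obj_iff_acyclic (K : CochainComplex 𝒱 ℤ) :
    IsZero (DerivedCategory.Q.obj K) ↔ K.Acyclic := by
  refine ⟨fun h n ↦ ?_, isZero_Q_obj_of_acyclic⟩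
  rw [HomologicalComplex.exactAt_iff_isZero_homology]
  exact (((DerivedCategory.homologyFunctorFactors 𝒱 n).app K).isZero_iff).1
    ((DerivedCategory.homologyFunctor 𝒱 n).map_isZero h)

lemma isThick_acyclic : IsThick (fun K : CochainComplex 𝒱 ℤ ↦ K.Acyclic) where
  prop₁ hS h₂ h₃ := by
    rw [← isZero_Q_obj_iff_acyclic] at *
    exact Triangle.isZero₁_of_isZero₂₃ _ (DerivedCategory.triangleOfSES_distinguished hS) h₂ h₃
  prop₂ hS h₁ h₃ := by
    rw [← isZero_Q_obj_iff_acyclic] at *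
    exact Triangle.isZero₂_of_isZero₁₃ _ (DerivedCategory.triangleOfSES_distinguished hS) h₁ h₃
  prop₃ hS h₁ h₂ := by
    rw [← isZero_Q_obj_iff_acyclic] at *
    exact Triangle.isZero₃_of_isZero₁₂ _ (DerivedCategory.triangleOfSES_distinguished hS) h₁ h₂

end TwoOutOfThree

section Equivalence

variable {𝒜 𝒱 R : Type*} [Category* 𝒜] [Category* 𝒱] [Category* R] [Abelian 𝒜] [Abelian 𝒱]
  [Preadditive R]

/-- The functor on complexes induced by an additive equivalence is an equivalence. -/
instance {R' : Type*} [Category* R'] [Preadditive R'] (F : R ⥤ R') [F.Additive]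
    [F.IsEquivalence] : (F.mapHomologicalComplex (ComplexShape.up ℤ)).IsEquivalence where
  essSurj := ⟨fun K ↦ by
    let e := F.asEquivalence
    have : e.functor.Additive := inferInstanceAs F.Additive
    have : e.inverse.Additive := inferInstance
    exact ⟨(e.inverse.mapHomologicalComplex _).obj K,
      ⟨(NatIso.mapHomologicalComplex e.counitIso (ComplexShape.up ℤ)).app K⟩⟩⟩

variable {ι : Type*} (e : 𝒜 ≌ R) [e.functor.Additive] (ev : ι → R ⥤ 𝒱) [∀ v, (ev v).Additive]
  [∀ v, (e.functor ⋙ ev v).PreservesHomology]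
  (hev : ∀ ⦃X Y : R⦄ (f : X ⟶ Y), (∀ v, IsIso ((ev v).map f)) → IsIso f)

/-- Evaluating the inverse equivalence. -/
def mapInverseIso (v : ι) :
    e.inverse.mapHomologicalComplex (ComplexShape.up ℤ) ⋙
      (e.functor ⋙ ev v).mapHomologicalComplex (ComplexShape.up ℤ) ≅
    (ev v).mapHomologicalComplex (ComplexShape.up ℤ) :=
  NatIso.mapHomologicalComplex (F := e.inverse ⋙ e.functor ⋙ ev v)
    (Functor.isoWhiskerRight e.counitIso (ev v)) (ComplexShape.up ℤ)

omit [e.functor.Additive] [∀ v, (ev v).Additive] [∀ v, (e.functor ⋙ ev v).PreservesHomology] in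
include hev in
lemma isIso_of_forall_map_functor ⦃X Y : 𝒜⦄ (f : X ⟶ Y)
    (h : ∀ v, IsIso ((e.functor ⋙ ev v).map f)) : IsIso f := by
  have : IsIso (e.functor.map f) := hev _ h
  exact isIso_of_reflects_iso f e.functor

include hev in
-- Vertexwise quasi-isomorphisms in a category `R` without given abelian structure are identified
-- with honest ones in the abelian category equivalent to it.
lemma jointQuasiIso_eq_inverseImage_inverse : jointQuasiIso ev =
    (HomologicalComplex.quasiIso 𝒜 (ComplexShape.up ℤ)).inverseImage
      (e.inverse.mapHomologicalComplex (ComplexShape.up ℤ)) := by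
  ext K L f
  refine Iff.trans ?_ (quasiIso_iff_forall_map (fun v ↦ e.functor ⋙ ev v)
    (isIso_of_forall_map_functor e ev hev) _).symm
  refine forall_congr' fun v ↦ ?_
  exact ((HomologicalComplex.quasiIso 𝒱 (ComplexShape.up ℤ)).arrow_mk_iso_iff
    (Arrow.isoOfNatIso (mapInverseIso e ev v) f)).symm

include hev in
lemma isLocalization_inverse_mapHomologicalComplex_comp_Q [HasDerivedCategory 𝒜] :
    (e.inverse.mapHomologicalComplex (ComplexShape.up ℤ) ⋙ DerivedCategory.Q).IsLocalization
      (jointQuasiIso ev) := by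
  let Φ : LocalizerMorphism (jointQuasiIso ev)
      (HomologicalComplex.quasiIso 𝒜 (ComplexShape.up ℤ)) :=
    .ofEq (jointQuasiIso_eq_inverseImage_inverse e ev hev)
  have : Φ.functor.IsEquivalence :=
    inferInstanceAs (e.inverse.mapHomologicalComplex (ComplexShape.up ℤ)).IsEquivalence
  have : Φ.IsLocalizedEquivalence := by
    -- An equivalence induces an equivalence of localizations once every morphism to be inverted is,
    -- up to isomorphism of arrows, the image of one to be inverted in the source.
    refine .of_equivalence _ ?_
    intro K L f hf
    refine ⟨_, _, Φ.functor.preimage ((Φ.functor.objObjPreimageIso K).hom ≫ f ≫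
      (Φ.functor.objObjPreimageIso L).inv), ?_, ⟨?_⟩⟩
    · refine (congr_fun (congr_fun (congr_fun
        (jointQuasiIso_eq_inverseImage_inverse e ev hev) _) _) _).mpr ?_
      change HomologicalComplex.quasiIso _ _ (Φ.functor.map _)
      rw [Functor.map_preimage]
      have : QuasiIso f := hf
      change QuasiIso _
      infer_instance
    · exact Arrow.isoMk (Φ.functor.objObjPreimageIso K) (Φ.functor.objObjPreimageIso L) (by simp)
  exact LocalizerMorphism.IsLocalizedEquivalence.isLocalization Φ DerivedCategory.Q

include hev in
lemma acyclic_inverse_iff (K : CochainComplex R ℤ) :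
    ((e.inverse.mapHomologicalComplex (ComplexShape.up ℤ)).obj K).Acyclic ↔
      ∀ v, (((ev v).mapHomologicalComplex (ComplexShape.up ℤ)).obj K).Acyclic := by
  rw [acyclic_iff_forall_map (fun v ↦ e.functor ⋙ ev v) (isIso_of_forall_map_functor e ev hev)]
  let _ : HasDerivedCategory 𝒱 := HasDerivedCategory.standard _
  refine forall_congr' fun v ↦ ?_
  rw [← isZero_Q_obj_iff_acyclic, ← isZero_Q_obj_iff_acyclic]
  exact (DerivedCategory.Q.mapIso ((mapInverseIso e ev v).app K)).isZero_iff

open DerivedCategory.TStructure in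
include hev in
lemma bounded_inverse_iff [Finite ι] [HasDerivedCategory 𝒜] [HasDerivedCategory 𝒱]
    (K : CochainComplex R ℤ) :
    (t (C := 𝒜)).bounded
        (DerivedCategory.Q.obj ((e.inverse.mapHomologicalComplex (ComplexShape.up ℤ)).obj K)) ↔
      ∀ v, (t (C := 𝒱)).bounded
        (DerivedCategory.Q.obj (((ev v).mapHomologicalComplex (ComplexShape.up ℤ)).obj K)) := by
  rw [bounded_iff_forall_map (fun v ↦ e.functor ⋙ ev v) (isIso_of_forall_map_functor e ev hev)]
  refine forall_congr' fun v ↦ ?_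
  exact ObjectProperty.prop_iff_of_iso _
    (DerivedCategory.Q.mapIso ((mapInverseIso e ev v).app K))

end Equivalence

end CochainComplex

/-! ### Presenting a derived category by complexes in an additive category -/

namespace CochainComplex

open Limits

section Presentation

variable {𝒜 E E' : Type*} [Category* 𝒜] [Abelian 𝒜] [HasDerivedCategory 𝒜]
  [Category* E] [Preadditive E] [Category* E'] [Preadditive E']

/-- A functor `G : E ⥤ 𝒜` presents the derived category of `𝒜` if it makes it a localization of
the category of complexes in `E`. -/
abbrev PresentsDerivedCategory (G : E ⥤ 𝒜) [G.Additive] : Prop :=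
  (G.mapHomologicalComplex (ComplexShape.up ℤ) ⋙ DerivedCategory.Q).IsLocalization
    ((HomologicalComplex.quasiIso 𝒜 (ComplexShape.up ℤ)).inverseImage
      (G.mapHomologicalComplex (ComplexShape.up ℤ)))

lemma PresentsDerivedCategory.equivalence_comp (F : E ⥤ E') [F.Additive] [F.IsEquivalence]
    (G : E' ⥤ 𝒜) [G.Additive] (hG : PresentsDerivedCategory G) :
    PresentsDerivedCategory (F ⋙ G) := by
  let W := (HomologicalComplex.quasiIso 𝒜 (ComplexShape.up ℤ)).inverseImage
      (G.mapHomologicalComplex (ComplexShape.up ℤ))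
  let Φ : LocalizerMorphism (W.inverseImage (F.mapHomologicalComplex (ComplexShape.up ℤ))) W :=
    .ofEq rfl
  have : Φ.functor.IsEquivalence :=
    inferInstanceAs (F.mapHomologicalComplex (ComplexShape.up ℤ)).IsEquivalence
  have : Φ.IsLocalizedEquivalence := by
    refine .of_equivalence _ ?_
    intro K L f hf
    refine ⟨_, _, Φ.functor.preimage ((Φ.functor.objObjPreimageIso K).hom ≫ f ≫
      (Φ.functor.objObjPreimageIso L).inv), ?_, ⟨?_⟩⟩
    · change W (Φ.functor.map _)
      rw [Functor.map_preimage]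
      rwa [W.cancel_left_of_respectsIso, W.cancel_right_of_respectsIso]
    · exact Arrow.isoMk (Φ.functor.objObjPreimageIso K) (Φ.functor.objObjPreimageIso L) (by simp)
  exact LocalizerMorphism.IsLocalizedEquivalence.isLocalization Φ
    (G.mapHomologicalComplex (ComplexShape.up ℤ) ⋙ DerivedCategory.Q)

variable {C 𝒱 : Type*} [Category* C] [Preadditive C] [HasBinaryBiproducts C] [Category* 𝒱]
  [Abelian 𝒱] {ι : Type*} (ev : ι → C ⥤ 𝒱) [∀ v, (ev v).Additive] {P P' P'' : ObjectProperty C}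

omit [HasBinaryBiproducts C] in
lemma isLocalizedEquivalence_localizerInclusion_trans (h : P ≤ P') (h' : P' ≤ P'')
    (H : (localizerInclusion ev h).IsLocalizedEquivalence)
    (H' : (localizerInclusion ev h').IsLocalizedEquivalence) :
    (localizerInclusion ev (h.trans h')).IsLocalizedEquivalence :=
  inferInstanceAs ((localizerInclusion ev h).comp (localizerInclusion ev h')).IsLocalizedEquivalence

omit [HasBinaryBiproducts C] in
-- Two comparisons are composed: complexes in `P` and in `P'` have the same localization by
-- resolutions, and complexes in `P'` are complexes in `𝒜` by the equivalence.
lemma presentsDerivedCategory_inclusion_comp_inverse (h : P ≤ P')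
    (H : (localizerInclusion ev h).IsLocalizedEquivalence)
    (e : 𝒜 ≌ P'.FullSubcategory) [e.functor.Additive]
    [∀ v, (e.functor ⋙ P'.ι ⋙ ev v).PreservesHomology]
    (hev : ∀ ⦃X Y : P'.FullSubcategory⦄ (f : X ⟶ Y), (∀ v, IsIso ((P'.ι ⋙ ev v).map f)) → IsIso f) :
    PresentsDerivedCategory (ObjectProperty.ιOfLE h ⋙ e.inverse) := by
  have := isLocalization_inverse_mapHomologicalComplex_comp_Q e (fun v ↦ P'.ι ⋙ ev v) hev
  have h₁ : ((ObjectProperty.ιOfLE h ⋙ e.inverse).mapHomologicalComplex (ComplexShape.up ℤ) ⋙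
      DerivedCategory.Q).IsLocalization (jointQuasiIso (fun v ↦ P.ι ⋙ ev v)) :=
    LocalizerMorphism.IsLocalizedEquivalence.isLocalization (localizerInclusion ev h)
      (e.inverse.mapHomologicalComplex (ComplexShape.up ℤ) ⋙ DerivedCategory.Q)
  rwa [jointQuasiIso_eq_inverseImage ev h, jointQuasiIso_eq_inverseImage_inverse e _ hev] at h₁

end Presentation

end CochainComplex

/-! ### The comparison theorem for two algebras with equivalent resolving subcategories -/

namespace PiecewiseHereditary

open Limits CochainComplex

/-- Bounded derived categories of module categories of two quivers with relations are triangle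
equivalent if they have resolutions by equivalent subcategories of representations, and the
equivalence respects vertexwise conditions on complexes. -/
theorem triangleEquivalent_bounded_of_resolutions {k : Type*} [Field k]
    {𝒜 𝒜' C C' 𝒱 : Type*} [Category* 𝒜] [Category* 𝒜'] [Abelian 𝒜] [Abelian 𝒜']
    [Linear k 𝒜] [Linear k 𝒜'] [HasDerivedCategory 𝒜] [HasDerivedCategory 𝒜']
    [Category* C] [Category* C'] [Preadditive C] [Preadditive C'] [Linear k C] [Linear k C']
    [Category* 𝒱] [Abelian 𝒱] {ι ι' : Type*} [Finite ι] [Finite ι']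
    (ev : ι → C ⥤ 𝒱) (ev' : ι' → C' ⥤ 𝒱) [∀ v, (ev v).Additive] [∀ v, (ev' v).Additive]
    {P₀ P : ObjectProperty C} {P₀' P' : ObjectProperty C'} (h : P ≤ P₀) (h' : P' ≤ P₀')
    [HasZeroObject P.FullSubcategory] [HasBinaryBiproducts P.FullSubcategory]
    (H : (localizerInclusion ev h).IsLocalizedEquivalence)
    (H' : (localizerInclusion ev' h').IsLocalizedEquivalence)
    (e : 𝒜 ≌ P₀.FullSubcategory) (e' : 𝒜' ≌ P₀'.FullSubcategory)
    [e.functor.Additive] [e'.functor.Additive] [e.functor.Linear k] [e'.functor.Linear k]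
    [∀ v, (e.functor ⋙ P₀.ι ⋙ ev v).PreservesHomology]
    [∀ v, (e'.functor ⋙ P₀'.ι ⋙ ev' v).PreservesHomology]
    (hev : ∀ ⦃X Y : C⦄ (f : X ⟶ Y), (∀ v, IsIso ((ev v).map f)) → IsIso f)
    (hev' : ∀ ⦃X Y : C'⦄ (f : X ⟶ Y), (∀ v, IsIso ((ev' v).map f)) → IsIso f)
    (Φ : P.FullSubcategory ⥤ P'.FullSubcategory) [Φ.IsEquivalence] [Φ.Additive] [Φ.Linear k]
    (hΦ : ∀ (T : ObjectProperty (CochainComplex 𝒱 ℤ)), IsThick T →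
      ∀ (K : CochainComplex P.FullSubcategory ℤ),
        (∀ v, T (((P.ι ⋙ ev v).mapHomologicalComplex (ComplexShape.up ℤ)).obj K)) ↔
          ∀ v, T (((Φ ⋙ P'.ι ⋙ ev' v).mapHomologicalComplex (ComplexShape.up ℤ)).obj K)) :
    TriangleEquivalent k (DerivedCategory.Bounded 𝒜) (DerivedCategory.Bounded 𝒜') := by
  let _ : HasDerivedCategory 𝒱 := HasDerivedCategory.standard _
  have hev₀ : ∀ ⦃X Y : P₀.FullSubcategory⦄ (f : X ⟶ Y),
      (∀ v, IsIso ((P₀.ι ⋙ ev v).map f)) → IsIso f := fun X Y f hf ↦ by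
    have : IsIso (P₀.ι.map f) := hev _ hf
    exact isIso_of_reflects_iso f P₀.ι
  have hev₀' : ∀ ⦃X Y : P₀'.FullSubcategory⦄ (f : X ⟶ Y),
      (∀ v, IsIso ((P₀'.ι ⋙ ev' v).map f)) → IsIso f := fun X Y f hf ↦ by
    have : IsIso (P₀'.ι.map f) := hev' _ hf
    exact isIso_of_reflects_iso f P₀'.ι
  have : (ObjectProperty.ιOfLE h).Linear k := ⟨fun _ _ ↦ rfl⟩
  have : (ObjectProperty.ιOfLE h').Linear k := ⟨fun _ _ ↦ rfl⟩
  have h₁ := presentsDerivedCategory_inclusion_comp_inverse ev h H e hev₀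
  have h₂ := (presentsDerivedCategory_inclusion_comp_inverse ev' h' H' e' hev₀').equivalence_comp Φ
  refine triangleEquivalent_bounded (ObjectProperty.ιOfLE h ⋙ e.inverse)
    (Φ ⋙ ObjectProperty.ιOfLE h' ⋙ e'.inverse) (fun K ↦ ?_) (fun K ↦ ?_)
  -- On either side the condition is tested at the vertices; `hΦ`, used for acyclicity here and for
  -- boundedness below, carries it across the equivalence `Φ`.
  · exact (acyclic_inverse_iff e (fun v ↦ P₀.ι ⋙ ev v) hev₀
      (((ObjectProperty.ιOfLE h).mapHomologicalComplex _).obj K)).trans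
      ((hΦ _ isThick_acyclic K).trans
        (acyclic_inverse_iff e' (fun v ↦ P₀'.ι ⋙ ev' v) hev₀'
          (((Φ ⋙ ObjectProperty.ιOfLE h').mapHomologicalComplex _).obj K)).symm)
  · exact (bounded_inverse_iff e (fun v ↦ P₀.ι ⋙ ev v) hev₀
      (((ObjectProperty.ιOfLE h).mapHomologicalComplex _).obj K)).trans
      ((hΦ _ isThick_bounded K).trans
        (bounded_inverse_iff e' (fun v ↦ P₀'.ι ⋙ ev' v) hev₀'
          (((Φ ⋙ ObjectProperty.ιOfLE h').mapHomologicalComplex _).obj K)).symm)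

end PiecewiseHereditary

namespace CategoryTheory.ObjectProperty

open Limits

variable {C : Type*} [Category* C] [Preadditive C] [HasBinaryBiproducts C] {P : ObjectProperty C}

lemma hasBinaryBiproducts_fullSubcategory (hP : ∀ X Y, P X → P Y → P (X ⊞ Y)) :
    HasBinaryBiproducts P.FullSubcategory where
  has_binary_biproduct X Y :=
    let b : BinaryBicone X Y :=
      { pt := ⟨X.obj ⊞ Y.obj, hP _ _ X.property Y.property⟩
        fst := P.homMk biprod.fst
        snd := P.homMk biprod.snd
        inl := P.homMk biprod.inl
        inr := P.homMk biprod.inr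
        inl_fst := by ext; exact biprod.inl_fst
        inl_snd := by ext; exact biprod.inl_snd
        inr_fst := by ext; exact biprod.inr_fst
        inr_snd := by ext; exact biprod.inr_snd }
    HasBinaryBiproduct.mk ⟨b, isBinaryBilimitOfTotal b (by
      apply P.ι.map_injective
      exact biprod.total (X := X.obj) (Y := Y.obj))⟩

end CategoryTheory.ObjectProperty

/-! ### Representations of a quiver -/

namespace PiecewiseHereditary

open Limits

/-- A representation of the quiver with vertices `V` and arrows `Arr`, where `s` and `t` are the
source and target of arrows. -/
structure QRep (k : Type u) [Field k] {V Arr : Type} (s t : Arr → V) where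
  /-- the vector space at a vertex -/
  obj : V → Type u
  [addCommGroup : ∀ v, AddCommGroup (obj v)]
  [module : ∀ v, Module k (obj v)]
  /-- the linear map of an arrow -/
  map : ∀ a, obj (s a) →ₗ[k] obj (t a)

namespace QRep

attribute [instance] QRep.addCommGroup QRep.module

variable {k : Type u} [Field k] {V Arr : Type} {s t : Arr → V}

/-- Morphisms of representations. -/
@[ext]
structure Hom (X Y : QRep k s t) where
  /-- the component at a vertex -/
  app : ∀ v, X.obj v →ₗ[k] Y.obj v
  comm : ∀ a x, app (t a) (X.map a x) = Y.map a (app (s a) x)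

instance : Category (QRep k s t) where
  Hom X Y := Hom X Y
  id X := ⟨fun _ ↦ LinearMap.id, fun _ _ ↦ rfl⟩
  comp f g := ⟨fun v ↦ g.app v ∘ₗ f.app v, fun a x ↦ by simp [f.comm, g.comm]⟩

variable {X Y Z : QRep k s t}

@[ext]
lemma hom_ext {f g : X ⟶ Y} (h : ∀ v x, f.app v x = g.app v x) : f = g :=
  Hom.ext (funext fun v ↦ LinearMap.ext (h v))

@[simp] lemma id_app (v : V) (x : X.obj v) : Hom.app (𝟙 X) v x = x := rfl

@[simp] lemma comp_app (f : X ⟶ Y) (g : Y ⟶ Z) (v : V) (x : X.obj v) :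
    (f ≫ g).app v x = g.app v (f.app v x) := rfl

instance : Zero (X ⟶ Y) := ⟨⟨fun _ ↦ 0, fun _ _ ↦ by simp⟩⟩
instance : Add (X ⟶ Y) :=
  ⟨fun f g ↦ ⟨fun v ↦ f.app v + g.app v, fun a x ↦ by simp [f.comm, g.comm]⟩⟩
instance : Neg (X ⟶ Y) := ⟨fun f ↦ ⟨fun v ↦ -f.app v, fun a x ↦ by simp [f.comm]⟩⟩
instance : Sub (X ⟶ Y) :=
  ⟨fun f g ↦ ⟨fun v ↦ f.app v - g.app v, fun a x ↦ by simp [f.comm, g.comm]⟩⟩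
instance {R : Type*} [Monoid R] [DistribMulAction R k] [SMulCommClass k R k]
    [∀ v, DistribMulAction R (Y.obj v)] [∀ v, SMulCommClass k R (Y.obj v)]
    [∀ a, LinearMap.CompatibleSMul (Y.obj (s a)) (Y.obj (t a)) R k] : SMul R (X ⟶ Y) :=
  ⟨fun c f ↦ ⟨fun v ↦ c • f.app v, fun a x ↦ by
    simp only [LinearMap.smul_apply, f.comm, LinearMap.map_smul_of_tower]⟩⟩

lemma app_injective : Function.Injective (fun (f : X ⟶ Y) ↦ f.app) := fun _ _ h ↦ Hom.ext h

instance : AddCommGroup (X ⟶ Y) :=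
  app_injective.addCommGroup (fun f : X ⟶ Y ↦ f.app) rfl (fun _ _ ↦ rfl) (fun _ ↦ rfl)
    (fun _ _ ↦ rfl) (fun _ _ ↦ rfl) (fun _ _ ↦ rfl)

/-- Components, as an additive homomorphism. -/
def appHom (X Y : QRep k s t) : (X ⟶ Y) →+ (∀ v, X.obj v →ₗ[k] Y.obj v) where
  toFun f := f.app
  map_zero' := rfl
  map_add' _ _ := rfl

instance : Module k (X ⟶ Y) :=
  app_injective.module k (appHom X Y) (fun _ _ ↦ rfl)

instance : Preadditive (QRep k s t) where
  add_comp _ _ _ f f' g := by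
    ext v x
    exact (g.app v).map_add _ _
  comp_add _ _ _ f g g' := rfl

instance : Linear k (QRep k s t) where
  smul_comp _ _ _ r f g := by
    ext v x
    exact (g.app v).map_smul _ _
  comp_smul _ _ _ f r g := rfl

variable (k s t) in
/-- Evaluation at a vertex. -/
def ev (v : V) : QRep k s t ⥤ ModuleCat.{u} k where
  obj X := ModuleCat.of k (X.obj v)
  map f := ModuleCat.ofHom (f.app v)

instance (v : V) : (ev k s t v).Additive where
  map_add := rfl

/-- The inverse of a morphism which is bijective at all vertices. -/
def isoOfBijective (f : X ⟶ Y) (hf : ∀ v, Function.Bijective (f.app v)) : X ≅ Y where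
  hom := f
  inv :=
    { app := fun v ↦ (LinearEquiv.ofBijective (f.app v) (hf v)).symm
      comm := fun a x ↦ (LinearEquiv.ofBijective (f.app (t a)) (hf (t a))).injective (by
        obtain ⟨x, rfl⟩ := (LinearEquiv.ofBijective (f.app (s a)) (hf (s a))).surjective x
        simp only [LinearEquiv.coe_coe, LinearEquiv.apply_symm_apply, LinearEquiv.symm_apply_apply]
        exact (f.comm a x).symm) }
  hom_inv_id := by
    ext v x
    exact (LinearEquiv.ofBijective (f.app v) (hf v)).symm_apply_apply x
  inv_hom_id := by
    ext v x
    exact (LinearEquiv.ofBijective (f.app v) (hf v)).apply_symm_apply x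

lemma isIso_of_bijective (f : X ⟶ Y) (hf : ∀ v, Function.Bijective (f.app v)) : IsIso f :=
  inferInstanceAs (IsIso (isoOfBijective f hf).hom)

/-- The joint conservativity required of evaluations by the vertexwise tests. -/
lemma isIso_of_forall_ev ⦃X Y : QRep k s t⦄ (f : X ⟶ Y) (h : ∀ v, IsIso ((ev k s t v).map f)) :
    IsIso f :=
  isIso_of_bijective f fun v ↦ by
    have := h v
    exact ConcreteCategory.bijective_of_isIso ((ev k s t v).map f)

@[simp] lemma hom_inv_app (e : X ≅ Y) (v : V) (x : X.obj v) : e.inv.app v (e.hom.app v x) = x := by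
  rw [← comp_app, e.hom_inv_id, id_app]

@[simp] lemma inv_hom_app (e : X ≅ Y) (v : V) (x : Y.obj v) : e.hom.app v (e.inv.app v x) = x := by
  rw [← comp_app, e.inv_hom_id, id_app]

/-- The linear equivalence at a vertex induced by an isomorphism. -/
def isoApp (e : X ≅ Y) (v : V) : X.obj v ≃ₗ[k] Y.obj v :=
  LinearEquiv.ofLinearMap (e.hom.app v) (e.inv.app v) (by ext; simp) (by ext; simp)

lemma map_eq_of_iso (e : X ≅ Y) (a : Arr) (y : Y.obj (s a)) :
    Y.map a y = e.hom.app _ (X.map a (e.inv.app _ y)) := by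
  rw [e.hom.comm, inv_hom_app]

/-- The direct sum of two representations. -/
abbrev prod (X Y : QRep k s t) : QRep k s t where
  obj v := X.obj v × Y.obj v
  map a := (X.map a).prodMap (Y.map a)

/-- The direct sum, as a bicone. -/
def prodBicone (X Y : QRep k s t) : BinaryBicone X Y where
  pt := prod X Y
  fst := ⟨fun _ ↦ LinearMap.fst _ _ _, fun _ _ ↦ rfl⟩
  snd := ⟨fun _ ↦ LinearMap.snd _ _ _, fun _ _ ↦ rfl⟩
  inl := ⟨fun _ ↦ LinearMap.inl _ _ _, fun _ _ ↦ by simp⟩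
  inr := ⟨fun _ ↦ LinearMap.inr _ _ _, fun _ _ ↦ by simp⟩
  inl_fst := rfl
  inl_snd := rfl
  inr_fst := rfl
  inr_snd := rfl

/-- The direct sum is a biproduct. -/
def prodIsBilimit (X Y : QRep k s t) : (prodBicone X Y).IsBilimit :=
  isBinaryBilimitOfTotal _ (by
    refine hom_ext fun v x ↦ ?_
    change ((x.1, 0) + (0, x.2) : X.obj v × Y.obj v) = x
    exact Prod.ext (add_zero x.1) (zero_add x.2))

instance : HasBinaryBiproducts (QRep k s t) where
  has_binary_biproduct X Y := HasBinaryBiproduct.mk ⟨_, prodIsBilimit X Y⟩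

variable (k s t) in
/-- The zero representation. -/
abbrev zeroRep : QRep k s t where
  obj _ := PUnit
  map _ := 0

lemma isZero_zeroRep : IsZero (zeroRep k s t) := by
  rw [IsZero.iff_id_eq_zero]
  rfl

section Properties

variable (P : ObjectProperty (QRep k s t)) [P.IsClosedUnderIsomorphisms]

lemma prop_biprod (hP : ∀ X Y, P X → P Y → P (prod X Y)) (X Y : QRep k s t) (hX : P X)
    (hY : P Y) : P (X ⊞ Y) :=
  P.prop_of_iso (biprod.uniqueUpToIso X Y (prodIsBilimit X Y)) (hP X Y hX hY)

end Properties

/-- A short complex of representations is short exact at each vertex if it is so elementwise. -/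
lemma shortExact_ev {v : V} {f : X ⟶ Y} {g : Y ⟶ Z}
    (w : (ev k s t v).map f ≫ (ev k s t v).map g = 0)
    (hf : Function.Injective (f.app v)) (hg : Function.Surjective (g.app v))
    (h : ∀ y, g.app v y = 0 → ∃ x, f.app v x = y) :
    (ShortComplex.mk ((ev k s t v).map f) ((ev k s t v).map g) w).ShortExact where
  exact := (ShortComplex.moduleCat_exact_iff _).2 h
  mono_f := (ModuleCat.mono_iff_injective _).2 hf
  epi_g := (ModuleCat.epi_iff_surjective _).2 hg

end QRep

end PiecewiseHereditary

/-! ### Right modules as representations -/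

namespace PiecewiseHereditary

open Limits MulOpposite
open scoped ModuleCat

/-- Orthogonal idempotents and elements compatible with them which generate an algebra. The
orientation of the arrows is that of the action on right modules. -/
structure IsQuiverPresentation (k : Type u) [Field k] {A : Type u} [Ring A] [Algebra k A]
    {V Arr : Type} [Fintype V] (s t : Arr → V) (e : V → A) (p : Arr → A) : Prop where
  mul_self : ∀ v, e v * e v = e v
  mul_of_ne : ∀ v w, v ≠ w → e v * e w = 0
  sum_eq_one : ∑ v, e v = 1
  left_mul : ∀ a, e (s a) * p a = p a
  mul_right : ∀ a, p a * e (t a) = p a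
  adjoin_eq_top : Algebra.adjoin k (Set.range e ∪ Set.range p) = ⊤

namespace IsQuiverPresentation

variable {k : Type u} [Field k] {A : Type u} [Ring A] [Algebra k A] {V Arr : Type} [Fintype V]
  {s t : Arr → V} {e : V → A} {p : Arr → A}

/-- The part of a right module at a vertex. -/
def vertexSubmodule (k : Type u) [Field k] {A : Type u} [Ring A] [Algebra k A] (x : A)
    (M : ModuleCat.{u} Aᵐᵒᵖ) : Submodule k M where
  carrier := {m | op x • m = m}
  zero_mem' := smul_zero _
  add_mem' {a b} ha hb := by
    change _ • (a + b) = a + b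
    rw [smul_add, ha, hb]
  smul_mem' c m hm := by
    change _ • (c • m) = c • m
    rw [smul_comm, hm]

lemma mem_vertexSubmodule {x : A} {M : ModuleCat.{u} Aᵐᵒᵖ} {m : M} :
    m ∈ vertexSubmodule k x M ↔ op x • m = m := Iff.rfl

lemma op_smul_op_smul {M : ModuleCat.{u} Aᵐᵒᵖ} (x y : A) (m : M) :
    op x • op y • m = op (y * x) • m := by
  rw [smul_smul, ← op_mul]

lemma hom_smul {M N : ModuleCat.{u} Aᵐᵒᵖ} (f : M ⟶ N) (c : k) (m : M) :
    f.hom (c • m) = c • f.hom m :=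
  (f.hom.restrictScalars k).map_smul c m

variable (h : IsQuiverPresentation k s t e p)

include h in
lemma op_smul_mem (M : ModuleCat.{u} Aᵐᵒᵖ) (v : V) (m : M) :
    op (e v) • m ∈ vertexSubmodule k (e v) M := by
  rw [mem_vertexSubmodule, op_smul_op_smul, h.mul_self]

/-- The projection to the part at a vertex. -/
def proj (M : ModuleCat.{u} Aᵐᵒᵖ) (v : V) : M →ₗ[k] vertexSubmodule k (e v) M where
  toFun m := ⟨op (e v) • m, h.op_smul_mem M v m⟩
  map_add' _ _ := Subtype.ext (smul_add _ _ _)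
  map_smul' c x := Subtype.ext (smul_comm _ c x)

lemma proj_coe (M : ModuleCat.{u} Aᵐᵒᵖ) (v : V) (m : M) : (h.proj M v m).1 = op (e v) • m := rfl

lemma proj_of_mem (M : ModuleCat.{u} Aᵐᵒᵖ) (v : V) (m : vertexSubmodule k (e v) M) :
    h.proj M v m.1 = m := Subtype.ext m.2

lemma proj_of_mem_of_ne (M : ModuleCat.{u} Aᵐᵒᵖ) (v w : V) (hw : w ≠ v)
    (m : vertexSubmodule k (e v) M) : h.proj M w m.1 = 0 :=
  Subtype.ext (by
    rw [proj_coe]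
    nth_rw 1 [← mem_vertexSubmodule.1 m.2]
    rw [op_smul_op_smul, h.mul_of_ne _ _ hw.symm, MulOpposite.op_zero, zero_smul]
    rfl)

/-- The representation associated to a right module. -/
abbrev repObj (M : ModuleCat.{u} Aᵐᵒᵖ) : QRep k s t where
  obj v := vertexSubmodule k (e v) M
  map a :=
    { toFun := fun m ↦ ⟨op (p a) • m.1, by
        rw [mem_vertexSubmodule, op_smul_op_smul, h.mul_right]⟩
      map_add' := fun x y ↦ Subtype.ext (smul_add _ _ _)
      map_smul' := fun c x ↦ Subtype.ext (smul_comm (op (p a)) c x.1) }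

/-- The functor from right modules to representations. -/
def rep : FDMod k A ⥤ QRep k s t where
  obj M := h.repObj M.obj
  map {M N} f :=
    { app := fun v ↦
        { toFun := fun m ↦ ⟨f.hom.hom m.1, by
            rw [mem_vertexSubmodule, ← LinearMap.map_smul, m.2]⟩
          map_add' := fun x y ↦ Subtype.ext (map_add f.hom.hom _ _)
          map_smul' := fun c x ↦ Subtype.ext (hom_smul f.hom c x.1) }
      comm := fun a x ↦ Subtype.ext (f.hom.hom.map_smul _ _) }

instance : h.rep.Additive where
  map_add := rfl

include h in
-- Because the idempotents sum to one, a module is the sum of its parts at the vertices, and a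
-- morphism is determined by its components.
lemma sum_op_smul (M : ModuleCat.{u} Aᵐᵒᵖ) (m : M) : ∑ v, op (e v) • m = m := by
  rw [← Finset.sum_smul, ← Finset.op_sum, h.sum_eq_one, op_one, one_smul]

instance : h.rep.Faithful where
  map_injective {M N f g} hfg := by
    ext m
    have key (v : V) (m : M.obj) : f.hom.hom (op (e v) • m) = g.hom.hom (op (e v) • m) :=
      congr_arg (fun φ : h.rep.obj M ⟶ h.rep.obj N ↦ (φ.app v (h.proj M.obj v m)).1) hfg
    change f.hom.hom m = g.hom.hom m
    rw [← h.sum_op_smul _ m, map_sum, map_sum]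
    exact Finset.sum_congr rfl fun v _ ↦ key v m

include h in
/-- An additive map which commutes with the idempotents and the arrows is linear. -/
lemma map_op_smul_of_generators {M N : ModuleCat.{u} Aᵐᵒᵖ} (F : M →ₗ[k] N)
    (he : ∀ v m, F (op (e v) • m) = op (e v) • F m)
    (hp : ∀ a m, F (op (p a) • m) = op (p a) • F m) (x : A) (m : M) :
    F (op x • m) = op x • F m := by
  have hx : x ∈ Algebra.adjoin k (Set.range e ∪ Set.range p) := h.adjoin_eq_top ▸ trivial
  induction hx using Algebra.adjoin_induction generalizing m with
  | mem x hx =>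
    obtain ⟨v, rfl⟩ | ⟨a, rfl⟩ := hx
    · exact he v m
    · exact hp a m
  | algebraMap c =>
    rw [← MulOpposite.algebraMap_apply, algebraMap_smul, algebraMap_smul, F.map_smul]
  | add x y _ _ hx hy => rw [MulOpposite.op_add, add_smul, add_smul, map_add, hx, hy]
  | mul x y _ _ hx hy => rw [op_mul, mul_smul, mul_smul, hy, hx]

instance : h.rep.Full where
  map_surjective {M N} φ := by
    let f (v : V) : vertexSubmodule k (e v) M.obj →ₗ[k] vertexSubmodule k (e v) N.obj := φ.app v
    -- The components of `φ` are added up along the decomposition of the modules. Linearity over the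
    -- algebra then only has to be checked on the generators.
    let F : M.obj →ₗ[k] N.obj :=
      ∑ v, (vertexSubmodule k (e v) N.obj).subtype ∘ₗ f v ∘ₗ h.proj M.obj v
    have hF (m : M.obj) : F m = ∑ v, (f v (h.proj M.obj v m)).1 := by
      simp [F]
    have hF' (v : V) (m : vertexSubmodule k (e v) M.obj) : F m.1 = (f v m).1 := by
      rw [hF, Finset.sum_eq_single v]
      · rw [h.proj_of_mem]
      · intro w _ hw
        rw [h.proj_of_mem_of_ne _ _ _ hw, map_zero]
        rfl
      · simp
    have he (v : V) (m : M.obj) : F (op (e v) • m) = op (e v) • F m := by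
      rw [← h.proj_coe, hF', hF, ← h.proj_coe, map_sum, Finset.sum_eq_single v]
      · rw [h.proj_of_mem]
      · intro w _ hw
        exact h.proj_of_mem_of_ne _ _ _ hw.symm _
      · simp
    have hp (a : Arr) (m : M.obj) : F (op (p a) • m) = op (p a) • F m := by
      -- An arrow only sees the part of the module at its source, where `φ.comm` applies.
      have h₁ : op (p a) • m = op (p a) • op (e (s a)) • m := by
        rw [op_smul_op_smul, h.left_mul]
      have h₂ : op (p a) • F m = op (p a) • op (e (s a)) • F m := by
        rw [op_smul_op_smul, h.left_mul]
      rw [h₁, h₂, ← he, ← h.proj_coe, hF']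
      refine (hF' _ ((h.repObj M.obj).map a (h.proj M.obj _ m))).trans ?_
      exact congr_arg Subtype.val (φ.comm a (h.proj M.obj _ m))
    refine ⟨ObjectProperty.homMk (ModuleCat.ofHom
      { toFun := F
        map_add' := F.map_add
        map_smul' := fun x m ↦ h.map_op_smul_of_generators F he hp x.unop m }), ?_⟩
    ext v m
    exact Subtype.ext (hF' v m)

include h in
/-- The functor to representations is exact. -/
lemma preservesHomology_rep_comp_ev (v : V) : (h.rep ⋙ QRep.ev k s t v).PreservesHomology := by
  have : (isFinDim k A).ι.PreservesHomology :=
    { preservesKernels := fun _ _ f ↦ (isFinDim k A).preservesKernels_ι f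
      preservesCokernels := fun _ _ f ↦ (isFinDim k A).preservesCokernels_ι f }
  refine Functor.preservesHomology_of_map_exact _ fun S hS ↦ ?_
  have hS' := (ShortComplex.moduleCat_exact_iff _).1 (hS.map (isFinDim k A).ι)
  refine (ShortComplex.moduleCat_exact_iff _).2 fun (y : vertexSubmodule k (e v) S.X₂.obj) hy ↦ ?_
  obtain ⟨x, hx⟩ := hS' y.1 (congr_arg Subtype.val hy)
  have hx' : S.f.hom.hom x = y.1 := hx
  -- A preimage in the whole module is moved into the part at `v` by the idempotent, which fixes its
  -- image `y`.
  refine ⟨⟨op (e v) • x, h.op_smul_mem _ v x⟩, Subtype.ext ?_⟩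
  exact (S.f.hom.hom.map_smul _ _).trans ((congr_arg (op (e v) • ·) hx').trans y.2)

section Realization

variable [DecidableEq V] (W : QRep k s t) [∀ v, Module.Finite k (W.obj v)]
  (τ : Aᵐᵒᵖ →ₐ[k] Module.End k (∀ v, W.obj v))

/-- The total space of a representation, as a right module. -/
def totalModule : ModuleCat.{u} Aᵐᵒᵖ :=
  letI : Module Aᵐᵒᵖ (∀ v, W.obj v) := Module.compHom _ τ.toRingHom
  ModuleCat.of Aᵐᵒᵖ (∀ v, W.obj v)

/-- The identification of the total space. -/
def totalModuleEquiv : totalModule W τ ≃ₗ[k] (∀ v, W.obj v) where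
  toFun f := f
  invFun f := f
  left_inv _ := rfl
  right_inv _ := rfl
  map_add' _ _ := rfl
  map_smul' c f := by
    change τ (algebraMap k _ c) f = _
    rw [τ.commutes]
    rfl

include h in
/-- A representation on which the algebra acts comes from a module. -/
lemma exists_rep_iso (he : ∀ v f, τ (op (e v)) f = Pi.single v (f v))
    (hp : ∀ a f, τ (op (p a)) f = Pi.single (t a) (W.map a (f (s a)))) :
    ∃ M : FDMod k A, Nonempty (h.rep.obj M ≅ W) := by
  have hfin : Module.Finite k (totalModule W τ) :=
    Module.Finite.equiv (totalModuleEquiv W τ).symm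
  let φ : h.repObj (totalModule W τ) ⟶ W :=
    { app := fun v ↦ LinearMap.proj v ∘ₗ (totalModuleEquiv W τ).toLinearMap ∘ₗ
        (vertexSubmodule k (e v) (totalModule W τ)).subtype
      comm := fun a x ↦ by
        change τ (op (p a)) x.1 (t a) = W.map a (totalModuleEquiv W τ x.1 (s a))
        exact (congr_fun (hp a (totalModuleEquiv W τ x.1)) (t a)).trans (Pi.single_eq_same _ _) }
  refine ⟨⟨totalModule W τ, hfin⟩, ⟨QRep.isoOfBijective φ fun v ↦ ⟨?_, fun w ↦ ?_⟩⟩⟩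
  · intro x y hxy
    have hxy' : totalModuleEquiv W τ x.1 v = totalModuleEquiv W τ y.1 v := hxy
    have hx : (Pi.single v (totalModuleEquiv W τ x.1 v) : ∀ v, W.obj v) = x.1 :=
      (he v x.1).symm.trans x.2
    have hy : (Pi.single v (totalModuleEquiv W τ y.1 v) : ∀ v, W.obj v) = y.1 :=
      (he v y.1).symm.trans y.2
    exact Subtype.ext (hx.symm.trans ((congr_arg _ hxy').trans hy))
  · refine ⟨⟨(totalModuleEquiv W τ).symm (Pi.single v w), ?_⟩, ?_⟩
    · refine (he v _).trans ?_
      change Pi.single v ((Pi.single v w : ∀ v, W.obj v) v) = (Pi.single v w : ∀ v, W.obj v)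
      rw [Pi.single_eq_same]
    · exact Pi.single_eq_same v w

end Realization

end IsQuiverPresentation

end PiecewiseHereditary

/-! ### Presentations of path algebras with at most one path between two vertices -/

namespace PiecewiseHereditary

open MulOpposite

section PathPresentation

variable {k : Type u} [Field k] {Q : Type} [Quiver.{0} Q]
  [hQ : ∀ x y : Q, Subsingleton (Quiver.Path x y)] {V Arr : Type}
  (code : Q → V)

/-- Two elements are connected if they label the end points of a path. -/
def Conn (v w : V) : Prop :=
  ∃ (x y : Q) (_ : Quiver.Path x y), code x = v ∧ code y = w

open Classical in
variable (k) in
/-- The path between two labels, or zero. -/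
def pathElt (v w : V) : PathAlgebra k Q :=
  if h : Conn code v w then
    .ofPath k ⟨_, _, h.choose_spec.choose_spec.choose⟩ else 0

variable {code}

omit hQ in
lemma pathElt_of_not_conn {v w : V} (h : ¬ Conn code v w) : pathElt k code v w = 0 := dif_neg h

variable (hcode : Function.Injective code)

include hcode in
-- Since labels are injective and paths are determined by their end points, the choice made in
-- `pathElt` is harmless.
lemma pathElt_code {x y : Q} (q : Quiver.Path x y) :
    pathElt k code (code x) (code y) = .ofPath k ⟨x, y, q⟩ := by
  have h : Conn code (code x) (code y) := ⟨x, y, q, rfl, rfl⟩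
  rw [pathElt, dif_pos h]
  obtain ⟨h₁, h₂⟩ := h.choose_spec.choose_spec.choose_spec
  replace h₁ := hcode h₁
  replace h₂ := hcode h₂
  generalize h.choose_spec.choose_spec.choose = q'
  generalize h.choose_spec.choose = y' at *
  generalize h.choose = x' at *
  subst h₁ h₂
  rw [Subsingleton.elim q q']

include hcode in
lemma pathElt_mul [Fintype Q] {v w u : V} (h₁ : Conn code v w) (h₂ : Conn code w u) :
    pathElt k code w u * pathElt k code v w = pathElt k code v u := by
  obtain ⟨x, y, q, rfl, rfl⟩ := h₁
  obtain ⟨y', z, q', hy, rfl⟩ := h₂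
  obtain rfl := hcode hy
  rw [pathElt_code hcode q, pathElt_code hcode q', pathElt_code hcode (q.comp q'),
    PathAlgebra.ofPath_mul_ofPath_of_comp]

include hcode in
lemma pathElt_mul_of_ne [Fintype Q] {v w w' u : V} (h : w ≠ w') :
    pathElt k code w u * pathElt k code v w' = 0 := by
  by_cases h₁ : Conn code v w'
  · by_cases h₂ : Conn code w u
    · obtain ⟨x, y, q, rfl, rfl⟩ := h₁
      obtain ⟨y', z, q', rfl, rfl⟩ := h₂
      rw [pathElt_code hcode q, pathElt_code hcode q',
        PathAlgebra.ofPath_mul_ofPath_of_ne _ _ fun hy ↦ h (congr_arg code hy)]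
    · rw [pathElt_of_not_conn h₂, zero_mul]
  · rw [pathElt_of_not_conn h₁, mul_zero]

omit hQ in
lemma Conn.self_left {v w : V} (h : Conn code v w) : Conn code v v := by
  obtain ⟨x, y, q, rfl, rfl⟩ := h
  exact ⟨x, x, .nil, rfl, rfl⟩

omit hQ in
lemma Conn.self_right {v w : V} (h : Conn code v w) : Conn code w w := by
  obtain ⟨x, y, q, rfl, rfl⟩ := h
  exact ⟨y, y, .nil, rfl, rfl⟩

omit hQ in
lemma conn_code (x : Q) : Conn code (code x) (code x) := ⟨x, x, .nil, rfl, rfl⟩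

include hcode in
lemma pathElt_self_mul [Fintype Q] (v w : V) :
    pathElt k code w w * pathElt k code v w = pathElt k code v w := by
  by_cases h : Conn code v w
  · rw [pathElt_mul hcode h h.self_right]
  · rw [pathElt_of_not_conn h, mul_zero]

include hcode in
lemma pathElt_mul_self [Fintype Q] (v w : V) :
    pathElt k code v w * pathElt k code v v = pathElt k code v w := by
  by_cases h : Conn code v w
  · rw [pathElt_mul hcode h.self_left h]
  · rw [pathElt_of_not_conn h, zero_mul]

include hcode in
-- Labels which belong to no vertex contribute zero. Hence `code` need not be surjective, which
-- leaves room for the additional label ⊤ of the star.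
lemma sum_pathElt [Fintype Q] [Fintype V] : ∑ v, pathElt k code v v = 1 := by
  classical
  rw [PathAlgebra.one_def]
  symm
  refine Finset.sum_of_injOn code hcode.injOn (by simp) ?_ ?_
  · intro v _ hv
    refine pathElt_of_not_conn ?_
    rintro ⟨x, y, q, rfl, h⟩
    exact hv ⟨x, by simp, rfl⟩
  · intro x _
    rw [pathElt_code hcode Quiver.Path.nil]

omit hQ in
/-- A subalgebra containing the trivial paths and the arrows is everything. -/
lemma subalgebra_eq_top [Fintype Q] (S : Subalgebra k (PathAlgebra k Q))
    (h₀ : ∀ x, PathAlgebra.ofPath k ⟨x, x, .nil⟩ ∈ S)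
    (h₁ : ∀ (x y : Q) (f : x ⟶ y), PathAlgebra.ofPath k ⟨x, y, f.toPath⟩ ∈ S) : S = ⊤ := by
  have key (x y : Q) (q : Quiver.Path x y) : PathAlgebra.ofPath k ⟨x, y, q⟩ ∈ S := by
    induction q with
    | nil => exact h₀ x
    | cons q f hq =>
      have := S.mul_mem (h₁ _ _ f) hq
      rwa [PathAlgebra.ofPath_mul_ofPath_of_comp] at this
  rw [eq_top_iff]
  intro z _
  induction z using PathAlgebra.induction_on with
  | zero => exact S.zero_mem
  | add x y hx hy => exact S.add_mem (hx trivial) (hy trivial)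
  | smul c q => exact S.smul_mem (key _ _ q.2.2) c

include hcode in
/-- The path algebra of a quiver in which paths are determined by their end points. -/
lemma isQuiverPresentation_of_surjective [Fintype Q] [Fintype V] {A : Type u} [Ring A] [Algebra k A]
    (ψ : PathAlgebra k Q →ₐ[k] A) (hψ : Function.Surjective ψ) (s t : Arr → V)
    (hArr : ∀ (x y : Q), (x ⟶ y) → ∃ a, s a = code y ∧ t a = code x) :
    IsQuiverPresentation k s t (fun v ↦ ψ (pathElt k code v v))
      (fun a ↦ ψ (pathElt k code (t a) (s a))) where
  mul_self v := by rw [← map_mul, pathElt_self_mul hcode]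
  mul_of_ne v w h := by rw [← map_mul, pathElt_mul_of_ne hcode h, map_zero]
  sum_eq_one := by rw [← map_sum, sum_pathElt hcode, map_one]
  left_mul a := by rw [← map_mul, pathElt_self_mul hcode]
  mul_right a := by rw [← map_mul, pathElt_mul_self hcode]
  adjoin_eq_top := by
    set S := Algebra.adjoin k (Set.range (fun v ↦ ψ (pathElt k code v v)) ∪
      Set.range (fun a ↦ ψ (pathElt k code (t a) (s a))))
    -- The preimage in the path algebra contains the trivial paths and the arrows, which generate
    -- it; `hArr` reverses the arrows since right modules are contravariant.
    have h : S.comap ψ = ⊤ := by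
      refine subalgebra_eq_top _ (fun x ↦ ?_) (fun x y f ↦ ?_)
      · rw [← pathElt_code hcode]
        exact Algebra.subset_adjoin (.inl ⟨code x, rfl⟩)
      · obtain ⟨a, ha, ha'⟩ := hArr x y f
        rw [← pathElt_code hcode, ← ha, ← ha']
        exact Algebra.subset_adjoin (.inr ⟨a, rfl⟩)
    rw [eq_top_iff]
    intro z _
    obtain ⟨z, rfl⟩ := hψ z
    exact (h ▸ Algebra.mem_top : z ∈ S.comap ψ)

section Realization

variable [DecidableEq V] {s t : Arr → V} (W : QRep k s t)
  (m : ∀ v w, W.obj w →ₗ[k] W.obj v)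

/-- The endomorphism of the total space given by a map between two vertices. -/
def totalEnd (v w : V) : Module.End k (∀ v, W.obj v) :=
  LinearMap.single k W.obj v ∘ₗ m v w ∘ₗ LinearMap.proj w

lemma totalEnd_apply (v w : V) (f : ∀ v, W.obj v) :
    totalEnd W m v w f = Pi.single v (m v w (f w)) := rfl

variable (m_self : ∀ v x, m v v x = x)
  (m_comp : ∀ (x y z : Q), Quiver.Path x y → Quiver.Path y z → ∀ w,
    m (code x) (code y) (m (code y) (code z) w) = m (code x) (code z) w)
  (h_off : ∀ v, v ∉ Set.range code → Subsingleton (W.obj v))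

omit hQ in
include m_comp in
lemma totalEnd_mul {x y z : Q} (p : Quiver.Path x y) (q : Quiver.Path y z) :
    totalEnd W m (code x) (code y) * totalEnd W m (code y) (code z) =
      totalEnd W m (code x) (code z) := by
  ext1 f
  rw [Module.End.mul_apply, totalEnd_apply, totalEnd_apply, totalEnd_apply, Pi.single_eq_same,
    m_comp x y z p q]

lemma totalEnd_mul_of_ne {v w w' u : V} (h : w ≠ w') :
    totalEnd W m v w * totalEnd W m w' u = 0 := by
  ext1 f
  rw [Module.End.mul_apply, totalEnd_apply, totalEnd_apply, Pi.single_eq_of_ne h, map_zero,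
    Pi.single_zero]
  rfl

omit hQ in
include m_self h_off hcode in
-- At labels of vertices exactly one summand contributes; at the other labels the space is zero.
lemma sum_totalEnd [Fintype Q] : ∑ x, totalEnd W m (code x) (code x) = 1 := by
  refine LinearMap.ext fun f ↦ funext fun v ↦ ?_
  rw [LinearMap.sum_apply, Finset.sum_apply]
  simp only [totalEnd_apply, m_self]
  by_cases hv : v ∈ Set.range code
  · obtain ⟨x, rfl⟩ := hv
    rw [Finset.sum_eq_single x]
    · exact Pi.single_eq_same _ _
    · intro y _ hy
      exact Pi.single_eq_of_ne (fun h ↦ hy (hcode h).symm) _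
    · simp
  · have := h_off v hv
    exact Subsingleton.elim _ _

/-- The linear map underlying the action of the path algebra. -/
def pathAlgebraLinear (code : Q → V) :
    PathAlgebra k Q →ₗ[k] (Module.End k (∀ v, W.obj v))ᵐᵒᵖ :=
  Finsupp.linearCombination k fun q : QPath Q ↦
    -- A path from x to y acts contravariantly, from the space at y to the space at x. The opposite
    -- algebra is there because the product pq acts on the right by p first and then by q.
    (op (totalEnd W m (code q.1) (code q.2.1)) : (Module.End k (∀ v, W.obj v))ᵐᵒᵖ)

omit hQ in
lemma pathAlgebraLinear_ofPath (q : QPath Q) :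
    pathAlgebraLinear W m code (.ofPath k q) = op (totalEnd W m (code q.1) (code q.2.1)) :=
  (Finsupp.linearCombination_single k (1 : k) q).trans (one_smul _ _)

variable [Fintype Q]

omit hQ in
include hcode m_self h_off in
lemma pathAlgebraLinear_one : pathAlgebraLinear W m code 1 = 1 := by
  rw [PathAlgebra.one_def, map_sum]
  simp only [pathAlgebraLinear_ofPath]
  rw [← Finset.op_sum, sum_totalEnd hcode W m m_self h_off, op_one]

omit hQ in
include hcode m_comp in
lemma pathAlgebraLinear_mul (a b : PathAlgebra k Q) :
    pathAlgebraLinear W m code (a * b) =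
      pathAlgebraLinear W m code a * pathAlgebraLinear W m code b := by
  induction a using PathAlgebra.induction_on with
  | zero => simp only [zero_mul, map_zero]
  | add x y hx hy => simp only [add_mul, map_add, hx, hy]
  | smul c p =>
  induction b using PathAlgebra.induction_on with
  | zero => simp only [mul_zero, map_zero]
  | add x y hx hy => simp only [mul_add, map_add, hx, hy]
  | smul d q =>
  simp only [smul_mul_assoc, mul_smul_comm, map_smul, pathAlgebraLinear_ofPath]
  congr 2
  obtain ⟨x, y, p⟩ := p
  obtain ⟨x', y', q⟩ := q
  rw [← op_mul]
  by_cases h : x = y'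
  · subst h
    rw [PathAlgebra.ofPath_mul_ofPath_of_comp, pathAlgebraLinear_ofPath,
      totalEnd_mul W m m_comp q p]
  · rw [PathAlgebra.ofPath_mul_ofPath_of_ne _ _ h, map_zero,
      totalEnd_mul_of_ne W m (fun hh ↦ h (hcode hh).symm), MulOpposite.op_zero]

/-- The action of the path algebra on the total space of a representation. -/
def pathAlgebraAction : PathAlgebra k Q →ₐ[k] (Module.End k (∀ v, W.obj v))ᵐᵒᵖ :=
  AlgHom.ofLinearMap (pathAlgebraLinear W m code)
    (pathAlgebraLinear_one hcode W m m_self h_off)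
    (pathAlgebraLinear_mul hcode W m m_comp)

lemma pathAlgebraAction_pathElt {v w : V} (h : ¬ Conn code v w → ∀ x, m v w x = 0) (f) :
    (pathAlgebraAction hcode W m m_self m_comp h_off (pathElt k code v w)).unop f =
      Pi.single v (m v w (f w)) := by
  by_cases hvw : Conn code v w
  · obtain ⟨x, y, q, rfl, rfl⟩ := hvw
    rw [pathElt_code hcode q]
    exact congr_arg (fun φ : (Module.End k (∀ v, W.obj v))ᵐᵒᵖ ↦ φ.unop f) (pathAlgebraLinear_ofPath W m ⟨x, y, q⟩)
  · rw [pathElt_of_not_conn hvw, map_zero, h hvw, Pi.single_zero]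
    rfl

/-- A representation of the quiver on which the relations hold is the representation of a
module. -/
lemma exists_rep_iso_of_factorization [Fintype V] {A : Type u} [Ring A] [Algebra k A]
    (ψ : PathAlgebra k Q →ₐ[k] A)
    (H : IsQuiverPresentation k s t (fun v ↦ ψ (pathElt k code v v))
      (fun a ↦ ψ (pathElt k code (t a) (s a)))) [∀ v, Module.Finite k (W.obj v)]
    (φ : A →ₐ[k] (Module.End k (∀ v, W.obj v))ᵐᵒᵖ)
    (hφ : ∀ x, φ (ψ x) = pathAlgebraAction hcode W m m_self m_comp h_off x)
    (h_map : ∀ a x, m (t a) (s a) x = W.map a x)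
    (h_zero : ∀ v w, ¬ Conn code v w → ∀ x, m v w x = 0) :
    ∃ M : FDMod k A, Nonempty (H.rep.obj M ≅ W) := by
  refine H.exists_rep_iso W (AlgHom.opComm φ) (fun v f ↦ ?_) (fun a f ↦ ?_)
  · change (φ (ψ (pathElt k code v v))).unop f = _
    rw [hφ, pathAlgebraAction_pathElt _ _ _ _ _ _ (h_zero v v), m_self]
  · change (φ (ψ (pathElt k code (t a) (s a)))).unop f = _
    rw [hφ, pathAlgebraAction_pathElt _ _ _ _ _ _ (h_zero _ _), h_map]

omit hQ in
/-- The action of the path algebra factors through a truncation if the long paths act by zero. -/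
lemma exists_truncated_factorization (r : ℕ)
    (hr : ∀ (x y : Q) (q : Quiver.Path x y), q.length = r → ∀ w, m (code x) (code y) w = 0) :
    ∃ φ : TruncatedPathAlgebra k Q r →ₐ[k] (Module.End k (∀ v, W.obj v))ᵐᵒᵖ,
      ∀ x, φ (RingCon.mkₐ k _ x) = pathAlgebraAction hcode W m m_self m_comp h_off x := by
  refine ⟨RingCon.liftₐ _ (pathAlgebraAction hcode W m m_self m_comp h_off) ?_, fun x ↦ rfl⟩
  -- It suffices to kill the generators of the ideal; the condition for lifting through the quotient
  -- concerns the associated congruence, hence the differences below.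
  have key : lengthIdeal k Q r ≤
      TwoSidedIdeal.ker (pathAlgebraAction hcode W m m_self m_comp h_off) := by
    refine TwoSidedIdeal.span_le.2 ?_
    rintro _ ⟨q, hq, rfl⟩
    refine (TwoSidedIdeal.mem_ker _).2 ?_
    refine (pathAlgebraLinear_ofPath W m q).trans ?_
    have : totalEnd W m (code q.1) (code q.2.1) = 0 := by
      ext1 f
      rw [totalEnd_apply, hr _ _ q.2.2 hq, Pi.single_zero]
      rfl
    rw [this, MulOpposite.op_zero]
  intro x y hxy
  have := key ((TwoSidedIdeal.rel_iff _ _ _).1 hxy)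
  rw [TwoSidedIdeal.mem_ker, map_sub, sub_eq_zero] at this
  exact this

end Realization

end PathPresentation

namespace IsQuiverPresentation

variable {k : Type u} [Field k] {A : Type u} [Ring A] [Algebra k A] {V Arr : Type} [Fintype V]
  {s t : Arr → V} {e : V → A} {p : Arr → A} (h : IsQuiverPresentation k s t e p)
  (P : ObjectProperty (QRep k s t)) [P.IsClosedUnderIsomorphisms] (hP : ∀ M, P (h.rep.obj M))

/-- The equivalence of the category of modules with the category of representations which satisfy
the relations. -/
def equivalence (hP' : ∀ W, P W → ∃ M, Nonempty (h.rep.obj M ≅ W)) :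
    FDMod k A ≌ P.FullSubcategory :=
  have : (P.lift h.rep hP).Faithful :=
    ⟨fun {_ _ _ _} hfg ↦ h.rep.map_injective (congr_arg P.ι.map hfg)⟩
  have : (P.lift h.rep hP).Full := ⟨fun {_ _} φ ↦ by
    obtain ⟨f, hf⟩ := h.rep.map_surjective (P.ι.map φ)
    exact ⟨f, P.ι.map_injective hf⟩⟩
  have : (P.lift h.rep hP).EssSurj := ⟨fun W ↦ by
    obtain ⟨M, ⟨i⟩⟩ := hP' W.obj W.property
    exact ⟨M, ⟨P.ι.preimageIso i⟩⟩⟩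
  have : (P.lift h.rep hP).IsEquivalence := {}
  (P.lift h.rep hP).asEquivalence

variable (hP' : ∀ W, P W → ∃ M, Nonempty (h.rep.obj M ≅ W))

instance : (h.equivalence P hP hP').functor.Additive where
  map_add := rfl

lemma preservesHomology_equivalence_comp_ev (v : V) :
    ((h.equivalence P hP hP').functor ⋙ P.ι ⋙ QRep.ev k s t v).PreservesHomology :=
  h.preservesHomology_rep_comp_ev v

end IsQuiverPresentation

end PiecewiseHereditary

/-! ### Free chains and spaces concentrated at the bottom -/

namespace PiecewiseHereditary

open Limits

section Chain

variable {k : Type u} [Field k] {ι : Type} [LinearOrder ι] (C : ι → Type u)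
  [∀ j, AddCommGroup (C j)] [∀ j, Module k (C j)] {C' : ι → Type u}
  [∀ j, AddCommGroup (C' j)] [∀ j, Module k (C' j)]

variable (k) in
/-- The families which vanish below a given index. -/
def upperPi (j : ι) : Submodule k (∀ l, C l) where
  carrier := {f | ∀ l, l < j → f l = 0}
  zero_mem' _ _ := rfl
  add_mem' {a b} ha hb l hl := by rw [Pi.add_apply, ha l hl, hb l hl, add_zero]
  smul_mem' c a ha l hl := by rw [Pi.smul_apply, ha l hl, smul_zero]

variable {C}

lemma upperPi_anti {j l : ι} (h : j ≤ l) : upperPi k C l ≤ upperPi k C j :=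
  fun _ hf i hi ↦ hf i (hi.trans_le h)

lemma single_mem_upperPi (j : ι) (x : C j) : Pi.single j x ∈ upperPi k C j :=
  fun _ hi ↦ Pi.single_eq_of_ne hi.ne _

/-- The componentwise application of a family of linear maps. -/
def piMap (φ : ∀ j, C j →ₗ[k] C' j) : (∀ j, C j) →ₗ[k] ∀ j, C' j :=
  LinearMap.pi fun j ↦ φ j ∘ₗ LinearMap.proj j

omit [LinearOrder ι] in
@[simp] lemma piMap_apply (φ : ∀ j, C j →ₗ[k] C' j) (f : ∀ j, C j) (j : ι) :
    piMap φ f j = φ j (f j) := rfl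

lemma piMap_mem_upperPi (φ : ∀ j, C j →ₗ[k] C' j) {j : ι} {f : ∀ j, C j}
    (hf : f ∈ upperPi k C j) : piMap φ f ∈ upperPi k C' j :=
  fun l hl ↦ by rw [piMap_apply, hf l hl, map_zero]

variable [Fintype ι] (c : ∀ j l, j ≤ l → C l →ₗ[k] C j) (c' : ∀ j l, j ≤ l → C' l →ₗ[k] C' j)

/-- The sum of the images in a given component of a family of elements. -/
def upperSum (j : ι) : (∀ l, C l) →ₗ[k] C j :=
  ∑ l, if h : j ≤ l then c j l h ∘ₗ LinearMap.proj l else 0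

lemma upperSum_apply (j : ι) (f : ∀ l, C l) :
    upperSum c j f = ∑ l, if h : j ≤ l then c j l h (f l) else 0 := by
  rw [upperSum, LinearMap.sum_apply]
  refine Finset.sum_congr rfl fun l _ ↦ ?_
  split_ifs <;> rfl

/-- For a family vanishing below `l`, every surviving term of the sum at `j` factors through `l`.
This is why the sum maps form a morphism from the free chain. -/
lemma upperSum_of_mem (c_comp : ∀ i j l (h : i ≤ j) (h' : j ≤ l) x,
      c i j h (c j l h' x) = c i l (h.trans h') x) {j l : ι} (h : j ≤ l) {f : ∀ l, C l}
    (hf : f ∈ upperPi k C l) : upperSum c j f = c j l h (upperSum c l f) := by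
  rw [upperSum_apply, upperSum_apply, map_sum]
  refine Finset.sum_congr rfl fun i _ ↦ ?_
  by_cases hi : l ≤ i
  · rw [dif_pos (h.trans hi), dif_pos hi, c_comp]
  · rw [dif_neg hi, map_zero, hf i (not_le.1 hi)]
    split_ifs <;> simp

lemma upperSum_single (c_id : ∀ j x, c j j le_rfl x = x) (j : ι) (x : C j) :
    upperSum c j (Pi.single j x) = x := by
  rw [upperSum_apply, Finset.sum_eq_single j]
  · rw [dif_pos le_rfl, Pi.single_eq_same, c_id]
  · intro l _ hl
    rw [Pi.single_eq_of_ne hl]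
    split_ifs <;> simp
  · simp

lemma upperSum_piMap (φ : ∀ j, C j →ₗ[k] C' j)
    (hφ : ∀ j l h x, φ j (c j l h x) = c' j l h (φ l x)) (j : ι) (f : ∀ l, C l) :
    upperSum c' j (piMap φ f) = φ j (upperSum c j f) := by
  rw [upperSum_apply, upperSum_apply, map_sum]
  refine Finset.sum_congr rfl fun l _ ↦ ?_
  split_ifs
  · rw [hφ, piMap_apply]
  · rw [map_zero]

variable (k) in
/-- A vector space placed at the bottom element. -/
def atBot {ι : Type} [LinearOrder ι] [OrderBot ι] (M : Type u) [AddCommGroup M] [Module k M]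
    (j : ι) : Submodule k M where
  carrier := {f | j ≠ ⊥ → f = 0}
  zero_mem' _ := rfl
  add_mem' ha hb hj := by rw [ha hj, hb hj, add_zero]
  smul_mem' _ _ ha hj := by rw [ha hj, smul_zero]

section

variable {ι : Type} [LinearOrder ι] [OrderBot ι] {M N : Type u} [AddCommGroup M] [Module k M]
  [AddCommGroup N] [Module k N]

lemma mem_atBot_bot (f : M) : f ∈ atBot k M (⊥ : ι) := fun h ↦ absurd rfl h

lemma atBot_anti {j l : ι} (h : j ≤ l) : atBot k M l ≤ atBot k M j :=
  fun _ hf hj ↦ hf (fun hl ↦ hj (le_bot_iff.1 (h.trans hl.le)))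

lemma map_mem_atBot (φ : M →ₗ[k] N) {j : ι} {f : M} (hf : f ∈ atBot k M j) :
    φ f ∈ atBot k N j := fun hj ↦ by rw [hf hj, map_zero]

end

end Chain

/-! ### Representations for the truncated algebra -/

/-- The pairs of indices which label the maps of a contravariant representation of a chain. -/
abbrev ChainArr (ι : Type) [LE ι] : Type := {p : ι × ι // p.1 ≤ p.2}

variable (k : Type u) [Field k] (ι β : Type) [LinearOrder ι] [OrderBot ι]

/-- The source of an arrow of the chain with arrows from the bottom element. -/
abbrev lamSource : ChainArr ι ⊕ β → ι ⊕ β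
  | .inl p => .inl p.1.2
  | .inr _ => .inl ⊥

/-- The target of an arrow of the chain with arrows from the bottom element. -/
abbrev lamTarget : ChainArr ι ⊕ β → ι ⊕ β
  | .inl p => .inl p.1.1
  | .inr i => .inr i

/-- Contravariant representations of a chain, together with maps from the space at the bottom
element. -/
abbrev LamRep : Type (u + 1) := QRep k (lamSource ι β) (lamTarget ι β)

namespace LamRep

variable {k ι β}

/-- The map between two elements of the chain. -/
abbrev chain (X : LamRep k ι β) {j l : ι} (h : j ≤ l) : X.obj (.inl l) →ₗ[k] X.obj (.inl j) :=
  X.map (.inl ⟨(j, l), h⟩)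

/-- The maps from the bottom element. -/
abbrev leaf (X : LamRep k ι β) (i : β) : X.obj (.inl ⊥) →ₗ[k] X.obj (.inr i) :=
  X.map (.inr i)

/-- A representation given by its components. -/
abbrev mk' (C : ι → Type u) (Y : β → Type u) [∀ j, AddCommGroup (C j)] [∀ j, Module k (C j)]
    [∀ i, AddCommGroup (Y i)] [∀ i, Module k (Y i)] (c : ∀ j l, j ≤ l → C l →ₗ[k] C j)
    (y : ∀ i, C ⊥ →ₗ[k] Y i) : LamRep k ι β where
  obj
    | .inl j => C j
    | .inr i => Y i
  addCommGroup
    | .inl j => inferInstanceAs (AddCommGroup (C j))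
    | .inr i => inferInstanceAs (AddCommGroup (Y i))
  module
    | .inl j => inferInstanceAs (Module k (C j))
    | .inr i => inferInstanceAs (Module k (Y i))
  map
    | .inl p => c _ _ p.2
    | .inr i => y i

/-- A morphism given by its components. -/
abbrev homMk {X Y : LamRep k ι β} (f : ∀ j, X.obj (.inl j) →ₗ[k] Y.obj (.inl j))
    (g : ∀ i, X.obj (.inr i) →ₗ[k] Y.obj (.inr i))
    (hf : ∀ j l (h : j ≤ l) x, f j (X.chain h x) = Y.chain h (f l x))
    (hg : ∀ i x, g i (X.leaf i x) = Y.leaf i (f ⊥ x)) : X ⟶ Y where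
  app
    | .inl j => f j
    | .inr i => g i
  comm
    | .inl p => hf _ _ p.2
    | .inr i => hg i

lemma hom_ext' {X Y : LamRep k ι β} {f g : X ⟶ Y}
    (h : ∀ j x, f.app (.inl j) x = g.app (.inl j) x)
    (h' : ∀ i x, f.app (.inr i) x = g.app (.inr i) x) : f = g :=
  QRep.hom_ext (by rintro (j | i) x; exacts [h j x, h' i x])

lemma app_chain {X Y : LamRep k ι β} (f : X ⟶ Y) {j l : ι} (h : j ≤ l) (x : X.obj (.inl l)) :
    f.app (.inl j) (X.chain h x) = Y.chain h (f.app (.inl l) x) :=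
  f.comm (.inl ⟨(j, l), h⟩) x

lemma app_leaf {X Y : LamRep k ι β} (f : X ⟶ Y) (i : β) (x : X.obj (.inl ⊥)) :
    f.app (.inr i) (X.leaf i x) = Y.leaf i (f.app (.inl ⊥) x) :=
  f.comm (.inr i) x

lemma map_injective_of_iso {X Y : LamRep k ι β} (e : X ≅ Y) (a : ChainArr ι ⊕ β)
    (h : Function.Injective (X.map a)) : Function.Injective (Y.map a) := by
  intro y y' hy
  rw [QRep.map_eq_of_iso e, QRep.map_eq_of_iso e _ y'] at hy
  exact (QRep.isoApp e.symm _).injective (h ((QRep.isoApp e _).injective hy))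

variable [OrderTop ι]

/-- Functoriality on the chain, and the zero relations. -/
structure Relations (X : LamRep k ι β) : Prop where
  finite : ∀ v, Module.Finite k (X.obj v)
  chain_id : ∀ j x, X.chain (le_refl j) x = x
  chain_comp : ∀ i j l (h : i ≤ j) (h' : j ≤ l) x,
    X.chain h (X.chain h' x) = X.chain (h.trans h') x
  leaf_top : ∀ i x, X.leaf i (X.chain (le_top : (⊥ : ι) ≤ ⊤) x) = 0

variable (k ι β) in
/-- The representations which satisfy the relations. -/
def relations : ObjectProperty (LamRep k ι β) := Relations

variable (k ι β) in
/-- The representations such that the map from the top to the bottom is injective. -/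
def topInjective : ObjectProperty (LamRep k ι β) := fun X ↦
  X.Relations ∧ Function.Injective (X.chain (le_top : (⊥ : ι) ≤ ⊤))

variable (k ι β) in
/-- The representations such that moreover the maps from the bottom are surjective. -/
def leafSurjective : ObjectProperty (LamRep k ι β) := fun X ↦
  topInjective k ι β X ∧ ∀ i, Function.Surjective (X.leaf i)

lemma topInjective_le : topInjective k ι β ≤ relations k ι β := fun _ h ↦ h.1

lemma leafSurjective_le : leafSurjective k ι β ≤ topInjective k ι β := fun _ h ↦ h.1

lemma Relations.of_iso {X Y : LamRep k ι β} (e : X ≅ Y) (h : X.Relations) : Y.Relations where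
  finite v := have := h.finite v; Module.Finite.equiv (QRep.isoApp e v)
  chain_id j x := by
    obtain ⟨x, rfl⟩ := (QRep.isoApp e _).surjective x
    exact (app_chain e.hom _ x).symm.trans (congr_arg (e.hom.app _) (h.chain_id j x))
  chain_comp i j l h₁ h₂ x := by
    obtain ⟨x, rfl⟩ := (QRep.isoApp e _).surjective x
    refine Eq.trans ?_ ((congr_arg (e.hom.app _) (h.chain_comp i j l h₁ h₂ x)).trans
      (app_chain e.hom _ x))
    exact (congr_arg (Y.chain h₁) (app_chain e.hom h₂ x).symm).trans (app_chain e.hom h₁ _).symm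
  leaf_top i x := by
    obtain ⟨x, rfl⟩ := (QRep.isoApp e _).surjective x
    refine Eq.trans ?_ ((congr_arg (e.hom.app _) (h.leaf_top i x)).trans (map_zero _))
    exact (congr_arg (Y.leaf i) (app_chain e.hom _ x).symm).trans (app_leaf e.hom i _).symm

instance : (relations k ι β).IsClosedUnderIsomorphisms := ⟨Relations.of_iso⟩

instance : (topInjective k ι β).IsClosedUnderIsomorphisms :=
  ⟨fun e h ↦ ⟨h.1.of_iso e, map_injective_of_iso e _ h.2⟩⟩

instance : (leafSurjective k ι β).IsClosedUnderIsomorphisms :=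
  ⟨fun {X Y} e h ↦ ⟨(topInjective k ι β).prop_of_iso e h.1, fun i y ↦ by
    obtain ⟨x, hx⟩ := h.2 i (e.inv.app _ y)
    refine ⟨e.hom.app _ x, ?_⟩
    rw [leaf, ← e.hom.comm]
    exact (congr_arg (e.hom.app _) hx).trans (QRep.inv_hom_app e _ y)⟩⟩

lemma Relations.prod {X Y : LamRep k ι β} (hX : X.Relations) (hY : Y.Relations) :
    Relations (QRep.prod X Y) where
  finite v := have := hX.finite v; have := hY.finite v; inferInstanceAs (Module.Finite k (_ × _))
  chain_id _ _ := Prod.ext (hX.chain_id _ _) (hY.chain_id _ _)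
  chain_comp _ _ _ _ _ _ := Prod.ext (hX.chain_comp _ _ _ _ _ _) (hY.chain_comp _ _ _ _ _ _)
  leaf_top _ _ := Prod.ext (hX.leaf_top _ _) (hY.leaf_top _ _)

lemma topInjective_prod (X Y : LamRep k ι β) (hX : topInjective k ι β X)
    (hY : topInjective k ι β Y) : topInjective k ι β (QRep.prod X Y) :=
  ⟨hX.1.prod hY.1, Function.Injective.prodMap hX.2 hY.2⟩

lemma leafSurjective_prod (X Y : LamRep k ι β) (hX : leafSurjective k ι β X)
    (hY : leafSurjective k ι β Y) : leafSurjective k ι β (QRep.prod X Y) :=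
  ⟨topInjective_prod X Y hX.1 hY.1, fun i ↦ Function.Surjective.prodMap (hX.2 i) (hY.2 i)⟩

instance : HasBinaryBiproducts (leafSurjective k ι β).FullSubcategory :=
  ObjectProperty.hasBinaryBiproducts_fullSubcategory
    (QRep.prop_biprod _ leafSurjective_prod)

instance : (leafSurjective k ι β).ContainsZero where
  exists_zero := ⟨_, QRep.isZero_zeroRep,
    ⟨⟨fun _ ↦ inferInstanceAs (Module.Finite k PUnit.{u + 1}), fun _ _ ↦ rfl, fun _ _ _ _ _ _ ↦ rfl,
      fun _ _ ↦ rfl⟩, fun _ _ _ ↦ rfl⟩, fun _ x ↦ ⟨x, rfl⟩⟩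

end LamRep

end PiecewiseHereditary

/-! ### Resolutions on the side of the truncated algebra -/

namespace PiecewiseHereditary

open Limits CochainComplex

lemma top_ne_bot_of_nontrivial {ι : Type*} [PartialOrder ι] [OrderBot ι] [OrderTop ι]
    [Nontrivial ι] : (⊤ : ι) ≠ ⊥ := fun h ↦ by
  obtain ⟨x, hx⟩ := exists_ne (⊥ : ι)
  exact hx (le_bot_iff.1 (le_top.trans h.le))

namespace LamRep

variable {k : Type u} [Field k] {ι β : Type} [LinearOrder ι] [OrderBot ι] [OrderTop ι]

section TopInjective

variable [Fintype ι]

/-- The sum of the images under the maps of the chain. -/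
abbrev chainSum (X : LamRep k ι β) (j : ι) : (∀ l, X.obj (.inl l)) →ₗ[k] X.obj (.inl j) :=
  upperSum (C := fun l ↦ X.obj (.inl l)) (fun _ _ h ↦ X.chain h) j

omit [OrderTop ι] in
lemma chainSum_piMap {X Y : LamRep k ι β} (f : X ⟶ Y) (j : ι) (x : ∀ l, X.obj (.inl l)) :
    Y.chainSum j (piMap (fun l ↦ f.app (.inl l)) x) = f.app (.inl j) (X.chainSum j x) :=
  upperSum_piMap _ _ _ (fun _ _ h x ↦ app_chain f h x) j x

lemma Relations.chainSum_of_mem {X : LamRep k ι β} (h : X.Relations) {j l : ι} (hjl : j ≤ l)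
    {x : ∀ l, X.obj (.inl l)} (hx : x ∈ upperPi k (fun l ↦ X.obj (.inl l)) l) :
    X.chainSum j x = X.chain hjl (X.chainSum l x) :=
  upperSum_of_mem _ h.chain_comp hjl hx

/-- The kernel of the sum map. -/
abbrev chainKer (X : LamRep k ι β) (j : ι) : Submodule k (∀ l, X.obj (.inl l)) :=
  upperPi k (fun l ↦ X.obj (.inl l)) j ⊓ LinearMap.ker (X.chainSum j)

lemma Relations.chainKer_anti {X : LamRep k ι β} (h : X.Relations) {j l : ι} (hjl : j ≤ l) :
    X.chainKer l ≤ X.chainKer j := fun x hx ↦ by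
  refine ⟨upperPi_anti hjl hx.1, ?_⟩
  have h₂ : X.chainSum l x = 0 := hx.2
  change X.chainSum j x = 0
  rw [h.chainSum_of_mem hjl hx.1, h₂, map_zero]

variable (k ι β) in
/-- The representation with free chain part. -/
def freeChain : (relations k ι β).FullSubcategory ⥤ LamRep k ι β where
  obj X := mk' (fun j ↦ upperPi k (fun l ↦ X.obj.obj (.inl l)) j) (fun i ↦ X.obj.obj (.inr i))
    (fun j l h ↦ Submodule.inclusion (upperPi_anti h))
    (fun i ↦ X.obj.leaf i ∘ₗ X.obj.chainSum ⊥ ∘ₗ Submodule.subtype _)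
  map {X Y} f := homMk
    (fun j ↦ (piMap fun l ↦ f.hom.app (.inl l)).restrict fun _ hx ↦ piMap_mem_upperPi _ hx)
    (fun i ↦ f.hom.app (.inr i))
    (fun _ _ _ _ ↦ rfl)
    (fun i x ↦ (app_leaf f.hom i _).trans
      (congr_arg (Y.obj.leaf i) (chainSum_piMap f.hom ⊥ x.1).symm))
  map_id X := hom_ext' (fun _ _ ↦ rfl) (fun _ _ ↦ rfl)
  map_comp f g := hom_ext' (fun _ _ ↦ rfl) (fun _ _ ↦ rfl)

instance : (freeChain k ι β).Additive where
  map_add := hom_ext' (fun _ _ ↦ rfl) (fun _ _ ↦ rfl)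

variable (k ι β) in
/-- The kernel of the map from the representation with free chain part. -/
def freeChainKer : (relations k ι β).FullSubcategory ⥤ LamRep k ι β where
  obj X := mk' (fun j ↦ X.obj.chainKer j) (fun _ ↦ PUnit.{u + 1})
    (fun j l h ↦ Submodule.inclusion (X.property.chainKer_anti h)) (fun _ ↦ 0)
  map {X Y} f := homMk
    (fun j ↦ (piMap fun l ↦ f.hom.app (.inl l)).restrict fun x hx ↦
      ⟨piMap_mem_upperPi _ hx.1, by
        have h₂ : X.obj.chainSum j x = 0 := hx.2
        change Y.obj.chainSum j _ = 0
        rw [chainSum_piMap, h₂, map_zero]⟩)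
    (fun _ ↦ 0)
    (fun _ _ _ _ ↦ rfl)
    (fun _ _ ↦ rfl)
  map_id X := hom_ext' (fun _ _ ↦ rfl) (fun _ _ ↦ rfl)
  map_comp f g := hom_ext' (fun _ _ ↦ rfl) (fun _ _ ↦ rfl)

instance : (freeChainKer k ι β).Additive where
  map_add := hom_ext' (fun _ _ ↦ rfl) (fun _ _ ↦ rfl)

variable (k ι β) in
/-- The inclusion of the kernel. -/
def freeChainKerι : freeChainKer k ι β ⟶ freeChain k ι β where
  app X := homMk (fun j ↦ Submodule.inclusion inf_le_left) (fun _ ↦ 0)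
    (fun _ _ _ _ ↦ rfl)
    (fun i x ↦ by
      have h : X.obj.chainSum ⊥ x.1 = 0 := x.2.2
      exact ((congr_arg (X.obj.leaf i) h).trans (map_zero _)).symm)
  naturality X Y f := hom_ext' (fun _ _ ↦ rfl) (fun i _ ↦ (map_zero (f.hom.app (.inr i))).symm)

variable (k ι β) in
/-- The sum map from the representation with free chain part. -/
def freeChainπ : freeChain k ι β ⟶ (relations k ι β).ι where
  app X := homMk (fun j ↦ X.obj.chainSum j ∘ₗ Submodule.subtype _) (fun _ ↦ LinearMap.id)
    (fun _ _ h x ↦ X.property.chainSum_of_mem h x.2)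
    (fun _ _ ↦ rfl)
  naturality X Y f := hom_ext' (fun j x ↦ chainSum_piMap f.hom j x.1) (fun _ _ ↦ rfl)

/-- The chain maps are inclusions of nested submodules, hence injective. On the top submodule the
sum at ⊥ factors through the chain map from ⊤ to ⊥ of `X`, so the zero relations of `X` give those
of the free chain. -/
lemma topInjective_freeChain (X : (relations k ι β).FullSubcategory) :
    topInjective k ι β ((freeChain k ι β).obj X) := by
  have := X.property.finite
  refine ⟨⟨?_, fun _ _ ↦ rfl, fun _ _ _ _ _ _ ↦ rfl, fun i x ↦ ?_⟩,
    Submodule.inclusion_injective (upperPi_anti bot_le)⟩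
  · rintro (j | i)
    · exact inferInstanceAs (Module.Finite k (upperPi k (fun l ↦ X.obj.obj (.inl l)) j))
    · exact X.property.finite _
  · have := X.property.chainSum_of_mem (le_top : ⊥ ≤ ⊤) x.2
    exact (congr_arg (X.obj.leaf i) this).trans (X.property.leaf_top _ _)

lemma topInjective_freeChainKer (X : (relations k ι β).FullSubcategory) :
    topInjective k ι β ((freeChainKer k ι β).obj X) := by
  have := X.property.finite
  refine ⟨⟨?_, fun _ _ ↦ rfl, fun _ _ _ _ _ _ ↦ rfl, fun i x ↦ rfl⟩,
    Submodule.inclusion_injective (X.property.chainKer_anti bot_le)⟩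
  rintro (j | i)
  · exact inferInstanceAs (Module.Finite k (X.obj.chainKer j))
  · exact inferInstanceAs (Module.Finite k PUnit.{u + 1})

/-- The sum map is onto on the chain and the identity on the leaves. Its kernel is concentrated on
the chain, where the maps are again inclusions, so both terms of the resolution have the required
injectivity. -/
lemma isLocalizedEquivalence_topInjective :
    (localizerInclusion (QRep.ev k (lamSource ι β) (lamTarget ι β))
      (topInjective_le (k := k) (ι := ι) (β := β))).IsLocalizedEquivalence := by
  refine isLocalizedEquivalence_of_left_resolution _ _ (QRep.prop_biprod _ topInjective_prod)
    topInjective_freeChainKer topInjective_freeChain (freeChainKerι k ι β) (freeChainπ k ι β)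
    (fun X ↦ hom_ext' (fun j x ↦ x.2.2) (fun i x ↦ rfl)) ?_
  rintro (j | i) X
  · refine QRep.shortExact_ev _ (Submodule.inclusion_injective inf_le_left) (fun x ↦ ?_) (fun x hx ↦ ?_)
    · exact ⟨⟨Pi.single j x, single_mem_upperPi (C := fun l ↦ X.obj.obj (.inl l)) j x⟩,
        upperSum_single _ X.property.chain_id j x⟩
    · exact ⟨⟨x.1, x.2, hx⟩, rfl⟩
  · exact QRep.shortExact_ev _ (fun _ _ _ ↦ rfl) Function.surjective_id
      (fun x hx ↦ ⟨PUnit.unit, hx.symm⟩)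

end TopInjective

section LeafSurjective

variable [Finite β]

/-- The product of the spaces at the leaves. -/
abbrev leafPi (X : LamRep k ι β) : Type u := ∀ i, X.obj (.inr i)

omit [OrderTop ι] [Finite β] in
lemma exists_leafPi (X : LamRep k ι β) (i : β) (y : X.obj (.inr i)) :
    ∃ f : X.leafPi, f i = y := by
  classical
  exact ⟨Pi.single i y, Pi.single_eq_same (M := fun i ↦ X.obj (.inr i)) i y⟩

/-- The map between products of the spaces at the leaves. -/
abbrev leafPiMap {X Y : LamRep k ι β} (f : X ⟶ Y) : X.leafPi →ₗ[k] Y.leafPi :=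
  piMap fun i ↦ f.app (.inr i)

variable (k ι β) in
/-- The representation with enlarged bottom element, so that the maps from it are surjective. -/
def addLeaves : (topInjective k ι β).FullSubcategory ⥤ LamRep k ι β where
  obj X := mk' (fun j ↦ X.obj.obj (.inl j) × atBot k X.obj.leafPi j) (fun i ↦ X.obj.obj (.inr i))
    (fun j l h ↦ (X.obj.chain h).prodMap (Submodule.inclusion (atBot_anti h)))
    (fun i ↦ (X.obj.leaf i).coprod
      (LinearMap.proj i ∘ₗ (atBot k X.obj.leafPi (⊥ : ι)).subtype))
  map {X Y} f := homMk
    (fun j ↦ (f.hom.app (.inl j)).prodMap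
      ((leafPiMap f.hom).restrict fun _ hx ↦ map_mem_atBot _ hx))
    (fun i ↦ f.hom.app (.inr i))
    (fun _ _ h x ↦ Prod.ext (app_chain f.hom h x.1) rfl)
    (fun i x ↦ (map_add (f.hom.app (.inr i)) _ _).trans
      (congr_arg (· + f.hom.app (.inr i) (x.2.1 i)) (app_leaf f.hom i x.1)))
  map_id X := hom_ext' (fun _ _ ↦ rfl) (fun _ _ ↦ rfl)
  map_comp f g := hom_ext' (fun _ _ ↦ rfl) (fun _ _ ↦ rfl)

instance : (addLeaves k ι β).Additive where
  map_add := hom_ext' (fun _ _ ↦ rfl) (fun _ _ ↦ rfl)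

variable (k ι β) in
/-- The product of the spaces at the leaves, at the bottom element. -/
def leavesAtBot : (topInjective k ι β).FullSubcategory ⥤ LamRep k ι β where
  obj X := mk' (fun j ↦ atBot k X.obj.leafPi j) (fun _ ↦ PUnit.{u + 1})
    (fun j l h ↦ Submodule.inclusion (atBot_anti h)) (fun _ ↦ 0)
  map {X Y} f := homMk
    (fun j ↦ (leafPiMap f.hom).restrict fun _ hx ↦ map_mem_atBot _ hx) (fun _ ↦ 0)
    (fun _ _ _ _ ↦ rfl) (fun _ _ ↦ rfl)
  map_id X := hom_ext' (fun _ _ ↦ rfl) (fun _ _ ↦ rfl)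
  map_comp f g := hom_ext' (fun _ _ ↦ rfl) (fun _ _ ↦ rfl)

instance : (leavesAtBot k ι β).Additive where
  map_add := hom_ext' (fun _ _ ↦ rfl) (fun _ _ ↦ rfl)

variable (k ι β) in
/-- The inclusion in the representation with enlarged bottom element. -/
def addLeavesι : (topInjective k ι β).ι ⟶ addLeaves k ι β where
  app X := homMk (fun j ↦ LinearMap.inl k (X.obj.obj (.inl j)) (atBot k X.obj.leafPi j)) (fun _ ↦ LinearMap.id)
    (fun _ _ _ _ ↦ Prod.ext rfl rfl) (fun i x ↦ (add_zero (X.obj.leaf i x)).symm)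
  naturality X Y f := hom_ext' (fun j x ↦ Prod.ext rfl
      (Subtype.ext (map_zero (leafPiMap f.hom)).symm))
    (fun _ _ ↦ rfl)

variable (k ι β) in
/-- The projection from the representation with enlarged bottom element. -/
def addLeavesπ : addLeaves k ι β ⟶ leavesAtBot k ι β where
  app X := homMk (fun j ↦ LinearMap.snd k (X.obj.obj (.inl j)) (atBot k X.obj.leafPi j)) (fun _ ↦ 0)
    (fun _ _ _ _ ↦ rfl) (fun i x ↦ rfl)
  naturality X Y f := hom_ext' (fun _ _ ↦ rfl) (fun _ _ ↦ rfl)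

lemma leafSurjective_addLeaves [Nontrivial ι] (X : (topInjective k ι β).FullSubcategory) :
    leafSurjective k ι β ((addLeaves k ι β).obj X) := by
  have := X.property.1.finite
  refine ⟨⟨⟨?_, fun j x ↦ Prod.ext (X.property.1.chain_id j x.1) rfl,
    fun _ _ _ h h' x ↦ Prod.ext (X.property.1.chain_comp _ _ _ h h' x.1) rfl, fun i x ↦ ?_⟩, ?_⟩,
    fun i y ↦ ?_⟩
  · rintro (j | i)
    · exact inferInstanceAs (Module.Finite k (X.obj.obj (.inl j) × atBot k X.obj.leafPi j))
    · exact X.property.1.finite _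
  -- The new summand lives only at ⊥ ≠ ⊤, so nothing is added at the top and the zero relations
  -- persist.
  · have h : x.2.1 = 0 := x.2.2 top_ne_bot_of_nontrivial
    exact (congr_arg₂ (· + ·) (X.property.1.leaf_top i x.1) (congr_fun h i)).trans (add_zero _)
  · exact Function.Injective.prodMap X.property.2
      (Submodule.inclusion_injective (atBot_anti bot_le))
  · obtain ⟨f, hf⟩ := X.obj.exists_leafPi i y
    exact ⟨(0, ⟨f, mem_atBot_bot _⟩), (congr_arg (· + f i) (map_zero (X.obj.leaf i))).trans
      ((zero_add _).trans hf)⟩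

lemma leafSurjective_leavesAtBot (X : (topInjective k ι β).FullSubcategory) :
    leafSurjective k ι β ((leavesAtBot k ι β).obj X) := by
  have := X.property.1.finite
  refine ⟨⟨⟨?_, fun _ _ ↦ rfl, fun _ _ _ _ _ _ ↦ rfl, fun i x ↦ rfl⟩,
    Submodule.inclusion_injective (atBot_anti bot_le)⟩, fun i y ↦ ⟨0, rfl⟩⟩
  rintro (j | i)
  · exact inferInstanceAs (Module.Finite k (atBot k X.obj.leafPi j))
  · exact inferInstanceAs (Module.Finite k PUnit.{u + 1})

/-- Adding the product of all leaves at ⊥ makes every map to a leaf surjective. The cokernel of the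
inclusion is that product placed at ⊥ with zero leaves, where surjectivity is trivial. -/
lemma isLocalizedEquivalence_leafSurjective [Nontrivial ι] :
    (localizerInclusion (QRep.ev k (lamSource ι β) (lamTarget ι β))
      (leafSurjective_le (k := k) (ι := ι) (β := β))).IsLocalizedEquivalence := by
  refine isLocalizedEquivalence_of_right_resolution _ _ (QRep.prop_biprod _ leafSurjective_prod)
    leafSurjective_addLeaves leafSurjective_leavesAtBot (addLeavesι k ι β) (addLeavesπ k ι β)
    (fun X ↦ hom_ext' (fun j x ↦ rfl) (fun i x ↦ rfl)) ?_
  rintro (j | i) X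
  · exact QRep.shortExact_ev _ LinearMap.inl_injective (fun y ↦ ⟨(0, y), rfl⟩)
      fun x hx ↦ ⟨x.1, Prod.ext rfl hx.symm⟩
  · exact QRep.shortExact_ev _ (fun _ _ h ↦ h) (fun _ ↦ ⟨0, rfl⟩) (fun x _ ↦ ⟨x, rfl⟩)

end LeafSurjective

end LamRep

end PiecewiseHereditary

/-! ### Representations for the star and their resolutions -/

namespace PiecewiseHereditary

open Limits CochainComplex

variable (k : Type u) [Field k] (ι β : Type) [LinearOrder ι] [OrderBot ι]

/-- The source of an arrow of the chain with arrows to the bottom element. -/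
abbrev starSource : ChainArr ι ⊕ Option β → ι ⊕ Option β
  | .inl p => .inl p.1.2
  | .inr o => .inr o

/-- The target of an arrow of the chain with arrows to the bottom element. -/
abbrev starTarget : ChainArr ι ⊕ Option β → ι ⊕ Option β
  | .inl p => .inl p.1.1
  | .inr _ => .inl ⊥

/-- Contravariant representations of a chain, together with maps to the space at the bottom
element. -/
abbrev StarRep : Type (u + 1) := QRep k (starSource ι β) (starTarget ι β)

namespace StarRep

variable {k ι β}

/-- The map between two elements of the chain. -/
abbrev chain (X : StarRep k ι β) {j l : ι} (h : j ≤ l) : X.obj (.inl l) →ₗ[k] X.obj (.inl j) :=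
  X.map (.inl ⟨(j, l), h⟩)

/-- The maps to the bottom element. -/
abbrev root (X : StarRep k ι β) (o : Option β) : X.obj (.inr o) →ₗ[k] X.obj (.inl ⊥) :=
  X.map (.inr o)

/-- A representation given by its components. -/
abbrev mk' (C : ι → Type u) (A : Type u) (B : β → Type u) [∀ j, AddCommGroup (C j)]
    [∀ j, Module k (C j)] [AddCommGroup A] [Module k A] [∀ i, AddCommGroup (B i)]
    [∀ i, Module k (B i)] (c : ∀ j l, j ≤ l → C l →ₗ[k] C j)
    (a : A →ₗ[k] C ⊥) (b : ∀ i, B i →ₗ[k] C ⊥) : StarRep k ι β where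
  obj
    | .inl j => C j
    | .inr none => A
    | .inr (some i) => B i
  addCommGroup
    | .inl j => inferInstanceAs (AddCommGroup (C j))
    | .inr none => inferInstanceAs (AddCommGroup A)
    | .inr (some i) => inferInstanceAs (AddCommGroup (B i))
  module
    | .inl j => inferInstanceAs (Module k (C j))
    | .inr none => inferInstanceAs (Module k A)
    | .inr (some i) => inferInstanceAs (Module k (B i))
  map
    | .inl p => c _ _ p.2
    | .inr none => a
    | .inr (some i) => b i

/-- A morphism given by its components. -/
abbrev homMk {X Y : StarRep k ι β} (f : ∀ j, X.obj (.inl j) →ₗ[k] Y.obj (.inl j))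
    (g : X.obj (.inr none) →ₗ[k] Y.obj (.inr none))
    (g' : ∀ i, X.obj (.inr (some i)) →ₗ[k] Y.obj (.inr (some i)))
    (hf : ∀ j l (h : j ≤ l) x, f j (X.chain h x) = Y.chain h (f l x))
    (hg : ∀ x, f ⊥ (X.root none x) = Y.root none (g x))
    (hg' : ∀ i x, f ⊥ (X.root (some i) x) = Y.root (some i) (g' i x)) : X ⟶ Y where
  app
    | .inl j => f j
    | .inr none => g
    | .inr (some i) => g' i
  comm
    | .inl p => hf _ _ p.2
    | .inr none => hg
    | .inr (some i) => hg' i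

lemma hom_ext' {X Y : StarRep k ι β} {f g : X ⟶ Y}
    (h : ∀ j x, f.app (.inl j) x = g.app (.inl j) x)
    (h₀ : ∀ x, f.app (.inr none) x = g.app (.inr none) x)
    (h' : ∀ i x, f.app (.inr (some i)) x = g.app (.inr (some i)) x) : f = g :=
  QRep.hom_ext (by rintro (j | _ | i) x; exacts [h j x, h₀ x, h' i x])

lemma app_chain {X Y : StarRep k ι β} (f : X ⟶ Y) {j l : ι} (h : j ≤ l) (x : X.obj (.inl l)) :
    f.app (.inl j) (X.chain h x) = Y.chain h (f.app (.inl l) x) :=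
  f.comm (.inl ⟨(j, l), h⟩) x

lemma app_root {X Y : StarRep k ι β} (f : X ⟶ Y) (o : Option β) (x : X.obj (.inr o)) :
    f.app (.inl ⊥) (X.root o x) = Y.root o (f.app (.inr o) x) :=
  f.comm (.inr o) x

lemma map_injective_of_iso {X Y : StarRep k ι β} (e : X ≅ Y) (a : ChainArr ι ⊕ Option β)
    (h : Function.Injective (X.map a)) : Function.Injective (Y.map a) := by
  intro y y' hy
  rw [QRep.map_eq_of_iso e, QRep.map_eq_of_iso e _ y'] at hy
  exact (QRep.isoApp e.symm _).injective (h ((QRep.isoApp e _).injective hy))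

variable [OrderTop ι]

/-- Functoriality on the chain, which vanishes at the top. -/
structure Relations (X : StarRep k ι β) : Prop where
  finite : ∀ v, Module.Finite k (X.obj v)
  chain_id : ∀ j x, X.chain (le_refl j) x = x
  chain_comp : ∀ i j l (h : i ≤ j) (h' : j ≤ l) x,
    X.chain h (X.chain h' x) = X.chain (h.trans h') x
  top_eq_zero : ∀ x : X.obj (.inl ⊤), x = 0

variable (k ι β) in
/-- The representations which satisfy the relations. -/
def relations : ObjectProperty (StarRep k ι β) := Relations

variable (k ι β) in
/-- The representations such that all maps to the bottom, with one exception, are injective. -/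
def rootInjective : ObjectProperty (StarRep k ι β) := fun X ↦
  X.Relations ∧ ∀ i, Function.Injective (X.root (some i))

variable (k ι β) in
/-- The representations such that moreover the remaining map to the bottom is surjective. -/
def rootSurjective : ObjectProperty (StarRep k ι β) := fun X ↦
  rootInjective k ι β X ∧ Function.Surjective (X.root none)

lemma rootInjective_le : rootInjective k ι β ≤ relations k ι β := fun _ h ↦ h.1

lemma rootSurjective_le : rootSurjective k ι β ≤ rootInjective k ι β := fun _ h ↦ h.1

lemma Relations.of_iso {X Y : StarRep k ι β} (e : X ≅ Y) (h : X.Relations) : Y.Relations where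
  finite v := have := h.finite v; Module.Finite.equiv (QRep.isoApp e v)
  chain_id j x := by
    obtain ⟨x, rfl⟩ := (QRep.isoApp e _).surjective x
    exact (app_chain e.hom _ x).symm.trans (congr_arg (e.hom.app _) (h.chain_id j x))
  chain_comp i j l h₁ h₂ x := by
    obtain ⟨x, rfl⟩ := (QRep.isoApp e _).surjective x
    refine Eq.trans ?_ ((congr_arg (e.hom.app _) (h.chain_comp i j l h₁ h₂ x)).trans
      (app_chain e.hom _ x))
    exact (congr_arg (Y.chain h₁) (app_chain e.hom h₂ x).symm).trans (app_chain e.hom h₁ _).symm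
  top_eq_zero x := by
    obtain ⟨x, rfl⟩ := (QRep.isoApp e _).surjective x
    exact (congr_arg (e.hom.app _) (h.top_eq_zero x)).trans (map_zero _)

instance : (relations k ι β).IsClosedUnderIsomorphisms := ⟨Relations.of_iso⟩

instance : (rootInjective k ι β).IsClosedUnderIsomorphisms :=
  ⟨fun e h ↦ ⟨h.1.of_iso e, fun i ↦ map_injective_of_iso e _ (h.2 i)⟩⟩

instance : (rootSurjective k ι β).IsClosedUnderIsomorphisms :=
  ⟨fun {X Y} e h ↦ ⟨(rootInjective k ι β).prop_of_iso e h.1, fun y ↦ by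
    obtain ⟨x, hx⟩ := h.2 (e.inv.app _ y)
    refine ⟨e.hom.app _ x, ?_⟩
    exact (app_root e.hom none x).symm.trans
      ((congr_arg (e.hom.app _) hx).trans (QRep.inv_hom_app e _ y))⟩⟩

lemma Relations.prod {X Y : StarRep k ι β} (hX : X.Relations) (hY : Y.Relations) :
    Relations (QRep.prod X Y) where
  finite v := have := hX.finite v; have := hY.finite v; inferInstanceAs (Module.Finite k (_ × _))
  chain_id _ _ := Prod.ext (hX.chain_id _ _) (hY.chain_id _ _)
  chain_comp _ _ _ _ _ _ := Prod.ext (hX.chain_comp _ _ _ _ _ _) (hY.chain_comp _ _ _ _ _ _)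
  top_eq_zero _ := Prod.ext (hX.top_eq_zero _) (hY.top_eq_zero _)

lemma rootInjective_prod (X Y : StarRep k ι β) (hX : rootInjective k ι β X)
    (hY : rootInjective k ι β Y) : rootInjective k ι β (QRep.prod X Y) :=
  ⟨hX.1.prod hY.1, fun i ↦ Function.Injective.prodMap (hX.2 i) (hY.2 i)⟩

lemma rootSurjective_prod (X Y : StarRep k ι β) (hX : rootSurjective k ι β X)
    (hY : rootSurjective k ι β Y) : rootSurjective k ι β (QRep.prod X Y) :=
  ⟨rootInjective_prod X Y hX.1 hY.1, Function.Surjective.prodMap hX.2 hY.2⟩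

section RootInjective

/-- The product of the spaces with injective maps to the bottom. -/
abbrev rootPi (X : StarRep k ι β) : Type u := ∀ i, X.obj (.inr (some i))

/-- The map between products of the spaces with injective maps to the bottom. -/
abbrev rootPiMap {X Y : StarRep k ι β} (f : X ⟶ Y) : X.rootPi →ₗ[k] Y.rootPi :=
  piMap fun i ↦ f.app (.inr (some i))

variable [DecidableEq β]

/-- The inclusion of a factor. -/
abbrev rootSingle (X : StarRep k ι β) (i : β) : X.obj (.inr (some i)) →ₗ[k] X.rootPi :=
  LinearMap.single k (fun i ↦ X.obj (.inr (some i))) i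

omit [OrderTop ι] in
lemma rootPiMap_rootSingle {X Y : StarRep k ι β} (f : X ⟶ Y) (i : β) (x : X.obj (.inr (some i))) :
    rootPiMap f (X.rootSingle i x) = Y.rootSingle i (f.app (.inr (some i)) x) := by
  funext i'
  by_cases h : i' = i
  · subst h
    simp
  · simp [h]

variable (k ι β) in
/-- The representation with enlarged bottom element, so that the maps to it are injective. -/
def addRoots : (relations k ι β).FullSubcategory ⥤ StarRep k ι β where
  obj X := mk' (fun j ↦ X.obj.obj (.inl j) × atBot k X.obj.rootPi j) (X.obj.obj (.inr none))
    (fun i ↦ X.obj.obj (.inr (some i)))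
    (fun j l h ↦ (X.obj.chain h).prodMap (Submodule.inclusion (atBot_anti h)))
    (LinearMap.inl k (X.obj.obj (.inl ⊥)) (atBot k X.obj.rootPi (⊥ : ι)) ∘ₗ X.obj.root none)
    (fun i ↦ (X.obj.root (some i)).prod ((X.obj.rootSingle i).codRestrict
      (atBot k X.obj.rootPi (⊥ : ι)) fun _ ↦ mem_atBot_bot _))
  map {X Y} f := homMk
    (fun j ↦ (f.hom.app (.inl j)).prodMap
      ((rootPiMap f.hom).restrict fun _ hx ↦ map_mem_atBot _ hx))
    (f.hom.app (.inr none))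
    (fun i ↦ f.hom.app (.inr (some i)))
    (fun _ _ h x ↦ Prod.ext (app_chain f.hom h x.1) rfl)
    (fun x ↦ Prod.ext (app_root f.hom none x) (Subtype.ext (map_zero (rootPiMap f.hom))))
    (fun i x ↦ Prod.ext (app_root f.hom (some i) x)
      (Subtype.ext (rootPiMap_rootSingle f.hom i x)))
  map_id X := hom_ext' (fun _ _ ↦ rfl) (fun _ ↦ rfl) (fun _ _ ↦ rfl)
  map_comp f g := hom_ext' (fun _ _ ↦ rfl) (fun _ ↦ rfl) (fun _ _ ↦ rfl)

instance : (addRoots k ι β).Additive where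
  map_add := hom_ext' (fun _ _ ↦ rfl) (fun _ ↦ rfl) (fun _ _ ↦ rfl)

omit [DecidableEq β] in
variable (k ι β) in
/-- The product of the spaces with injective maps to the bottom, placed at the bottom. -/
def rootsAtBot : (relations k ι β).FullSubcategory ⥤ StarRep k ι β where
  obj X := mk' (fun j ↦ atBot k X.obj.rootPi j) PUnit.{u + 1} (fun _ ↦ PUnit.{u + 1})
    (fun j l h ↦ Submodule.inclusion (atBot_anti h)) 0 (fun _ ↦ 0)
  map {X Y} f := homMk
    (fun j ↦ (rootPiMap f.hom).restrict fun _ hx ↦ map_mem_atBot _ hx) 0 (fun _ ↦ 0)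
    (fun _ _ _ _ ↦ rfl) (fun _ ↦ Subtype.ext (map_zero (rootPiMap f.hom)))
    (fun _ _ ↦ Subtype.ext (map_zero (rootPiMap f.hom)))
  map_id X := hom_ext' (fun _ _ ↦ rfl) (fun _ ↦ rfl) (fun _ _ ↦ rfl)
  map_comp f g := hom_ext' (fun _ _ ↦ rfl) (fun _ ↦ rfl) (fun _ _ ↦ rfl)

instance : (rootsAtBot k ι β).Additive where
  map_add := hom_ext' (fun _ _ ↦ rfl) (fun _ ↦ rfl) (fun _ _ ↦ rfl)

variable (k ι β) in
/-- The inclusion in the representation with enlarged bottom element. -/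
def addRootsι : rootsAtBot k ι β ⟶ addRoots k ι β where
  app X := homMk (fun j ↦ LinearMap.inr k (X.obj.obj (.inl j)) (atBot k X.obj.rootPi j))
    0 (fun _ ↦ 0)
    (fun _ _ h _ ↦ Prod.ext (map_zero (X.obj.chain h)).symm rfl)
    (fun _ ↦ Prod.ext (map_zero (X.obj.root none)).symm rfl)
    (fun i _ ↦ Prod.ext (map_zero (X.obj.root (some i))).symm
      (Subtype.ext (map_zero (X.obj.rootSingle i)).symm))
  naturality X Y f := hom_ext'
    (fun j x ↦ Prod.ext (map_zero (f.hom.app (.inl j))).symm rfl)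
    (fun _ ↦ (map_zero (f.hom.app (.inr none))).symm)
    (fun i _ ↦ (map_zero (f.hom.app (.inr (some i)))).symm)

variable (k ι β) in
/-- The projection from the representation with enlarged bottom element. -/
def addRootsπ : addRoots k ι β ⟶ (relations k ι β).ι where
  app X := homMk (fun j ↦ LinearMap.fst k (X.obj.obj (.inl j)) (atBot k X.obj.rootPi j))
    LinearMap.id (fun _ ↦ LinearMap.id)
    (fun _ _ _ _ ↦ rfl) (fun _ ↦ rfl) (fun i x ↦ rfl)
  naturality X Y f := hom_ext' (fun _ _ ↦ rfl) (fun _ ↦ rfl) (fun _ _ ↦ rfl)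

variable [Finite β]

/-- The second component of each nonexceptional map to ⊥ is the inclusion of a factor in the
product, hence the map is injective. The space at ⊤ stays zero because the product is added only at
⊥ ≠ ⊤. -/
lemma rootInjective_addRoots [Nontrivial ι] (X : (relations k ι β).FullSubcategory) :
    rootInjective k ι β ((addRoots k ι β).obj X) := by
  have := X.property.finite
  refine ⟨⟨?_, fun j x ↦ Prod.ext (X.property.chain_id j x.1) rfl,
    fun _ _ _ h h' x ↦ Prod.ext (X.property.chain_comp _ _ _ h h' x.1) rfl, fun x ↦ ?_⟩,
    fun i x y h ↦ ?_⟩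
  · rintro (j | _ | i)
    · exact inferInstanceAs (Module.Finite k (X.obj.obj (.inl j) × atBot k X.obj.rootPi j))
    · exact X.property.finite _
    · exact X.property.finite _
  · exact Prod.ext (X.property.top_eq_zero _)
      (Subtype.ext (x.2.2 top_ne_bot_of_nontrivial))
  · exact Pi.single_injective (M := fun i ↦ X.obj.obj (.inr (some i))) i
      (congr_arg (fun z : X.obj.obj (.inl ⊥) × atBot k X.obj.rootPi (⊥ : ι) ↦ z.2.1) h)

lemma rootInjective_rootsAtBot [Nontrivial ι] (X : (relations k ι β).FullSubcategory) :
    rootInjective k ι β ((rootsAtBot k ι β).obj X) := by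
  have := X.property.finite
  refine ⟨⟨?_, fun _ _ ↦ rfl, fun _ _ _ _ _ _ ↦ rfl,
    fun x ↦ Subtype.ext (x.2 top_ne_bot_of_nontrivial)⟩, fun _ _ _ _ ↦ rfl⟩
  rintro (j | _ | i)
  · exact inferInstanceAs (Module.Finite k (atBot k X.obj.rootPi j))
  · exact inferInstanceAs (Module.Finite k PUnit.{u + 1})
  · exact inferInstanceAs (Module.Finite k PUnit.{u + 1})

omit [DecidableEq β] in
-- Forgetting the added product is surjective, with kernel the product placed at ⊥; that kernel
-- vanishes on the short arms, so its maps are trivially injective.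
lemma isLocalizedEquivalence_rootInjective [Nontrivial ι] :
    (localizerInclusion (QRep.ev k (starSource ι β) (starTarget ι β))
      (rootInjective_le (k := k) (ι := ι) (β := β))).IsLocalizedEquivalence := by
  classical
  refine isLocalizedEquivalence_of_left_resolution _ _ (QRep.prop_biprod _ rootInjective_prod)
    rootInjective_rootsAtBot rootInjective_addRoots (addRootsι k ι β) (addRootsπ k ι β)
    (fun X ↦ hom_ext' (fun j x ↦ rfl) (fun x ↦ rfl) (fun i x ↦ rfl)) ?_
  rintro (j | _ | i) X
  · exact QRep.shortExact_ev _ (fun _ _ h ↦ congr_arg Prod.snd h) (fun y ↦ ⟨(y, 0), rfl⟩)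
      fun x hx ↦ ⟨x.2, Prod.ext hx.symm rfl⟩
  · exact QRep.shortExact_ev _ (fun _ _ _ ↦ rfl) (fun y ↦ ⟨y, rfl⟩) (fun x hx ↦ ⟨0, hx.symm⟩)
  · exact QRep.shortExact_ev _ (fun _ _ _ ↦ rfl) (fun y ↦ ⟨y, rfl⟩) (fun x hx ↦ ⟨0, hx.symm⟩)

end RootInjective

section RootSurjective

variable (k ι β) in
/-- The representation with a surjective map to the bottom. -/
def addBot : (rootInjective k ι β).FullSubcategory ⥤ StarRep k ι β where
  obj X := mk' (fun j ↦ X.obj.obj (.inl j)) (X.obj.obj (.inr none) × X.obj.obj (.inl ⊥))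
    (fun i ↦ X.obj.obj (.inr (some i)))
    (fun j l h ↦ X.obj.chain h) ((X.obj.root none).coprod LinearMap.id)
    (fun i ↦ X.obj.root (some i))
  map {X Y} f := homMk
    (fun j ↦ f.hom.app (.inl j))
    ((f.hom.app (.inr none)).prodMap (f.hom.app (.inl ⊥)))
    (fun i ↦ f.hom.app (.inr (some i)))
    (fun _ _ h x ↦ app_chain f.hom h x)
    (fun x ↦ (map_add (f.hom.app (.inl ⊥)) _ _).trans
      (congr_arg (· + f.hom.app (.inl ⊥) x.2) (app_root f.hom none x.1)))
    (fun i x ↦ app_root f.hom (some i) x)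
  map_id X := hom_ext' (fun _ _ ↦ rfl) (fun _ ↦ rfl) (fun _ _ ↦ rfl)
  map_comp f g := hom_ext' (fun _ _ ↦ rfl) (fun _ ↦ rfl) (fun _ _ ↦ rfl)

instance : (addBot k ι β).Additive where
  map_add := hom_ext' (fun _ _ ↦ rfl) (fun _ ↦ rfl) (fun _ _ ↦ rfl)

variable (k ι β) in
/-- The space at the bottom, placed at a root. -/
def botAtRoot : (rootInjective k ι β).FullSubcategory ⥤ StarRep k ι β where
  obj X := mk' (fun _ ↦ PUnit.{u + 1}) (X.obj.obj (.inl ⊥)) (fun _ ↦ PUnit.{u + 1})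
    (fun _ _ _ ↦ 0) 0 (fun _ ↦ 0)
  map {X Y} f := homMk (fun _ ↦ 0) (f.hom.app (.inl ⊥)) (fun _ ↦ 0)
    (fun _ _ _ _ ↦ rfl) (fun _ ↦ rfl) (fun _ _ ↦ rfl)
  map_id X := hom_ext' (fun _ _ ↦ rfl) (fun _ ↦ rfl) (fun _ _ ↦ rfl)
  map_comp f g := hom_ext' (fun _ _ ↦ rfl) (fun _ ↦ rfl) (fun _ _ ↦ rfl)

instance : (botAtRoot k ι β).Additive where
  map_add := hom_ext' (fun _ _ ↦ rfl) (fun _ ↦ rfl) (fun _ _ ↦ rfl)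

variable (k ι β) in
/-- The inclusion in the representation with a surjective map to the bottom. -/
def addBotι : (rootInjective k ι β).ι ⟶ addBot k ι β where
  app X := homMk (fun j ↦ LinearMap.id)
    (LinearMap.inl k (X.obj.obj (.inr none)) (X.obj.obj (.inl ⊥))) (fun _ ↦ LinearMap.id)
    (fun _ _ _ _ ↦ rfl) (fun x ↦ (add_zero (X.obj.root none x)).symm) (fun _ _ ↦ rfl)
  naturality X Y f := hom_ext' (fun _ _ ↦ rfl)
    (fun x ↦ Prod.ext rfl (map_zero (f.hom.app (.inl ⊥))).symm) (fun _ _ ↦ rfl)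

variable (k ι β) in
/-- The projection from the representation with a surjective map to the bottom. -/
def addBotπ : addBot k ι β ⟶ botAtRoot k ι β where
  app X := homMk (fun j ↦ 0)
    (LinearMap.snd k (X.obj.obj (.inr none)) (X.obj.obj (.inl ⊥))) (fun _ ↦ 0)
    (fun _ _ _ _ ↦ rfl) (fun _ ↦ rfl) (fun _ _ ↦ rfl)
  naturality X Y f := hom_ext' (fun _ _ ↦ rfl) (fun _ ↦ rfl) (fun _ _ ↦ rfl)

lemma rootSurjective_addBot (X : (rootInjective k ι β).FullSubcategory) :
    rootSurjective k ι β ((addBot k ι β).obj X) := by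
  have := X.property.1.finite
  refine ⟨⟨⟨?_, X.property.1.chain_id, X.property.1.chain_comp, X.property.1.top_eq_zero⟩,
    X.property.2⟩, fun y ↦ ⟨(0, y), ?_⟩⟩
  · rintro (j | _ | i)
    · exact X.property.1.finite _
    · exact inferInstanceAs (Module.Finite k (X.obj.obj (.inr none) × X.obj.obj (.inl ⊥)))
    · exact X.property.1.finite _
  · exact (congr_arg (· + y) (map_zero (X.obj.root none))).trans (zero_add y)

lemma rootSurjective_botAtRoot (X : (rootInjective k ι β).FullSubcategory) :
    rootSurjective k ι β ((botAtRoot k ι β).obj X) := by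
  refine ⟨⟨⟨?_, fun _ _ ↦ rfl, fun _ _ _ _ _ _ ↦ rfl, fun _ ↦ rfl⟩,
    fun _ _ _ _ ↦ rfl⟩, fun y ↦ ⟨0, rfl⟩⟩
  rintro (j | _ | i)
  · exact inferInstanceAs (Module.Finite k PUnit.{u + 1})
  · exact X.property.1.finite _
  · exact inferInstanceAs (Module.Finite k PUnit.{u + 1})

/-- Adding a copy of the space at ⊥ to the exceptional short arm makes its map surjective and leaves
the injective maps untouched. The cokernel is supported on that arm alone. -/
lemma isLocalizedEquivalence_rootSurjective :
    (localizerInclusion (QRep.ev k (starSource ι β) (starTarget ι β))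
      (rootSurjective_le (k := k) (ι := ι) (β := β))).IsLocalizedEquivalence := by
  refine isLocalizedEquivalence_of_right_resolution _ _ (QRep.prop_biprod _ rootSurjective_prod)
    rootSurjective_addBot rootSurjective_botAtRoot (addBotι k ι β) (addBotπ k ι β)
    (fun X ↦ hom_ext' (fun j x ↦ rfl) (fun x ↦ rfl) (fun i x ↦ rfl)) ?_
  rintro (j | _ | i) X
  · exact QRep.shortExact_ev _ (fun _ _ h ↦ h) (fun _ ↦ ⟨0, rfl⟩) (fun x _ ↦ ⟨x, rfl⟩)
  · exact QRep.shortExact_ev _ LinearMap.inl_injective (fun y ↦ ⟨(0, y), rfl⟩)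
      fun x hx ↦ ⟨x.1, Prod.ext rfl hx.symm⟩
  · exact QRep.shortExact_ev _ (fun _ _ h ↦ h) (fun _ ↦ ⟨0, rfl⟩) (fun x _ ↦ ⟨x, rfl⟩)

end RootSurjective

end StarRep

end PiecewiseHereditary

/-! ### The reduction functor and short exact sequences relating both sides -/

namespace CochainComplex

variable {E 𝒱 : Type*} [Category* E] [Preadditive E] [Category* 𝒱] [Abelian 𝒱]

/-- The short complex of complexes given by natural transformations. -/
abbrev mapShortComplex {F G H : E ⥤ 𝒱} [F.Additive] [G.Additive] [H.Additive] (α : F ⟶ G)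
    (β : G ⟶ H) (w : ∀ X, α.app X ≫ β.app X = 0) (K : CochainComplex E ℤ) :
    ShortComplex (CochainComplex 𝒱 ℤ) :=
  ShortComplex.mk ((NatTrans.mapHomologicalComplex α (ComplexShape.up ℤ)).app K)
    ((NatTrans.mapHomologicalComplex β (ComplexShape.up ℤ)).app K) (by
      ext n
      exact w _)

lemma shortExact_mapShortComplex {F G H : E ⥤ 𝒱} [F.Additive] [G.Additive] [H.Additive]
    (α : F ⟶ G) (β : G ⟶ H) (w : ∀ X, α.app X ≫ β.app X = 0)
    (h : ∀ X, (ShortComplex.mk _ _ (w X)).ShortExact) (K : CochainComplex E ℤ) :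
    (mapShortComplex α β w K).ShortExact :=
  HomologicalComplex.shortExact_of_degreewise_shortExact _ fun n ↦ h (K.X n)

end CochainComplex

namespace PiecewiseHereditary

open Limits CochainComplex

section LinearAlgebra

variable {k : Type*} [Field k] {M N T : Type*} [AddCommGroup M] [Module k M] [AddCommGroup N]
  [Module k N] [AddCommGroup T] [Module k T]

lemma exists_comp_eq_of_injective (h : N →ₗ[k] T) (hh : Function.Injective h) (g : M →ₗ[k] T)
    (H : ∀ x, ∃ y, h y = g x) : ∃ f : M →ₗ[k] N, ∀ x, h (f x) = g x := by
  refine ⟨(LinearEquiv.ofInjective h hh).symm ∘ₗ g.codRestrict (LinearMap.range h) H, fun x ↦ ?_⟩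
  have := congr_arg Subtype.val
    ((LinearEquiv.ofInjective h hh).apply_symm_apply (g.codRestrict (LinearMap.range h) H x))
  exact this

lemma exists_comp_eq_of_surjective (h : M →ₗ[k] N) (hh : Function.Surjective h) (g : M →ₗ[k] T)
    (H : ∀ x, h x = 0 → g x = 0) : ∃ f : N →ₗ[k] T, ∀ x, f (h x) = g x := by
  obtain ⟨s, hs⟩ := h.exists_rightInverse_of_surjective (LinearMap.range_eq_top.2 hh)
  refine ⟨g ∘ₗ s, fun x ↦ ?_⟩
  have hs' : h (s (h x)) = h x := LinearMap.congr_fun hs (h x)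
  rw [LinearMap.comp_apply, ← sub_eq_zero, ← map_sub]
  exact H _ (by rw [map_sub, hs', sub_self])

end LinearAlgebra

namespace LamRep

variable {k : Type u} [Field k] {ι β : Type} [LinearOrder ι] [OrderBot ι] [OrderTop ι]

/-- The image of the space at the top. -/
abbrev topRange (X : LamRep k ι β) (j : ι) : Submodule k (X.obj (.inl j)) :=
  LinearMap.range (X.chain (le_top : j ≤ ⊤))

lemma Relations.topRange_le {X : LamRep k ι β} (hX : X.Relations) {j l : ι} (h : j ≤ l) :
    X.topRange l ≤ (X.topRange j).comap (X.chain h) := by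
  rintro _ ⟨x, rfl⟩
  exact ⟨x, (hX.chain_comp _ _ _ _ _ _).symm⟩

/-- The map to a leaf from the quotient at the bottom. -/
abbrev leafQ {X : LamRep k ι β} (hX : X.Relations) (i : β) :
    (X.obj (.inl ⊥) ⧸ X.topRange ⊥) →ₗ[k] X.obj (.inr i) :=
  (X.topRange ⊥).liftQ (X.leaf i) (by
    rintro _ ⟨x, rfl⟩
    exact hX.leaf_top i x)

lemma topRange_le_comap_app {X Y : LamRep k ι β} (f : X ⟶ Y) (j : ι) :
    X.topRange j ≤ (Y.topRange j).comap (f.app (.inl j)) := by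
  rintro _ ⟨x, rfl⟩
  exact ⟨f.app _ x, (app_chain f _ x).symm⟩

/-- The map between quotients by the images of the space at the top. -/
abbrev appQ {X Y : LamRep k ι β} (f : X ⟶ Y) (j : ι) :
    (X.obj (.inl j) ⧸ X.topRange j) →ₗ[k] (Y.obj (.inl j) ⧸ Y.topRange j) :=
  Submodule.mapQ _ _ (f.app (.inl j)) (topRange_le_comap_app f j)

lemma appQ_id (X : LamRep k ι β) (j : ι) (x : X.obj (.inl j) ⧸ X.topRange j) :
    appQ (𝟙 X) j x = x := by
  obtain ⟨x, rfl⟩ := Submodule.mkQ_surjective _ x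
  rfl

lemma appQ_comp {X Y Z : LamRep k ι β} (f : X ⟶ Y) (g : Y ⟶ Z) (j : ι)
    (x : X.obj (.inl j) ⧸ X.topRange j) : appQ (f ≫ g) j x = appQ g j (appQ f j x) := by
  obtain ⟨x, rfl⟩ := Submodule.mkQ_surjective _ x
  rfl

lemma appQ_add {X Y : LamRep k ι β} (f g : X ⟶ Y) (j : ι)
    (x : X.obj (.inl j) ⧸ X.topRange j) : appQ (f + g) j x = appQ f j x + appQ g j x := by
  obtain ⟨x, rfl⟩ := Submodule.mkQ_surjective _ x
  rfl

lemma appQ_smul {X Y : LamRep k ι β} (c : k) (f : X ⟶ Y) (j : ι)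
    (x : X.obj (.inl j) ⧸ X.topRange j) : appQ (c • f) j x = c • appQ f j x := by
  obtain ⟨x, rfl⟩ := Submodule.mkQ_surjective _ x
  rfl

lemma leafQ_appQ {X Y : LamRep k ι β} (hX : X.Relations) (hY : Y.Relations) (f : X ⟶ Y) (i : β)
    (x : X.obj (.inl ⊥) ⧸ X.topRange ⊥) :
    leafQ hY i (appQ f ⊥ x) = f.app (.inr i) (leafQ hX i x) := by
  obtain ⟨x, rfl⟩ := Submodule.mkQ_surjective _ x
  exact (app_leaf f i x).symm

variable (k ι β) in
/-- The passage to the quotient by the space at the top, and from the leaves to the kernels of the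
maps to them. -/
def quotientTop : (relations k ι β).FullSubcategory ⥤ StarRep k ι β where
  obj X := StarRep.mk' (fun j ↦ X.obj.obj (.inl j) ⧸ X.obj.topRange j) (X.obj.obj (.inl ⊥))
    (fun i ↦ LinearMap.ker (leafQ X.property i))
    (fun j l h ↦ Submodule.mapQ _ _ (X.obj.chain h) (X.property.topRange_le h))
    (Submodule.mkQ (X.obj.topRange ⊥)) (fun i ↦ Submodule.subtype _)
  map {X Y} f := StarRep.homMk (fun j ↦ appQ f.hom j) (f.hom.app (.inl ⊥))
    (fun i ↦ (appQ f.hom ⊥).restrict fun x hx ↦ by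
      have hx' : leafQ X.property i x = 0 := hx
      exact (leafQ_appQ X.property Y.property f.hom i x).trans
        ((congr_arg (f.hom.app (.inr i)) hx').trans (map_zero _)))
    (fun j l h x ↦ by
      obtain ⟨x, rfl⟩ := Submodule.mkQ_surjective _ x
      exact congr_arg (Y.obj.topRange j).mkQ (app_chain f.hom h x))
    (fun _ ↦ rfl) (fun _ _ ↦ rfl)
  map_id X := StarRep.hom_ext'
    (fun j x ↦ appQ_id X.obj j x) (fun _ ↦ rfl)
    (fun i x ↦ Subtype.ext (appQ_id X.obj ⊥ x.1))
  map_comp f g := StarRep.hom_ext'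
    (fun j x ↦ appQ_comp f.hom g.hom j x) (fun _ ↦ rfl)
    (fun i x ↦ Subtype.ext (appQ_comp f.hom g.hom ⊥ x.1))

instance : (quotientTop k ι β).Additive where
  map_add := StarRep.hom_ext'
    (fun j x ↦ appQ_add _ _ j x) (fun _ ↦ rfl)
    (fun i x ↦ Subtype.ext (appQ_add _ _ ⊥ x.1))

instance : (quotientTop k ι β).Linear k where
  map_smul _ _ := StarRep.hom_ext'
    (fun j x ↦ appQ_smul _ _ j x) (fun _ ↦ rfl)
    (fun i x ↦ Subtype.ext (appQ_smul _ _ ⊥ x.1))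

/-- Kernels include injectively, the projection at ⊥ is onto, and at ⊤ the quotient is by the whole
space. The conditions of `leafSurjective` are not needed for this. -/
lemma rootSurjective_quotientTop (X : (relations k ι β).FullSubcategory) :
    StarRep.rootSurjective k ι β ((quotientTop k ι β).obj X) := by
  have := X.property.finite
  refine ⟨⟨⟨?_, ?_, ?_, ?_⟩, fun i ↦ Subtype.val_injective⟩, Submodule.mkQ_surjective _⟩
  · rintro (j | _ | i)
    · exact inferInstanceAs (Module.Finite k (X.obj.obj (.inl j) ⧸ X.obj.topRange j))
    · exact X.property.finite _
    · exact inferInstanceAs (Module.Finite k (LinearMap.ker (leafQ X.property i)))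
  · intro j x
    obtain ⟨x, rfl⟩ := Submodule.mkQ_surjective _ x
    exact congr_arg (X.obj.topRange j).mkQ (X.property.chain_id _ _)
  · intro i j l h h' x
    obtain ⟨x, rfl⟩ := Submodule.mkQ_surjective _ x
    exact congr_arg (X.obj.topRange i).mkQ (X.property.chain_comp _ _ _ h h' x)
  · intro x
    obtain ⟨x, rfl⟩ := Submodule.mkQ_surjective _ x
    exact (Submodule.Quotient.mk_eq_zero _).2 ⟨x, X.property.chain_id _ _⟩

variable (k ι β) in
/-- The passage to the quotient by the space at the top, on the smaller subcategory. -/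
abbrev quotientTopOfLE : (leafSurjective k ι β).FullSubcategory ⥤ StarRep k ι β :=
  ObjectProperty.ιOfLE (leafSurjective_le.trans topInjective_le) ⋙ quotientTop k ι β

variable (k ι β) in
/-- The passage to the quotient by the space at the top, on representations with injectivity and
surjectivity conditions. -/
def reduction :
    (leafSurjective k ι β).FullSubcategory ⥤ (StarRep.rootSurjective k ι β).FullSubcategory :=
  (StarRep.rootSurjective k ι β).lift (quotientTopOfLE k ι β) fun _ ↦ rootSurjective_quotientTop _

instance : (quotientTopOfLE k ι β).Linear k :=
  have : (ObjectProperty.ιOfLE (leafSurjective_le.trans (topInjective_le (k := k) (ι := ι)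
    (β := β)))).Linear k := ⟨fun _ _ ↦ rfl⟩
  inferInstance

instance : (reduction k ι β).Additive where
  map_add {X Y f g} := (StarRep.rootSurjective k ι β).ι.map_injective
    (show (quotientTopOfLE k ι β).map (f + g) = _ from Functor.map_add _)

instance : (reduction k ι β).Linear k where
  map_smul f c := (StarRep.rootSurjective k ι β).ι.map_injective
    (show (quotientTopOfLE k ι β).map (c • f) = _ from CategoryTheory.Functor.map_smul _ _ _)

section Thick

variable (k ι β) in
/-- The evaluation of a representation at a vertex. -/
abbrev evSub (v : ι ⊕ β) : (leafSurjective k ι β).FullSubcategory ⥤ ModuleCat.{u} k :=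
  (leafSurjective k ι β).ι ⋙ QRep.ev k (lamSource ι β) (lamTarget ι β) v

variable (k ι β) in
/-- The evaluation of the reduction of a representation at a vertex. -/
abbrev evReduction (v : ι ⊕ Option β) : (leafSurjective k ι β).FullSubcategory ⥤ ModuleCat.{u} k :=
  reduction k ι β ⋙ (StarRep.rootSurjective k ι β).ι ⋙
    QRep.ev k (starSource ι β) (starTarget ι β) v

variable (k ι β) in
/-- The map from the top to any element of the chain. -/
def evTop (j : ι) : evSub k ι β (.inl ⊤) ⟶ evSub k ι β (.inl j) where
  app X := ModuleCat.ofHom (X.obj.chain le_top)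
  naturality X Y f := by
    ext x
    exact (app_chain f.hom le_top x).symm

variable (k ι β) in
/-- The projection to the quotient by the image of the top. -/
def evMkQ (j : ι) : evSub k ι β (.inl j) ⟶ evReduction k ι β (.inl j) where
  app X := ModuleCat.ofHom (X.obj.topRange j).mkQ

variable (k ι β) in
/-- The inclusion of the kernel of the map to a leaf. -/
def evKer (i : β) : evReduction k ι β (.inr (some i)) ⟶ evReduction k ι β (.inl ⊥) where
  app X := ModuleCat.ofHom (LinearMap.ker (leafQ X.property.1.1 i)).subtype

variable (k ι β) in
/-- The map to a leaf. -/
def evLeaf (i : β) : evReduction k ι β (.inl ⊥) ⟶ evSub k ι β (.inr i) where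
  app X := ModuleCat.ofHom (leafQ X.property.1.1 i)
  naturality X Y f := by
    ext x
    exact leafQ_appQ X.property.1.1 Y.property.1.1 f.hom i x

/-- The injective map from ⊤ to ⊥ factors through the space at `j`. -/
lemma chain_top_injective {X : LamRep k ι β} (hX : topInjective k ι β X) (j : ι) :
    Function.Injective (X.chain (le_top : j ≤ ⊤)) := fun x y h ↦
  hX.2 ((hX.1.chain_comp _ _ _ bot_le le_top x).symm.trans
    ((congr_arg (X.chain bot_le) h).trans (hX.1.chain_comp _ _ _ bot_le le_top y)))

lemma evTop_evMkQ (j : ι) (X : (leafSurjective k ι β).FullSubcategory) :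
    (evTop k ι β j).app X ≫ (evMkQ k ι β j).app X = 0 := by
  ext x
  exact (Submodule.Quotient.mk_eq_zero (X.obj.topRange j)).2 ⟨x, rfl⟩

lemma evKer_evLeaf (i : β) (X : (leafSurjective k ι β).FullSubcategory) :
    (evKer k ι β i).app X ≫ (evLeaf k ι β i).app X = 0 := by
  ext x
  exact x.2

lemma shortExact_evTop_evMkQ (j : ι) (X : (leafSurjective k ι β).FullSubcategory) :
    (ShortComplex.mk _ _ (evTop_evMkQ j X)).ShortExact where
  exact := (ShortComplex.moduleCat_exact_iff _).2 fun x hx ↦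
    (Submodule.Quotient.mk_eq_zero (X.obj.topRange j)).1 hx
  mono_f := (ModuleCat.mono_iff_injective _).2 (chain_top_injective X.property.1 j)
  epi_g := (ModuleCat.epi_iff_surjective _).2 (Submodule.mkQ_surjective _)

lemma shortExact_evKer_evLeaf (i : β) (X : (leafSurjective k ι β).FullSubcategory) :
    (ShortComplex.mk _ _ (evKer_evLeaf i X)).ShortExact where
  exact := (ShortComplex.moduleCat_exact_iff _).2 fun x hx ↦ ⟨⟨x, hx⟩, rfl⟩
  mono_f := (ModuleCat.mono_iff_injective _).2 Subtype.val_injective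
  epi_g := (ModuleCat.epi_iff_surjective _).2 fun y ↦ by
    obtain ⟨x, hx⟩ := X.property.2 i y
    exact ⟨(X.obj.topRange ⊥).mkQ x, hx⟩

/-- The sequences 0 → C_⊤ → C_j → C_j / C_⊤ → 0 and 0 → B_i → C_⊥ / C_⊤ → Y_i → 0 are exact thanks
to the injectivity and surjectivity conditions. Two-out-of-three then passes from either set of
vertices to the other, C_⊥ being a vertex space on both sides. -/
lemma isThick_iff_reduction (T : ObjectProperty (CochainComplex (ModuleCat.{u} k) ℤ))
    (hT : IsThick T) (K : CochainComplex (leafSurjective k ι β).FullSubcategory ℤ) :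
    (∀ v, T (((evSub k ι β v).mapHomologicalComplex (ComplexShape.up ℤ)).obj K)) ↔
      ∀ v, T (((evReduction k ι β v).mapHomologicalComplex (ComplexShape.up ℤ)).obj K) := by
  have h₁ (j : ι) := shortExact_mapShortComplex _ _ _ (shortExact_evTop_evMkQ (β := β) j) K
  have h₂ (i : β) := shortExact_mapShortComplex _ _ _ (shortExact_evKer_evLeaf (ι := ι) i) K
  constructor
  · intro h
    have h₃ (j : ι) := hT.prop₃ (h₁ j) (h _) (h _)
    rintro (j | _ | i)
    · exact h₃ j
    · exact h (.inl ⊥)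
    · exact hT.prop₁ (h₂ i) (h₃ ⊥) (h _)
  · intro h
    -- The top space is the kernel of C_⊥ → C_⊥ / C_⊤, both of which the reduction retains.
    have h₃ := hT.prop₁ (h₁ ⊥) (h (.inr none)) (h _)
    rintro (j | i)
    · exact hT.prop₂ (h₁ j) h₃ (h _)
    · exact hT.prop₃ (h₂ i) (h _) (h _)

end Thick

end LamRep

end PiecewiseHereditary

/-! ### The reduction functor is an equivalence -/

namespace PiecewiseHereditary

open Limits

namespace LamRep

variable {k : Type u} [Field k] {ι β : Type} [LinearOrder ι] [OrderBot ι] [OrderTop ι]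

lemma mkQ_eq_iff {X : LamRep k ι β} {j : ι} {x y : X.obj (.inl j)} :
    (X.topRange j).mkQ x = (X.topRange j).mkQ y ↔ ∃ z, X.chain le_top z = x - y :=
  (Submodule.Quotient.eq _).trans Iff.rfl

/-- An element of the chain is determined by its images at the bottom and in the quotient. -/
lemma eq_of_chain_eq_of_mkQ_eq {X : LamRep k ι β} (hX : topInjective k ι β X) {j : ι}
    {x y : X.obj (.inl j)} (h : X.chain bot_le x = X.chain bot_le y)
    (h' : (X.topRange j).mkQ x = (X.topRange j).mkQ y) : x = y := by
  obtain ⟨z, hz⟩ := mkQ_eq_iff.1 h'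
  have h₁ : X.chain (le_top : ⊥ ≤ ⊤) z = 0 := by
    rw [← hX.1.chain_comp _ j _ bot_le le_top, hz, map_sub, h, sub_self]
  have h₂ : z = 0 := hX.2 (h₁.trans (map_zero _).symm)
  rw [h₂, map_zero] at hz
  exact (sub_eq_zero.1 hz.symm)

/-- The quotient at an element of the chain is a pullback. -/
lemma exists_of_mkQ_chain {X : LamRep k ι β} (hX : X.Relations) {j : ι} (u : X.obj (.inl ⊥))
    (x : X.obj (.inl j)) (h : (X.topRange ⊥).mkQ u = (X.topRange ⊥).mkQ (X.chain bot_le x)) :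
    ∃ y, X.chain bot_le y = u ∧ (X.topRange j).mkQ y = (X.topRange j).mkQ x := by
  obtain ⟨z, hz⟩ := mkQ_eq_iff.1 h
  refine ⟨x + X.chain le_top z, ?_, mkQ_eq_iff.2 ⟨z, by abel⟩⟩
  rw [map_add, hX.chain_comp, hz]
  abel

/-- Each C_j embeds in C_⊥ × C_j / C_⊤, and each leaf is a quotient of C_⊥; the reduction records
C_⊥ and all quotients C_j / C_⊤. -/
instance : (reduction k ι β).Faithful where
  map_injective {X Y f g} h := by
    have h' : (quotientTop k ι β).map ((ObjectProperty.ιOfLE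
        (leafSurjective_le.trans topInjective_le)).map f) = (quotientTop k ι β).map
          ((ObjectProperty.ιOfLE (leafSurjective_le.trans topInjective_le)).map g) :=
      congr_arg (StarRep.rootSurjective k ι β).ι.map h
    have hbot (x) : f.hom.app (.inl ⊥) x = g.hom.app (.inl ⊥) x :=
      congr_arg (fun φ ↦ QRep.Hom.app φ (.inr none) x) h'
    refine (leafSurjective k ι β).ι.map_injective (hom_ext' (fun j x ↦ ?_) (fun i y ↦ ?_))
    · refine eq_of_chain_eq_of_mkQ_eq Y.property.1 ?_ ?_
      · exact (app_chain f.hom _ x).symm.trans ((hbot _).trans (app_chain g.hom _ x))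
      · exact congr_arg (fun φ ↦ QRep.Hom.app φ (.inl j) ((X.obj.topRange j).mkQ x)) h'
    · obtain ⟨x, rfl⟩ := X.property.2 i y
      exact (app_leaf f.hom i x).trans
        ((congr_arg (Y.obj.leaf i) (hbot x)).trans (app_leaf g.hom i x).symm)

/-- C_j is the pullback of C_⊥ and C_j / C_⊤ over C_⊥ / C_⊤, so compatible maps on these determine a
map on the chain; maps of the kernels make the map on C_⊥ descend to the leaves. -/
lemma exists_hom_of_quotientTop (X Y : (relations k ι β).FullSubcategory)
    (hX : leafSurjective k ι β X.obj) (hY : leafSurjective k ι β Y.obj)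
    (φ : (quotientTop k ι β).obj X ⟶ (quotientTop k ι β).obj Y) :
    ∃ f, (quotientTop k ι β).map f = φ := by
  let a : X.obj.obj (.inl ⊥) →ₗ[k] Y.obj.obj (.inl ⊥) := φ.app (.inr none)
  let c (j : ι) : (X.obj.obj (.inl j) ⧸ X.obj.topRange j) →ₗ[k]
    (Y.obj.obj (.inl j) ⧸ Y.obj.topRange j) := φ.app (.inl j)
  have hac (x) : c ⊥ ((X.obj.topRange ⊥).mkQ x) = (Y.obj.topRange ⊥).mkQ (a x) :=
    StarRep.app_root φ none x
  have hc {j l : ι} (h : j ≤ l) (x) : c j ((X.obj.topRange j).mkQ (X.obj.chain h x)) =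
      Submodule.mapQ _ _ (Y.obj.chain h) (Y.property.topRange_le h)
        (c l ((X.obj.topRange l).mkQ x)) :=
    StarRep.app_chain φ h ((X.obj.topRange l).mkQ x)
  -- An element of C_⊥ killed by the i-th leaf has its class in the i-th kernel, and `φ` maps this
  -- kernel to the corresponding one of `Y`.
  have hb (i : β) (x) (hx : X.obj.leaf i x = 0) : Y.obj.leaf i (a x) = 0 := by
    have := (φ.app (.inr (some i)) ⟨(X.obj.topRange ⊥).mkQ x, hx⟩).2
    have h' := StarRep.app_root φ (some i) ⟨(X.obj.topRange ⊥).mkQ x, hx⟩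
    have h'' : (Y.obj.topRange ⊥).mkQ (a x) =
      (φ.app (.inr (some i)) ⟨(X.obj.topRange ⊥).mkQ x, hx⟩).1 := (hac x).symm.trans h'
    exact (congr_arg (leafQ Y.property i) h'').trans this
  -- The pair given by `a` and `c j` takes values in the image of the embedding of C_j in C_⊥ × C_j
  -- / C_⊤, by the pullback property.
  choose f hf using fun j ↦ exists_comp_eq_of_injective
    ((Y.obj.chain (bot_le : ⊥ ≤ j)).prod (Y.obj.topRange j).mkQ)
    (fun x y h ↦ eq_of_chain_eq_of_mkQ_eq hY.1 (Prod.ext_iff.1 h).1 (Prod.ext_iff.1 h).2)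
    ((a ∘ₗ X.obj.chain (bot_le : ⊥ ≤ j)).prod (c j ∘ₗ (X.obj.topRange j).mkQ)) (fun x ↦ by
      obtain ⟨y, hy⟩ := Submodule.mkQ_surjective _ (c j ((X.obj.topRange j).mkQ x))
      obtain ⟨z, hz, hz'⟩ := exists_of_mkQ_chain Y.property (a (X.obj.chain bot_le x)) y (by
        rw [← hac, hc, ← hy]
        rfl)
      exact ⟨z, Prod.ext hz (hz'.trans hy)⟩)
  have hf₁ (j x) : Y.obj.chain bot_le (f j x) = a (X.obj.chain bot_le x) :=
    (Prod.ext_iff.1 (hf j x)).1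
  have hf₂ (j x) : (Y.obj.topRange j).mkQ (f j x) = c j ((X.obj.topRange j).mkQ x) :=
    (Prod.ext_iff.1 (hf j x)).2
  have hfa (x) : f ⊥ x = a x := by
    have := hf₁ ⊥ x
    rwa [X.property.chain_id, Y.property.chain_id] at this
  choose g hg using fun i ↦ exists_comp_eq_of_surjective (X.obj.leaf i) (hX.2 i)
    (Y.obj.leaf i ∘ₗ a) (hb i)
  refine ⟨ObjectProperty.homMk (homMk f g (fun j l h x ↦ ?_) (fun i x ↦ ?_)), ?_⟩
  · refine eq_of_chain_eq_of_mkQ_eq hY.1 ?_ ?_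
    · rw [hf₁, X.property.chain_comp, Y.property.chain_comp, hf₁]
    · rw [hf₂, hc, ← hf₂]
      rfl
  · rw [hg, hfa]
    rfl
  · refine StarRep.hom_ext' (fun j x ↦ ?_) hfa (fun i x ↦ Subtype.ext ?_)
    · obtain ⟨x, rfl⟩ := Submodule.mkQ_surjective _ x
      exact hf₂ j x
    · obtain ⟨x, hx⟩ := x
      obtain ⟨x, rfl⟩ := Submodule.mkQ_surjective _ x
      exact (hf₂ ⊥ x).trans (StarRep.app_root φ (some i) ⟨(X.obj.topRange ⊥).mkQ x, hx⟩)

instance : (reduction k ι β).Full where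
  map_surjective {X Y} φ := by
    obtain ⟨f, hf⟩ := exists_hom_of_quotientTop
      ((ObjectProperty.ιOfLE (leafSurjective_le.trans topInjective_le)).obj X)
      ((ObjectProperty.ιOfLE (leafSurjective_le.trans topInjective_le)).obj Y)
      X.property Y.property φ.hom
    exact ⟨ObjectProperty.homMk f.hom, (StarRep.rootSurjective k ι β).ι.map_injective hf⟩

section EssSurj

variable (W : StarRep k ι β)

/-- The pullback of the chain along the map from the exceptional root. -/
abbrev pullback (j : ι) : Submodule k (W.obj (.inl j) × W.obj (.inr none)) :=
  LinearMap.ker ((W.chain bot_le).coprod (-W.root none))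

lemma mem_pullback {j : ι} {x : W.obj (.inl j) × W.obj (.inr none)} :
    x ∈ pullback W j ↔ W.chain bot_le x.1 = W.root none x.2 := by
  rw [LinearMap.mem_ker, LinearMap.coprod_apply, LinearMap.neg_apply, ← sub_eq_add_neg,
    sub_eq_zero]

/-- The representation with the given reduction. -/
abbrev ofStarRep (hW : W.Relations) : LamRep k ι β :=
  mk' (fun j ↦ pullback W j) (fun i ↦ W.obj (.inl ⊥) ⧸ LinearMap.range (W.root (some i)))
    (fun j l h ↦ ((W.chain h).prodMap LinearMap.id).restrict fun x hx ↦ by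
      rw [mem_pullback] at *
      exact (hW.chain_comp _ _ _ _ _ _).trans hx)
    (fun i ↦ Submodule.mkQ _ ∘ₗ LinearMap.fst _ _ _ ∘ₗ Submodule.subtype _)

/-- Since the chain of `W` vanishes at ⊤, the pullback there is the kernel of the exceptional map.
It therefore embeds in the pullback at ⊥ by the second coordinate and is killed by the leaves, which
only see the first. Surjectivity of the exceptional map lifts every class at a leaf. -/
lemma leafSurjective_ofStarRep (hW : StarRep.rootSurjective k ι β W) :
    leafSurjective k ι β (ofStarRep W hW.1.1) := by
  have := hW.1.1.finite
  refine ⟨⟨⟨?_, fun j x ↦ Subtype.ext (Prod.ext (hW.1.1.chain_id _ _) rfl),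
    fun _ _ _ h h' x ↦ Subtype.ext (Prod.ext (hW.1.1.chain_comp _ _ _ h h' _) rfl),
    fun i x ↦ ?_⟩, fun x y h ↦ ?_⟩, fun i y ↦ ?_⟩
  · rintro (j | i)
    · exact inferInstanceAs (Module.Finite k (pullback W j))
    · exact inferInstanceAs
        (Module.Finite k (W.obj (.inl ⊥) ⧸ LinearMap.range (W.root (some i))))
  · have h : W.chain bot_le x.1.1 = 0 := by
      rw [hW.1.1.top_eq_zero x.1.1, map_zero]
    exact (congr_arg (Submodule.mkQ _) h).trans (map_zero _)
  · refine Subtype.ext (Prod.ext ?_ ?_)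
    · exact (hW.1.1.top_eq_zero _).trans (hW.1.1.top_eq_zero _).symm
    · exact congr_arg (fun z : pullback W ⊥ ↦ z.1.2) h
  · obtain ⟨x, rfl⟩ := Submodule.mkQ_surjective _ y
    obtain ⟨z, hz⟩ := hW.2 x
    exact ⟨⟨(x, z), (mem_pullback W).2 ((hW.1.1.chain_id _ _).trans hz.symm)⟩, rfl⟩

/-- The first coordinate identifies the quotient of the pullback at j by its top part with the space
of `W` at j, using surjectivity of the exceptional map; the second identifies the pullback at ⊥ with
the exceptional space. Injectivity of the other maps identifies their sources with the kernels. -/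
lemma nonempty_quotientTop_ofStarRep_iso (hW : StarRep.rootSurjective k ι β W)
    (X : (relations k ι β).FullSubcategory) (hX : X.obj = ofStarRep W hW.1.1) :
    Nonempty ((quotientTop k ι β).obj X ≅ W) := by
  obtain ⟨X, hX'⟩ := X
  subst hX
  let R := ofStarRep W hW.1.1
  let c (j : ι) : (R.obj (.inl j) ⧸ R.topRange j) →ₗ[k] W.obj (.inl j) :=
    (R.topRange j).liftQ (LinearMap.fst _ _ _ ∘ₗ (pullback W j).subtype) (by
      rintro _ ⟨x, rfl⟩
      change W.chain le_top x.1.1 = 0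
      rw [hW.1.1.top_eq_zero x.1.1, map_zero])
  have hc (j : ι) : Function.Bijective (c j) := by
    constructor
    · rw [injective_iff_map_eq_zero]
      intro x hx
      obtain ⟨x, rfl⟩ := Submodule.mkQ_surjective _ x
      have hx' : x.1.1 = 0 := hx
      have h := (mem_pullback W).1 x.2
      rw [hx', map_zero] at h
      -- An element with vanishing first coordinate has its second one in the kernel of the
      -- exceptional map, so it comes from the pullback at ⊤.
      refine (Submodule.Quotient.mk_eq_zero _).2 ⟨⟨(0, x.1.2), ?_⟩, ?_⟩
      · rw [mem_pullback]
        exact (map_zero _).trans h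
      · exact Subtype.ext (Prod.ext ((map_zero (W.chain (le_top : j ≤ ⊤))).trans hx'.symm) rfl)
    · intro x
      obtain ⟨z, hz⟩ := hW.2 (W.chain bot_le x)
      exact ⟨(R.topRange j).mkQ ⟨(x, z), (mem_pullback W).2 hz.symm⟩, rfl⟩
  let a : pullback W ⊥ →ₗ[k] W.obj (.inr none) := LinearMap.snd _ _ _ ∘ₗ Submodule.subtype _
  have ha : Function.Bijective a := by
    constructor
    · rw [injective_iff_map_eq_zero]
      intro x hx
      have hx' : x.1.2 = 0 := hx
      have h := (mem_pullback W).1 x.2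
      rw [hx', map_zero, hW.1.1.chain_id] at h
      exact Subtype.ext (Prod.ext h hx')
    · intro x
      exact ⟨⟨(W.root none x, x), (mem_pullback W).2 (hW.1.1.chain_id _ _)⟩, rfl⟩
  have hleaf (i : β) (x : R.obj (.inl ⊥) ⧸ R.topRange ⊥) :
      leafQ hX' i x = (LinearMap.range (W.root (some i))).mkQ (c ⊥ x) := by
    obtain ⟨x, rfl⟩ := Submodule.mkQ_surjective _ x
    rfl
  choose b hb using fun i ↦ exists_comp_eq_of_injective (W.root (some i)) (hW.1.2 i)
    (c ⊥ ∘ₗ (LinearMap.ker (leafQ hX' i)).subtype) (fun x ↦ by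
      have h : leafQ hX' i x.1 = 0 := x.2
      rw [hleaf] at h
      exact (Submodule.Quotient.mk_eq_zero _).1 h)
  have hb' (i : β) : Function.Bijective (b i) := by
    constructor
    · intro x y hxy
      refine Subtype.ext ((hc ⊥).1 ?_)
      exact (hb i x).symm.trans ((congr_arg _ hxy).trans (hb i y))
    · intro y
      obtain ⟨x, hx⟩ := (hc ⊥).2 (W.root (some i) y)
      refine ⟨⟨x, ?_⟩, hW.1.2 i ?_⟩
      · refine (hleaf i x).trans ((congr_arg _ hx).trans ?_)
        exact (Submodule.Quotient.mk_eq_zero _).2 ⟨y, rfl⟩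
      · exact (hb i _).trans hx
  refine ⟨QRep.isoOfBijective (StarRep.homMk c a b (fun j l h x ↦ ?_) (fun x ↦ ?_)
    (fun i x ↦ (hb i x).symm)) ?_⟩
  · obtain ⟨x, rfl⟩ := Submodule.mkQ_surjective _ x
    rfl
  · exact (hW.1.1.chain_id _ _).symm.trans ((mem_pullback W).1 x.2)
  · rintro (j | _ | i)
    · exact hc j
    · exact ha
    · exact hb' i

end EssSurj

instance : (reduction k ι β).EssSurj where
  mem_essImage W := by
    obtain ⟨i⟩ := nonempty_quotientTop_ofStarRep_iso W.obj W.property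
      ⟨_, (leafSurjective_ofStarRep W.obj W.property).1.1⟩ rfl
    exact ⟨⟨_, leafSurjective_ofStarRep W.obj W.property⟩,
      ⟨(StarRep.rootSurjective k ι β).ι.preimageIso i⟩⟩

instance : (reduction k ι β).IsEquivalence where

end LamRep

end PiecewiseHereditary

/-! ### Projective dimension at most one from resolutions of representations -/

namespace CategoryTheory.ShortComplex

open Limits

variable {𝒜 𝒱 : Type*} [Category* 𝒜] [Category* 𝒱] [Abelian 𝒜] [Abelian 𝒱] {ι : Type*}
  (ev : ι → 𝒜 ⥤ 𝒱) [∀ v, (ev v).Additive] [∀ v, (ev v).PreservesHomology]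
  (hev : ∀ ⦃X Y : 𝒜⦄ (f : X ⟶ Y), (∀ v, IsIso ((ev v).map f)) → IsIso f)

include hev

/-- Jointly conservative exact functors reflect exactness. -/
lemma exact_of_forall_map (S : ShortComplex 𝒜) (h : ∀ v, (S.map (ev v)).Exact) : S.Exact := by
  rw [exact_iff_isZero_leftHomology]
  have h₀ : IsIso (0 : S.leftHomology ⟶ S.leftHomology) := by
    refine hev _ fun v ↦ ?_
    have : IsZero ((ev v).obj S.leftHomology) :=
      ((S.leftHomologyData.map (ev v)).exact_iff).1 (h v)
    exact ⟨0, this.eq_of_src _ _, this.eq_of_src _ _⟩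
  rw [IsZero.iff_id_eq_zero, ← IsIso.hom_inv_id (0 : S.leftHomology ⟶ S.leftHomology), zero_comp]

/-- Jointly conservative exact functors reflect short exactness. -/
lemma shortExact_of_forall_map (S : ShortComplex 𝒜) (h : ∀ v, (S.map (ev v)).ShortExact) :
    S.ShortExact where
  exact := exact_of_forall_map ev hev S fun v ↦ (h v).exact
  mono_f := by
    -- Being a monomorphism is rephrased as exactness after a zero map, so that exactness is the
    -- only thing to be reflected.
    let T := ShortComplex.mk (0 : S.X₁ ⟶ S.X₁) S.f (by simp)
    refine (T.exact_iff_mono rfl).1 (exact_of_forall_map ev hev T fun v ↦ ?_)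
    exact ((T.map (ev v)).exact_iff_mono ((ev v).map_zero _ _)).2 (h v).mono_f
  epi_g := by
    let T := ShortComplex.mk S.g (0 : S.X₃ ⟶ S.X₃) (by simp)
    refine (T.exact_iff_epi rfl).1 (exact_of_forall_map ev hev T fun v ↦ ?_)
    exact ((T.map (ev v)).exact_iff_epi ((ev v).map_zero _ _)).2 (h v).epi_g

end CategoryTheory.ShortComplex

namespace PiecewiseHereditary

open Limits

namespace QRep

variable {k : Type u} [Field k] {V Arr : Type} {s t : Arr → V}

/-- The lifting property of a representation against pointwise surjective morphisms between
representations with a given property. -/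
def IsLiftable (P : ObjectProperty (QRep k s t)) (W : QRep k s t) : Prop :=
  ∀ (G H : QRep k s t), P G → P H → ∀ p : G ⟶ H, (∀ v, Function.Surjective (p.app v)) →
    ∀ f : W ⟶ H, ∃ g, g ≫ p = f

end QRep

namespace IsQuiverPresentation

variable {k : Type u} [Field k] {A : Type u} [Ring A] [Algebra k A] {V Arr : Type} [Fintype V]
  {s t : Arr → V} {e : V → A} {p : Arr → A} (h : IsQuiverPresentation k s t e p)
  {P : ObjectProperty (QRep k s t)}

include h in
lemma isIso_of_forall_rep_ev ⦃X Y : FDMod k A⦄ (f : X ⟶ Y)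
    (hf : ∀ v, IsIso ((h.rep ⋙ QRep.ev k s t v).map f)) : IsIso f := by
  have : IsIso (h.rep.map f) := QRep.isIso_of_forall_ev _ hf
  exact isIso_of_reflects_iso f h.rep

include h in
-- Evaluation at a vertex is exact, so an epimorphism of modules is surjective at every vertex,
-- which is what the lifting property requires.
lemma projective_of_isLiftable (hP : ∀ M, P (h.rep.obj M)) {M : FDMod k A} {W : QRep k s t}
    (hW : W.IsLiftable P) (i : h.rep.obj M ≅ W) : Projective M where
  factors {G H} f q _ := by
    have hq (v : V) : Function.Surjective ((h.rep.map q).app v) := by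
      have := h.preservesHomology_rep_comp_ev v
      exact (ModuleCat.epi_iff_surjective ((h.rep ⋙ QRep.ev k s t v).map q)).1 inferInstance
    obtain ⟨g, hg⟩ := hW _ _ (hP G) (hP H) (h.rep.map q) hq (i.inv ≫ h.rep.map f)
    refine ⟨h.rep.preimage (i.hom ≫ g), h.rep.map_injective ?_⟩
    rw [h.rep.map_comp, h.rep.map_preimage, Category.assoc, hg, i.hom_inv_id_assoc]

include h in
/-- A module whose representation has a resolution of length one by representations with the
lifting property has projective dimension at most one. -/
lemma hasProjectiveDimensionLE_one (hP : ∀ M, P (h.rep.obj M))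
    (hP' : ∀ W, P W → ∃ M, Nonempty (h.rep.obj M ≅ W)) (M : FDMod k A) {W₁ W₀ : QRep k s t}
    (h₁ : P W₁) (h₀ : P W₀) (h₁' : W₁.IsLiftable P) (h₀' : W₀.IsLiftable P)
    (α : W₁ ⟶ W₀) (π : W₀ ⟶ h.rep.obj M) (w : α ≫ π = 0)
    (hS : ∀ v, (ShortComplex.mk ((QRep.ev k s t v).map α) ((QRep.ev k s t v).map π)
      (by rw [← Functor.map_comp, w, CategoryTheory.Functor.map_zero])).ShortExact) :
    HasProjectiveDimensionLE M 1 := by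
  obtain ⟨M₁, ⟨i₁⟩⟩ := hP' _ h₁
  obtain ⟨M₀, ⟨i₀⟩⟩ := hP' _ h₀
  have := h.projective_of_isLiftable hP h₁' i₁
  have := h.projective_of_isLiftable hP h₀' i₀
  have hev (v : V) := h.preservesHomology_rep_comp_ev v
  let S : ShortComplex (FDMod k A) :=
    ShortComplex.mk (h.rep.preimage (i₁.hom ≫ α ≫ i₀.inv)) (h.rep.preimage (i₀.hom ≫ π))
      (h.rep.map_injective (by simp [w]))
  have hS' : S.ShortExact := by
    refine ShortComplex.shortExact_of_forall_map (fun v ↦ h.rep ⋙ QRep.ev k s t v)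
      h.isIso_of_forall_rep_ev S fun v ↦ ?_
    refine ShortComplex.shortExact_of_iso (S₁ := .mk ((QRep.ev k s t v).map α)
      ((QRep.ev k s t v).map π) _) (S₂ := S.map (h.rep ⋙ QRep.ev k s t v)) (ShortComplex.isoMk
      ((QRep.ev k s t v).mapIso i₁.symm) ((QRep.ev k s t v).mapIso i₀.symm) (Iso.refl _)
      ?_ ?_) (hS v)
    · change (QRep.ev k s t v).map i₁.inv ≫ (QRep.ev k s t v).map (h.rep.map (h.rep.preimage _)) =
        (QRep.ev k s t v).map α ≫ (QRep.ev k s t v).map i₀.inv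
      rw [h.rep.map_preimage, ← Functor.map_comp, ← Functor.map_comp, i₁.inv_hom_id_assoc]
    · change (QRep.ev k s t v).map i₀.inv ≫ (QRep.ev k s t v).map (h.rep.map (h.rep.preimage _)) =
        (QRep.ev k s t v).map π ≫ 𝟙 _
      rw [h.rep.map_preimage, ← Functor.map_comp, i₀.inv_hom_id_assoc, Category.comp_id]
  exact hS'.hasProjectiveDimensionLT_X₃ 1 inferInstance inferInstance

end IsQuiverPresentation

section LinearAlgebra

variable {k : Type*} [Field k] {S W G H : Type*} [AddCommGroup S] [Module k S] [AddCommGroup W]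
  [Module k W] [AddCommGroup G] [Module k G] [AddCommGroup H] [Module k H]

/-- A lift of a linear map along a surjection which extends a given lift on a subspace. -/
lemma exists_extension_lift (ρ : S →ₗ[k] W) (hρ : Function.Injective ρ) (π : G →ₗ[k] H)
    (hπ : Function.Surjective π) (h : W →ₗ[k] H) (t : S →ₗ[k] G) (ht : ∀ x, π (t x) = h (ρ x)) :
    ∃ v : W →ₗ[k] G, (∀ x, π (v x) = h x) ∧ ∀ x, v (ρ x) = t x := by
  obtain ⟨r, hr⟩ := ρ.exists_leftInverse_of_injective (LinearMap.ker_eq_bot.2 hρ)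
  obtain ⟨s, hs⟩ := π.exists_rightInverse_of_surjective (LinearMap.range_eq_top.2 hπ)
  replace hr (x) : r (ρ x) = x := LinearMap.congr_fun hr x
  replace hs (x) : π (s x) = x := LinearMap.congr_fun hs x
  -- Extend `t` by a retraction of `ρ` and correct the error by a section of `π`; the error vanishes
  -- on the image of `ρ`, so the prescribed values survive.
  refine ⟨t ∘ₗ r + s ∘ₗ (h - π ∘ₗ t ∘ₗ r), fun x ↦ ?_, fun x ↦ ?_⟩
  · simp [hs]
  · simp [hr, ht]

end LinearAlgebra

end PiecewiseHereditary

/-! ### The star side is hereditary: the standard resolution -/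

namespace PiecewiseHereditary

open Limits

section BotMap

variable {k : Type u} [Field k] {ι : Type} [LinearOrder ι] [OrderBot ι] {C C' : ι → Type u}
  [∀ j, AddCommGroup (C j)] [∀ j, Module k (C j)]
  [∀ j, AddCommGroup (C' j)] [∀ j, Module k (C' j)] {M : Type u} [AddCommGroup M] [Module k M]

/-- The extension by zero of a linear map to the space at the bottom. -/
def botMap (φ : M →ₗ[k] C ⊥) (j : ι) : atBot k M j →ₗ[k] C j :=
  if h : j = ⊥ then h ▸ (φ ∘ₗ (atBot k M ⊥).subtype) else 0

@[simp] lemma botMap_bot (φ : M →ₗ[k] C ⊥) (x : atBot k M (⊥ : ι)) : botMap φ ⊥ x = φ x.1 := by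
  simp [botMap]

lemma botMap_chain (c : ∀ j l, j ≤ l → C l →ₗ[k] C j) (c_id : ∀ j x, c j j le_rfl x = x)
    (φ : M →ₗ[k] C ⊥) {j l : ι} (h : j ≤ l) (x : atBot k M l) :
    c j l h (botMap φ l x) = botMap φ j (Submodule.inclusion (atBot_anti h) x) := by
  by_cases hl : l = ⊥
  · subst hl
    obtain rfl := le_bot_iff.1 h
    rw [c_id]
    rfl
  · obtain rfl : x = 0 := Subtype.ext (x.2 hl)
    simp

lemma map_botMap (f : ∀ j, C j →ₗ[k] C' j) (φ : M →ₗ[k] C ⊥) (j : ι) (x : atBot k M j) :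
    f j (botMap φ j x) = botMap (f ⊥ ∘ₗ φ) j x := by
  by_cases hj : j = ⊥
  · subst hj
    simp
  · obtain rfl : x = 0 := Subtype.ext (x.2 hj)
    simp

end BotMap

namespace StarRep

variable {k : Type u} [Field k] {ι β : Type} [LinearOrder ι] [OrderBot ι]

/-- The product of the spaces at the roots. -/
abbrev allRoots (X : StarRep k ι β) : Type u := ∀ o, X.obj (.inr o)

variable [Fintype β]

/-- The sum of the maps from the roots to the bottom. -/
def rootSum (X : StarRep k ι β) : X.allRoots →ₗ[k] X.obj (.inl ⊥) :=
  ∑ o, X.root o ∘ₗ LinearMap.proj o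

lemma rootSum_apply (X : StarRep k ι β) (g : X.allRoots) :
    X.rootSum g = ∑ o, X.root o (g o) := by
  rw [rootSum, LinearMap.sum_apply]
  rfl

lemma rootSum_single [DecidableEq β] (X : StarRep k ι β) (o : Option β) (x : X.obj (.inr o)) :
    X.rootSum (Pi.single o x) = X.root o x := by
  rw [rootSum_apply, Finset.sum_eq_single o]
  · rw [Pi.single_eq_same (M := fun o ↦ X.obj (.inr o))]
  · intro o' _ ho
    rw [Pi.single_eq_of_ne (M := fun o ↦ X.obj (.inr o)) ho, map_zero]
  · simp

lemma app_rootSum {X Y : StarRep k ι β} (f : X ⟶ Y) (g : X.allRoots) :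
    f.app (.inl ⊥) (X.rootSum g) = Y.rootSum (piMap (fun o ↦ f.app (.inr o)) g) := by
  rw [rootSum_apply, rootSum_apply, map_sum]
  exact Finset.sum_congr rfl fun o _ ↦ app_root f o (g o)

variable [OrderTop ι] [Fintype ι]

/-- A representation lifts against surjections if there are no relations between the images of
the maps to any vertex. -/
lemma Relations.isLiftable [Nontrivial ι] {W : StarRep k ι β} (hW : W.Relations)
    (H : ∀ a b (h : a < b),
      Function.Injective ((W.chain h.le).coprod (botMap (C := fun j ↦ W.obj (.inl j)) W.rootSum a))) :
    W.IsLiftable (relations k ι β) := by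
  classical
  intro (G : StarRep k ι β) (H' : StarRep k ι β) hG hH' p hp f
  choose uR huR using fun o ↦ Module.projective_lifting_property (p.app (.inr o))
    (f.app (.inr o)) (hp _)
  replace huR (o x) : p.app (.inr o) (uR o x) = f.app (.inr o) x := LinearMap.congr_fun (huR o) x
  let t₀ : W.allRoots →ₗ[k] G.obj (.inl ⊥) := G.rootSum ∘ₗ piMap uR
  have ht₀ (g) : p.app (.inl ⊥) (t₀ g) = f.app (.inl ⊥) (W.rootSum g) := by
    refine (app_rootSum p _).trans (Eq.trans ?_ (app_rootSum f g).symm)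
    exact congr_arg H'.rootSum (funext fun o ↦ huR o (g o))
  -- The lift is built down the chain, starting from the zero space at ⊤. Only components at or
  -- above `a` are constrained; compatibility with the short arms enters when ⊥ is reached.
  have key (a : ι) : ∃ u : ∀ l, W.obj (.inl l) →ₗ[k] G.obj (.inl l),
      (∀ l, a ≤ l → ∀ x, p.app (.inl l) (u l x) = f.app (.inl l) x) ∧
      (∀ j l (h : j ≤ l), a ≤ j → ∀ x, u j (W.chain h x) = G.chain h (u l x)) ∧
      (a = ⊥ → ∀ g, u ⊥ (W.rootSum g) = t₀ g) := by
    induction a using WellFoundedGT.induction with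
    | ind a ih =>
    by_cases ha : a = ⊤
    · subst ha
      refine ⟨fun _ ↦ 0, fun l hl x ↦ ?_, fun j l h hj x ↦ ?_,
        fun h ↦ absurd h top_ne_bot_of_nontrivial⟩
      · obtain rfl := top_le_iff.1 hl
        rw [hW.top_eq_zero x, map_zero, map_zero]
        exact (map_zero _).symm
      · exact (map_zero _).symm
    · obtain ⟨b, hb⟩ := exists_covBy_of_wellFoundedLT (a := a) (fun h ↦ ha h.eq_top)
      obtain ⟨u, hu₁, hu₂, -⟩ := ih b hb.lt
      -- At `a` the lift is forced on the image of the space at the cover `b` and, if `a` is ⊥, on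
      -- the images of the short arms. By `H` these images are independent, so the forced values are
      -- consistent and extend to the whole space.
      obtain ⟨v, hv₁, hv₂⟩ := exists_extension_lift _ (H a b hb.lt) (p.app (.inl a)) (hp _)
        (f.app (.inl a)) ((G.chain hb.le ∘ₗ u b).coprod
          (botMap (C := fun j ↦ G.obj (.inl j)) t₀ a)) (fun ⟨x, g⟩ ↦ by
          simp only [LinearMap.coprod_apply, LinearMap.comp_apply, map_add]
          congr 1
          · exact (app_chain p _ _).trans
              ((congr_arg _ (hu₁ b le_rfl x)).trans (app_chain f _ x).symm)
          · refine (map_botMap (C := fun j ↦ G.obj (.inl j)) (C' := fun j ↦ H'.obj (.inl j))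
              (fun j ↦ p.app (.inl j)) _ _ _).trans (Eq.trans ?_
              (map_botMap (C := fun j ↦ W.obj (.inl j)) (C' := fun j ↦ H'.obj (.inl j))
              (fun j ↦ f.app (.inl j)) _ _ _).symm)
            congr 2
            exact LinearMap.ext ht₀)
      have hv₃ (x) : v (W.chain hb.le x) = G.chain hb.le (u b x) := by
        simpa using hv₂ (x, 0)
      have hne {l : ι} (hl : b ≤ l) : l ≠ a := (hb.lt.trans_le hl).ne'
      refine ⟨Function.update u a v, fun l hl x ↦ ?_, fun j l h hj x ↦ ?_, fun ha' g ↦ ?_⟩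
      · obtain rfl | hl := hl.eq_or_lt
        · rw [Function.update_self, hv₁]
        · rw [Function.update_of_ne hl.ne', hu₁ l (hb.ge_of_gt hl)]
      · obtain rfl | hj := hj.eq_or_lt
        · obtain rfl | hl := h.eq_or_lt
          · rw [hW.chain_id, hG.chain_id]
          · have hbl := hb.ge_of_gt hl
            rw [Function.update_self, Function.update_of_ne hl.ne',
              ← hW.chain_comp _ _ _ hb.le hbl, hv₃, hu₂ _ _ hbl le_rfl, hG.chain_comp]
        · have hbj := hb.ge_of_gt hj
          rw [Function.update_of_ne (hne hbj), Function.update_of_ne (hne (hbj.trans h)),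
            hu₂ _ _ h hbj]
      · subst ha'
        rw [Function.update_self]
        simpa using hv₂ (0, ⟨g, mem_atBot_bot g⟩)
  obtain ⟨u, hu₁, hu₂, hu₃⟩ := key ⊥
  refine ⟨{ app := fun | .inl j => u j | .inr o => uR o
            comm := fun | .inl q => hu₂ _ _ q.2 bot_le | .inr o => fun x ↦ ?_ }, ?_⟩
  · refine (congr_arg (u ⊥) (W.rootSum_single o x).symm).trans ((hu₃ rfl _).trans
      (Eq.trans ?_ (G.rootSum_single o (uR o x))))
    refine congr_arg G.rootSum (funext fun o' ↦ ?_)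
    by_cases h : o' = o
    · subst h
      simp
    · simp [h]
  · refine QRep.hom_ext ?_
    rintro (j | o) x
    · exact hu₁ j bot_le x
    · exact huR o x

/-- The sum of the images under the maps of the chain. -/
abbrev chainSum (X : StarRep k ι β) (j : ι) : (∀ l, X.obj (.inl l)) →ₗ[k] X.obj (.inl j) :=
  upperSum (C := fun l ↦ X.obj (.inl l)) (fun _ _ h ↦ X.chain h) j

section Resolution

variable [DecidableEq β] (X : StarRep k ι β)

/-- The free representation on the spaces of a representation. -/
abbrev free : StarRep k ι β where
  obj
    | .inl j => upperPi k (fun l ↦ X.obj (.inl l)) j × atBot k X.allRoots j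
    | .inr o => X.obj (.inr o)
  addCommGroup
    | .inl j => inferInstanceAs
        (AddCommGroup (upperPi k (fun l ↦ X.obj (.inl l)) j × atBot k X.allRoots j))
    | .inr o => inferInstanceAs (AddCommGroup (X.obj (.inr o)))
  module
    | .inl j => inferInstanceAs
        (Module k (upperPi k (fun l ↦ X.obj (.inl l)) j × atBot k X.allRoots j))
    | .inr o => inferInstanceAs (Module k (X.obj (.inr o)))
  map
    | .inl q => (Submodule.inclusion (upperPi_anti q.2)).prodMap
        (Submodule.inclusion (atBot_anti q.2))
    | .inr o => LinearMap.inr k (upperPi k (fun l ↦ X.obj (.inl l)) ⊥) (atBot k X.allRoots ⊥) ∘ₗ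
        (LinearMap.single k (fun o ↦ X.obj (.inr o)) o).codRestrict _ fun _ ↦ mem_atBot_bot _

variable {X} (hX : X.Relations)

include hX in
lemma relations_free [Nontrivial ι] : relations k ι β X.free where
  finite := by
    have := hX.finite
    rintro (j | o)
    · exact inferInstanceAs (Module.Finite k
        (upperPi k (fun l ↦ X.obj (.inl l)) j × atBot k X.allRoots j))
    · exact hX.finite _
  chain_id _ _ := rfl
  chain_comp _ _ _ _ _ _ := rfl
  top_eq_zero x := by
    refine Prod.ext (Subtype.ext (funext fun l ↦ ?_))
      (Subtype.ext (x.2.2 top_ne_bot_of_nontrivial))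
    obtain rfl | hl := eq_or_ne l ⊤
    · exact hX.top_eq_zero _
    · exact x.1.2 l hl.lt_top

lemma rootSum_free (g : X.allRoots) : X.free.rootSum g = (0, ⟨g, mem_atBot_bot g⟩) := by
  let a : X.allRoots →ₗ[k] upperPi k (fun l ↦ X.obj (.inl l)) ⊥ × atBot k X.allRoots (⊥ : ι) :=
    LinearMap.inr k _ _ ∘ₗ LinearMap.id.codRestrict _ fun g ↦ mem_atBot_bot g
  have h : ∑ o, Pi.single o (g o) = g := Finset.univ_sum_single g
  refine (X.free.rootSum_apply g).trans (Eq.trans ?_ (congr_arg a h))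
  rw [map_sum]
  rfl

include hX in
-- The chain map from `b > a` lands injectively in the first summand, as the second vanishes at `b`,
-- while the short arms fill the second summand at ⊥. So there are no relations between the images.
lemma isLiftable_free [Nontrivial ι] : X.free.IsLiftable (relations k ι β) := by
  refine (relations_free hX).isLiftable fun a b h ↦ ?_
  rw [injective_iff_map_eq_zero]
  rintro ⟨⟨f, g⟩, m⟩ hx
  obtain rfl : g = 0 := Subtype.ext (g.2 (bot_le.trans_lt h).ne')
  rw [LinearMap.coprod_apply] at hx
  by_cases ha : a = ⊥
  · subst ha
    rw [botMap_bot] at hx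
    let T := upperPi k (fun l ↦ X.obj (.inl l)) ⊥ × atBot k X.allRoots (⊥ : ι)
    let y : T := (Submodule.inclusion (upperPi_anti h.le) f, 0)
    have hx' : y + (0, ⟨m.1, mem_atBot_bot m.1⟩) = 0 :=
      (congr_arg (fun z : T ↦ y + z) (rootSum_free (X := X) m.1).symm).trans hx
    have h₁ : f.1 + 0 = 0 := congr_arg (fun z : T ↦ z.1.1) hx'
    have h₂ : 0 + m.1 = 0 := congr_arg (fun z : T ↦ z.2.1) hx'
    rw [add_zero] at h₁
    rw [zero_add] at h₂
    exact Prod.ext (Prod.ext (Subtype.ext h₁) rfl) (Subtype.ext h₂)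
  · obtain rfl : m = 0 := Subtype.ext (m.2 ha)
    rw [map_zero, add_zero] at hx
    exact Prod.ext (Prod.ext (Subtype.ext (congr_arg (fun z : upperPi k (fun l ↦ X.obj (.inl l)) a ×
      atBot k X.allRoots a ↦ z.1.1) hx)) rfl) rfl

/-- The projection from the free representation. -/
abbrev freeπ : X.free ⟶ X where
  app
    | .inl j => (X.chainSum j ∘ₗ Submodule.subtype _).coprod
        (botMap (C := fun j ↦ X.obj (.inl j)) X.rootSum j)
    | .inr o => LinearMap.id
  comm
    | .inl q => fun x ↦ by
      refine Eq.trans ?_ (map_add (X.map (.inl q)) _ _).symm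
      exact congr_arg₂ (· + ·) (upperSum_of_mem _ hX.chain_comp q.2 x.1.2)
        (botMap_chain (C := fun j ↦ X.obj (.inl j)) (fun _ _ h ↦ X.chain h) hX.chain_id
          X.rootSum q.2 x.2).symm
    | .inr o => fun x ↦ by
      change X.chainSum ⊥ 0 + botMap (C := fun j ↦ X.obj (.inl j)) X.rootSum ⊥
        ⟨Pi.single o x, mem_atBot_bot _⟩ = X.root o x
      rw [map_zero, zero_add, botMap_bot, rootSum_single]

lemma freeπ_surjective (v) : Function.Surjective ((freeπ hX).app v) := by
  obtain j | o := v
  · intro x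
    refine ⟨(⟨Pi.single j x, single_mem_upperPi (C := fun l ↦ X.obj (.inl l)) j x⟩, 0), ?_⟩
    exact (congr_arg₂ (· + ·) (upperSum_single _ hX.chain_id j x)
      (map_zero (botMap (C := fun j ↦ X.obj (.inl j)) X.rootSum j))).trans (add_zero x)
  · exact fun x ↦ ⟨x, rfl⟩

/-- The kernel of the projection from the free representation. -/
abbrev freeKer : StarRep k ι β where
  obj
    | .inl j => LinearMap.ker ((freeπ hX).app (.inl j))
    | .inr _ => PUnit.{u + 1}
  addCommGroup
    | .inl j => inferInstanceAs (AddCommGroup (LinearMap.ker ((freeπ hX).app (.inl j))))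
    | .inr _ => inferInstanceAs (AddCommGroup PUnit.{u + 1})
  module
    | .inl j => inferInstanceAs (Module k (LinearMap.ker ((freeπ hX).app (.inl j))))
    | .inr _ => inferInstanceAs (Module k PUnit.{u + 1})
  map
    | .inl q => (X.free.map (.inl q)).restrict fun x hx ↦ by
        have hx' : (freeπ hX).app (.inl q.1.2) x = 0 := hx
        exact ((freeπ hX).comm (.inl q) x).trans
          ((congr_arg (X.map (.inl q)) hx').trans (map_zero _))
    | .inr _ => 0

lemma relations_freeKer [Nontrivial ι] : relations k ι β (freeKer hX) where
  finite := by
    have := (relations_free hX).finite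
    rintro (j | o)
    · exact inferInstanceAs (Module.Finite k (LinearMap.ker ((freeπ hX).app (.inl j))))
    · exact inferInstanceAs (Module.Finite k PUnit.{u + 1})
  chain_id _ _ := rfl
  chain_comp _ _ _ _ _ _ := rfl
  top_eq_zero x := Subtype.ext ((relations_free hX).top_eq_zero x.1)

/-- The kernel vanishes on the short arms, and its chain maps are restrictions of injective ones, so
again there are no relations. -/
lemma isLiftable_freeKer [Nontrivial ι] : (freeKer hX).IsLiftable (relations k ι β) := by
  refine (relations_freeKer hX).isLiftable fun a b h ↦ ?_
  rw [injective_iff_map_eq_zero]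
  rintro ⟨x, m⟩ hx
  obtain rfl : m = 0 := Subtype.ext (funext fun _ ↦ rfl)
  rw [LinearMap.coprod_apply, map_zero, add_zero] at hx
  have hx' : X.free.chain h.le x.1 = 0 := congr_arg Subtype.val hx
  refine Prod.ext (Subtype.ext (Prod.ext (Subtype.ext ?_) (Subtype.ext ?_))) rfl
  · exact congr_arg (fun z : upperPi k (fun l ↦ X.obj (.inl l)) a ×
      atBot k X.allRoots a ↦ z.1.1) hx'
  · exact congr_arg (fun z : upperPi k (fun l ↦ X.obj (.inl l)) a ×
      atBot k X.allRoots a ↦ z.2.1) hx'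

/-- The inclusion of the kernel of the projection from the free representation. -/
abbrev freeKerι : freeKer hX ⟶ X.free where
  app
    | .inl j => (LinearMap.ker ((freeπ hX).app (.inl j))).subtype
    | .inr _ => 0
  comm
    | .inl _ => fun _ ↦ rfl
    | .inr o => fun _ ↦ (map_zero (X.free.map (.inr o))).symm

lemma freeKerι_freeπ : freeKerι hX ≫ freeπ hX = 0 := by
  refine QRep.hom_ext ?_
  rintro (j | o) x
  · exact x.2
  · rfl

lemma shortExact_free (v) : (ShortComplex.mk
    ((QRep.ev k (starSource ι β) (starTarget ι β) v).map (freeKerι hX))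
    ((QRep.ev k (starSource ι β) (starTarget ι β) v).map (freeπ hX))
    (by rw [← Functor.map_comp, freeKerι_freeπ, CategoryTheory.Functor.map_zero])).ShortExact := by
  obtain j | o := v
  · exact QRep.shortExact_ev _ Subtype.val_injective (freeπ_surjective hX _)
      fun x hx ↦ ⟨⟨x, hx⟩, rfl⟩
  · exact QRep.shortExact_ev _ (fun _ _ _ ↦ rfl) (freeπ_surjective hX _)
      fun x hx ↦ ⟨PUnit.unit, hx.symm⟩

end Resolution

/-- Modules over an algebra presented by the chain with arrows to the bottom have projective
dimension at most one. -/
lemma isHereditaryCategory_of_presentation [Nontrivial ι] {A : Type u} [Ring A] [Algebra k A]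
    {e : ι ⊕ Option β → A} {p : ChainArr ι ⊕ Option β → A}
    (h : IsQuiverPresentation k (starSource ι β) (starTarget ι β) e p)
    (hP : ∀ M, relations k ι β (h.rep.obj M))
    (hP' : ∀ W, relations k ι β W → ∃ M, Nonempty (h.rep.obj M ≅ W)) :
    IsHereditaryCategory (FDMod k A) := fun M ↦ by
  classical
  exact h.hasProjectiveDimensionLE_one hP hP' M (relations_freeKer (hP M)) (relations_free (hP M))
    (isLiftable_freeKer (hP M)) (isLiftable_free (hP M)) (freeKerι (hP M)) (freeπ (hP M))
    (freeKerι_freeπ (hP M)) (shortExact_free (hP M))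

end StarRep

end PiecewiseHereditary

/-! ### Modules over the truncated algebra -/

namespace PiecewiseHereditary

open Limits MulOpposite
open scoped ModuleCat

section Quiver

variable {Q : Type} [Quiver.{0} Q] (lev : Q → ℕ) (hlev : ∀ x y : Q, (x ⟶ y) → lev y = lev x + 1)

include hlev in
lemma level_eq_add_length {x y : Q} (p : Quiver.Path x y) : lev y = lev x + p.length := by
  induction p with
  | nil => rfl
  | cons p f ih => rw [hlev _ _ f, ih, Quiver.Path.length_cons, add_assoc]

/-- If every vertex has at most one outgoing arrow, paths are determined by their length. -/
lemma path_eq_of_unique_outgoing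
    (hout : ∀ (z y y' : Q) (f : z ⟶ y) (g : z ⟶ y'), (⟨y, f⟩ : Σ y, z ⟶ y) = ⟨y', g⟩)
    {x y : Q} (p : Quiver.Path x y) : ∀ {y' : Q} (q : Quiver.Path x y'), p.length = q.length →
      (⟨y, p⟩ : Σ y, Quiver.Path x y) = ⟨y', q⟩ := by
  induction p with
  | nil =>
    rintro y' (_ | _) h
    · rfl
    · simp at h
  | cons p f ih =>
    rintro y' (_ | ⟨q, g⟩) h
    · simp at h
    · have := ih q (by simpa using h)
      cases this
      cases hout _ _ _ f g
      rfl

include hlev in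
-- The level function makes parallel paths equally long, and with at most one arrow leaving each
-- vertex a path is determined by its start and its length.
lemma subsingleton_path_of_unique_outgoing
    (hout : ∀ (z y y' : Q) (f : z ⟶ y) (g : z ⟶ y'), (⟨y, f⟩ : Σ y, z ⟶ y) = ⟨y', g⟩)
    (x y : Q) : Subsingleton (Quiver.Path x y) := ⟨fun p q ↦ by
  have h := path_eq_of_unique_outgoing hout p q (by
    have h₁ := level_eq_add_length lev hlev p
    have h₂ := level_eq_add_length lev hlev q
    omega)
  cases h
  rfl⟩

include hlev in
lemma subsingleton_path_of_unique_incoming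
    (hin : ∀ (z y y' : Q) (f : y ⟶ z) (g : y' ⟶ z), (⟨y, f⟩ : Σ y, y ⟶ z) = ⟨y', g⟩)
    (x y : Q) : Subsingleton (Quiver.Path x y) := ⟨fun p q ↦ by
  induction p with
  | nil =>
    cases q with
    | nil => rfl
    | cons q g =>
      have := level_eq_add_length lev hlev (q.cons g)
      simp at this
  | cons p f ih =>
    cases q with
    | nil =>
      have := level_eq_add_length lev hlev (p.cons f)
      simp at this
    | cons q g =>
      cases hin _ _ _ f g
      rw [ih q]⟩

lemma finite_pathAlgebra {k : Type u} [Field k] [Finite Q]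
    [∀ x y : Q, Subsingleton (Quiver.Path x y)] : Module.Finite k (PathAlgebra k Q) :=
  inferInstanceAs (Module.Finite k (QPath Q →₀ k))

end Quiver

namespace ExtVertex

variable {m N : ℕ}

/-- The distance from the sources. -/
def level : ExtVertex m (N + 3) → ℕ
  | .source _ => 0
  | .arm j => j.1 - 1

lemma two_le (j : Finset.Icc 2 (N + 3)) : 2 ≤ j.1 := (Finset.mem_Icc.1 j.2).1

lemma le_add_three (j : Finset.Icc 2 (N + 3)) : j.1 ≤ N + 3 := (Finset.mem_Icc.1 j.2).2

lemma level_of_hom : ∀ x y : ExtVertex m (N + 3), (x ⟶ y) → y.level = x.level + 1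
  | .source _, .arm j, f => by
    have h : j.1 = 2 := f.down
    simp [level, h]
  | .arm i, .arm j, f => by
    have h : j.1 = i.1 + 1 := f.down
    have := two_le i
    simp only [level]
    omega

lemma hom_unique : ∀ (z y y' : ExtVertex m (N + 3)) (f : z ⟶ y) (g : z ⟶ y'),
    (⟨y, f⟩ : Σ y, z ⟶ y) = ⟨y', g⟩
  | .source _, .arm j, .arm j', f, g => by
    obtain rfl : j = j' := Subtype.ext (f.down.trans g.down.symm)
    obtain ⟨f⟩ := f
    obtain ⟨g⟩ := g
    rfl
  | .arm _, .arm j, .arm j', f, g => by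
    obtain rfl : j = j' := Subtype.ext (f.down.trans g.down.symm)
    obtain ⟨f⟩ := f
    obtain ⟨g⟩ := g
    rfl

instance (x y : ExtVertex m (N + 3)) : Subsingleton (Quiver.Path x y) :=
  subsingleton_path_of_unique_outgoing level level_of_hom hom_unique x y

/-- The labelling of the vertices. -/
def code : ExtVertex m (N + 3) → Fin (N + 2) ⊕ Fin m
  | .source i => .inr i
  -- The vertices 2, …, N + 3 become 0, …, N + 1, so that 2 is ⊥ and n = N + 3 is ⊤.
  | .arm j => .inl ⟨j.1 - 2, by
      have := two_le j
      have := le_add_three j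
      omega⟩

/-- The vertex on the arm with a given label. -/
def ofFin (j : Fin (N + 2)) : ExtVertex m (N + 3) :=
  .arm ⟨j.1 + 2, Finset.mem_Icc.2 ⟨by omega, by omega⟩⟩

@[simp] lemma code_ofFin (j : Fin (N + 2)) : code (ofFin j : ExtVertex m (N + 3)) = .inl j := rfl

@[simp] lemma code_source (i : Fin m) : code (.source i : ExtVertex m (N + 3)) = .inr i := rfl

@[simp] lemma level_ofFin (j : Fin (N + 2)) :
    level (ofFin j : ExtVertex m (N + 3)) = j.1 + 1 := rfl

@[simp] lemma level_source (i : Fin m) : level (.source i : ExtVertex m (N + 3)) = 0 := rfl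

lemma exists_eq (x : ExtVertex m (N + 3)) : (∃ i, x = .source i) ∨ ∃ j, x = ofFin j := by
  obtain i | j := x
  · exact .inl ⟨i, rfl⟩
  · have := two_le j
    have := le_add_three j
    refine .inr ⟨⟨j.1 - 2, by omega⟩, congr_arg _ (Subtype.ext ?_)⟩
    change j.1 = j.1 - 2 + 2
    omega

lemma code_injective : Function.Injective (code : ExtVertex m (N + 3) → _) := by
  intro x y h
  obtain ⟨i, rfl⟩ | ⟨j, rfl⟩ := exists_eq x <;> obtain ⟨i', rfl⟩ | ⟨j', rfl⟩ := exists_eq y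
  · rw [code_source, code_source, Sum.inr.injEq] at h
    rw [h]
  · simp at h
  · simp at h
  · rw [code_ofFin, code_ofFin, Sum.inl.injEq] at h
    rw [h]

lemma mem_range_code (v : Fin (N + 2) ⊕ Fin m) : v ∈ Set.range code := by
  obtain j | i := v
  · exact ⟨ofFin j, rfl⟩
  · exact ⟨.source i, rfl⟩

/-- The arrow between consecutive vertices on the arm. -/
def homOfFin {j l : Fin (N + 2)} (h : l.1 = j.1 + 1) :
    (ofFin j : ExtVertex m (N + 3)) ⟶ ofFin l :=
  PLift.up (show l.1 + 2 = j.1 + 2 + 1 by omega)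

lemma nonempty_path_ofFin {j l : Fin (N + 2)} (h : j ≤ l) :
    Nonempty (Quiver.Path (ofFin j : ExtVertex m (N + 3)) (ofFin l)) := by
  obtain ⟨d, hd⟩ := Nat.exists_eq_add_of_le (Fin.le_def.1 h)
  induction d generalizing l with
  | zero =>
    obtain rfl : l = j := Fin.ext (by omega)
    exact ⟨.nil⟩
  | succ d ih =>
    obtain ⟨p⟩ := ih (l := ⟨j.1 + d, by omega⟩) (Fin.le_def.2 (by simp)) rfl
    exact ⟨p.cons (homOfFin (by simp only; omega))⟩

lemma nonempty_path_source (i : Fin m) (l : Fin (N + 2)) :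
    Nonempty (Quiver.Path (.source i : ExtVertex m (N + 3)) (ofFin l)) := by
  obtain ⟨p⟩ := nonempty_path_ofFin (m := m) (bot_le : ⊥ ≤ l)
  have f : (.source i : ExtVertex m (N + 3)) ⟶ ofFin ⊥ := PLift.up (show 0 + 2 = 2 from rfl)
  exact ⟨f.toPath.comp p⟩

lemma le_of_path {j l : Fin (N + 2)}
    (p : Quiver.Path (ofFin j : ExtVertex m (N + 3)) (ofFin l)) : j ≤ l := by
  have := level_eq_add_length level level_of_hom p
  rw [level_ofFin, level_ofFin] at this
  exact Fin.le_def.2 (by omega)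

lemma eq_of_path_source {x : ExtVertex m (N + 3)} {i : Fin m} (p : Quiver.Path x (.source i)) :
    x = .source i := by
  have := level_eq_add_length level level_of_hom p
  rw [level_source] at this
  cases p with
  | nil => rfl
  | cons p f => simp at this

lemma conn_inl {j l : Fin (N + 2)} (h : j ≤ l) :
    Conn (code : ExtVertex m (N + 3) → _) (.inl j) (.inl l) := by
  obtain ⟨p⟩ := nonempty_path_ofFin (m := m) h
  exact ⟨_, _, p, rfl, rfl⟩

lemma conn_inr_inl (i : Fin m) (l : Fin (N + 2)) :
    Conn (code : ExtVertex m (N + 3) → _) (.inr i) (.inl l) := by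
  obtain ⟨p⟩ := nonempty_path_source i l
  exact ⟨_, _, p, rfl, rfl⟩

lemma conn_inr (i : Fin m) : Conn (code : ExtVertex m (N + 3) → _) (.inr i) (.inr i) :=
  conn_code (ExtVertex.source i)

/-- Levels range from 0 at the sources to N + 2 at the vertex n, so a path of length N + 2 = n - 1
must use the full range. Truncation therefore amounts to the m zero relations `leaf_top`. -/
lemma eq_of_path_length {x y : ExtVertex m (N + 3)} (p : Quiver.Path x y)
    (hp : p.length = N + 2) : ∃ i, x = .source i ∧ y = ofFin ⊤ := by
  have h := level_eq_add_length level level_of_hom p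
  obtain ⟨i', rfl⟩ | ⟨j', rfl⟩ := exists_eq y
  · rw [level_source] at h
    omega
  rw [level_ofFin] at h
  obtain ⟨i, rfl⟩ | ⟨j, rfl⟩ := exists_eq x
  · rw [level_source] at h
    refine ⟨i, rfl, congr_arg _ (Fin.ext ?_)⟩
    change j'.1 = N + 1
    omega
  · rw [level_ofFin] at h
    omega

end ExtVertex

namespace LamRep

open ExtVertex

variable (k : Type u) [Field k] (m N : ℕ)

/-- The presentation of the truncated path algebra. -/
lemma isQuiverPresentation : IsQuiverPresentation (A := LambdaPrime k m (N + 3)) k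
    (lamSource (Fin (N + 2)) (Fin m)) (lamTarget (Fin (N + 2)) (Fin m))
    (fun v ↦ RingCon.mkₐ k _ (pathElt k code v v))
    (fun a ↦ RingCon.mkₐ k _ (pathElt k code (lamTarget _ _ a) (lamSource _ _ a))) :=
  isQuiverPresentation_of_surjective code_injective (RingCon.mkₐ k _)
    (RingCon.mkₐ_surjective _) _ _ (by
      rintro (i | j) (i' | j') f
      · exact f.elim
      · refine ⟨.inr i, congr_arg Sum.inl (Fin.ext ?_), rfl⟩
        have : j'.1 = 2 := f.down
        change 0 = j'.1 - 2
        omega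
      · exact f.elim
      · have : j'.1 = j.1 + 1 := f.down
        exact ⟨.inl ⟨(⟨j.1 - 2, _⟩, ⟨j'.1 - 2, _⟩), Fin.le_def.2 (by simp only; omega)⟩, rfl, rfl⟩)

variable {k m N}

lemma relations_rep (M : FDMod k (LambdaPrime k m (N + 3))) :
    relations k (Fin (N + 2)) (Fin m) ((isQuiverPresentation k m N).rep.obj M) where
  finite v := by
    have : Module.Finite k M.obj := M.property
    exact inferInstanceAs (Module.Finite k (IsQuiverPresentation.vertexSubmodule k _ M.obj))
  chain_id j x := Subtype.ext x.2
  chain_comp i j l h h' x := Subtype.ext (by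
    refine (IsQuiverPresentation.op_smul_op_smul _ _ _).trans ?_
    rw [← map_mul, pathElt_mul code_injective (conn_inl h) (conn_inl h')]
    rfl)
  leaf_top i x := Subtype.ext (by
    refine (IsQuiverPresentation.op_smul_op_smul _ _ _).trans ?_
    rw [← map_mul, pathElt_mul code_injective (conn_inr_inl i ⊥) (conn_inl le_top)]
    obtain ⟨p⟩ := nonempty_path_source i (⊤ : Fin (N + 2))
    -- The path from a source to the last vertex climbs from level 0 to level N + 2, so it is one of
    -- the generators of the ideal.
    have hp : p.length = N + 2 := by
      have := level_eq_add_length level level_of_hom p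
      rw [level_source, level_ofFin, zero_add] at this
      exact this.symm
    have : RingCon.mkₐ k (lengthIdeal k (ExtVertex m (N + 3)) (N + 2)).ringCon
        (pathElt k code (.inr i) (.inl ⊤)) = 0 := by
      refine ((lengthIdeal k (ExtVertex m (N + 3)) (N + 2)).ringCon.eq).2 ?_
      exact TwoSidedIdeal.subset_span ⟨_, hp, pathElt_code code_injective p⟩
    refine (congr_arg (fun z : LambdaPrime k m (N + 3) ↦ op z • x.1) this).trans ?_
    rw [MulOpposite.op_zero, zero_smul]
    rfl)

/-- The action of the paths on a representation. -/
def pathMap (W : LamRep k (Fin (N + 2)) (Fin m)) : ∀ v w, W.obj w →ₗ[k] W.obj v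
  | .inl j, .inl l => if h : j ≤ l then W.chain h else 0
  | .inr i, .inl _ => W.leaf i ∘ₗ W.chain bot_le
  | .inl _, .inr _ => 0
  | .inr i, .inr i' => if h : i' = i then h ▸ LinearMap.id else 0

lemma exists_rep_iso (W : LamRep k (Fin (N + 2)) (Fin m)) (hW : W.Relations) :
    ∃ M, Nonempty ((isQuiverPresentation k m N).rep.obj M ≅ W) := by
  have := hW.finite
  have h_inl {j l : Fin (N + 2)} (h : j ≤ l) (x) :
      pathMap W (.inl j) (.inl l) x = W.chain h x := by simp [pathMap, h]
  have h_inr (i : Fin m) (x) : pathMap W (.inr i) (.inr i) x = x := by simp [pathMap]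
  have m_self (v x) : pathMap W v v x = x := by
    obtain j | i := v
    · rw [h_inl le_rfl, hW.chain_id]
    · exact h_inr i x
  have h_chain {r l j : Fin (N + 2)} (h : r ≤ l) (h' : l ≤ j) (w) :
      pathMap W (.inl r) (.inl l) (pathMap W (.inl l) (.inl j) w) =
        pathMap W (.inl r) (.inl j) w := by
    rw [h_inl h, h_inl h', h_inl (h.trans h'), hW.chain_comp]
  have h_leaf (i : Fin m) {l j : Fin (N + 2)} (h : l ≤ j) (w) :
      pathMap W (.inr i) (.inl l) (pathMap W (.inl l) (.inl j) w) =
        pathMap W (.inr i) (.inl j) w := by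
    rw [h_inl h]
    exact congr_arg (W.leaf i) (hW.chain_comp _ _ _ bot_le h w)
  have m_comp (x y z : ExtVertex m (N + 3)) (p : Quiver.Path x y) (q : Quiver.Path y z) (w) :
      pathMap W (code x) (code y) (pathMap W (code y) (code z) w) =
        pathMap W (code x) (code z) w := by
    obtain ⟨i, rfl⟩ | ⟨j, rfl⟩ := exists_eq z
    · obtain rfl := eq_of_path_source q
      rw [m_self]
    · obtain ⟨i, rfl⟩ | ⟨l, rfl⟩ := exists_eq y
      · obtain rfl := eq_of_path_source p
        rw [m_self]
      · have hlj := le_of_path q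
        obtain ⟨i, rfl⟩ | ⟨r, rfl⟩ := exists_eq x
        · exact h_leaf i hlj w
        · exact h_chain (le_of_path p) hlj w
  have h_off (v) (hv : v ∉ Set.range code) : Subsingleton (W.obj v) :=
    absurd (mem_range_code v) hv
  obtain ⟨φ, hφ⟩ := exists_truncated_factorization code_injective W (pathMap W) m_self m_comp
    h_off (N + 2) (fun x y q hq w ↦ by
      obtain ⟨i, rfl, rfl⟩ := eq_of_path_length q hq
      exact hW.leaf_top i w)
  refine exists_rep_iso_of_factorization code_injective W (pathMap W) m_self m_comp h_off
    (RingCon.mkₐ k _) (isQuiverPresentation k m N) φ hφ ?_ ?_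
  · rintro (⟨⟨j, l⟩, h⟩ | i) x
    · exact h_inl h x
    · exact congr_arg (W.leaf i) (hW.chain_id _ _)
  · rintro (j | i) (l | i') h x
    · by_cases hjl : j ≤ l
      · exact absurd (conn_inl hjl) h
      · simp [pathMap, hjl]
    · rfl
    · exact absurd (conn_inr_inl i l) h
    · by_cases hi : i' = i
      · subst hi
        exact absurd (conn_inr i') h
      · simp [pathMap, hi]

end LamRep

end PiecewiseHereditary

/-! ### Modules over the path algebra of the star -/

namespace PiecewiseHereditary

open Limits MulOpposite
open scoped ModuleCat

section

variable {m N : ℕ}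

lemma starWeights_last : starWeights m (N + 3) (Fin.last (m + 1)) - 1 = N := by
  simp [starWeights]

lemma starWeights_castSucc (i : Fin (m + 1)) : starWeights m (N + 3) i.castSucc - 1 = 1 := by
  simp [starWeights, (Fin.castSucc_lt_last i).ne]

end

namespace StarVertex

/-- The distance from the centre. -/
def level {r : ℕ} {p : Fin r → ℕ} : StarVertex p → ℕ
  | .centre => 0
  | .arm _ j => j.1 + 1

lemma level_of_hom {r : ℕ} {p : Fin r → ℕ} :
    ∀ x y : StarVertex p, (x ⟶ y) → y.level = x.level + 1
  | .centre, .arm _ j, f => by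
    have h : j.1 = 0 := f.down
    simp [level, h]
  | .arm _ j, .arm _ j', f => by
    have h : j'.1 = j.1 + 1 := f.down.2
    simp [level, h]

lemma hom_unique {r : ℕ} {p : Fin r → ℕ} : ∀ (z y y' : StarVertex p) (f : y ⟶ z) (g : y' ⟶ z),
    (⟨y, f⟩ : Σ y, y ⟶ z) = ⟨y', g⟩
  | .arm _ _, .centre, .centre, ⟨_⟩, ⟨_⟩ => rfl
  | .arm _ l, .centre, .arm _ j, f, g => by
    have h : l.1 = 0 := f.down
    have h' : l.1 = j.1 + 1 := g.down.2
    omega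
  | .arm _ l, .arm _ j, .centre, f, g => by
    have h : l.1 = 0 := g.down
    have h' : l.1 = j.1 + 1 := f.down.2
    omega
  | .arm i l, .arm i' j, .arm i'' j', f, g => by
    obtain ⟨rfl, h⟩ : i' = i ∧ l.1 = j.1 + 1 := f.down
    obtain ⟨rfl, h'⟩ : i'' = i' ∧ l.1 = j'.1 + 1 := g.down
    obtain rfl : j = j' := Fin.ext (by omega)
    obtain ⟨f⟩ := f
    obtain ⟨g⟩ := g
    rfl

instance {r : ℕ} {p : Fin r → ℕ} (x y : StarVertex p) : Subsingleton (Quiver.Path x y) :=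
  subsingleton_path_of_unique_incoming level level_of_hom hom_unique x y

lemma eq_arm_of_path {r : ℕ} {p : Fin r → ℕ} {i : Fin r} {j : Fin (p i - 1)} {y : StarVertex p}
    (q : Quiver.Path (.arm i j) y) : ∃ j', y = .arm i j' := by
  induction q with
  | nil => exact ⟨j, rfl⟩
  | @cons y z q f ih =>
    obtain ⟨l, rfl⟩ := ih
    obtain _ | ⟨i', l'⟩ := z
    · exact f.elim
    · obtain ⟨rfl, -⟩ : i = i' ∧ _ := f.down
      exact ⟨l', rfl⟩

variable {m N : ℕ}

/-- The labelling of the vertices. -/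
def code : StarVertex (starWeights m (N + 3)) → Fin (N + 2) ⊕ Option (Fin m)
  | .centre => .inl ⊥
  -- The centre occupies ⊥, so the long arm is shifted by one. It has only N vertices besides the
  -- centre, hence the label ⊤ = N + 1 is never reached.
  | .arm i j => if h : i = Fin.last (m + 1) then .inl ⟨j.1 + 1, by
        subst h
        have := j.2.trans_eq starWeights_last
        omega⟩
      else .inr (Fin.cases none some (i.castPred h))

/-- The vertices on the long arm, starting with the centre. -/
def pos : Fin (N + 1) → StarVertex (starWeights m (N + 3)) :=
  Fin.cases .centre fun j ↦ .arm (Fin.last _) (j.cast starWeights_last.symm)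

/-- The vertices on the short arms. -/
def leg (i : Fin (m + 1)) : StarVertex (starWeights m (N + 3)) :=
  .arm i.castSucc ⟨0, by rw [starWeights_castSucc]; exact one_pos⟩

/-- The short arm with a given label. -/
def legIndex : Option (Fin m) → Fin (m + 1)
  | none => 0
  | some i => i.succ

/-- The vertex on a short arm with a given label. -/
abbrev legOf (o : Option (Fin m)) : StarVertex (starWeights m (N + 3)) := leg (legIndex o)

@[simp] lemma code_pos (l : Fin (N + 1)) :
    code (pos l : StarVertex (starWeights m (N + 3))) = .inl l.castSucc := by
  induction l using Fin.cases with
  | zero => rfl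
  | succ j => exact dif_pos rfl

@[simp] lemma code_legOf (o : Option (Fin m)) :
    code (legOf o : StarVertex (starWeights m (N + 3))) = .inr o := by
  refine (dif_neg (Fin.castSucc_lt_last _).ne).trans ?_
  cases o <;> rfl

@[simp] lemma level_pos (l : Fin (N + 1)) :
    level (pos l : StarVertex (starWeights m (N + 3))) = l.1 := by
  induction l using Fin.cases with
  | zero => rfl
  | succ j => rfl

@[simp] lemma level_leg (i : Fin (m + 1)) :
    level (leg i : StarVertex (starWeights m (N + 3))) = 1 := rfl

lemma exists_eq (x : StarVertex (starWeights m (N + 3))) :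
    (∃ o, x = legOf o) ∨ ∃ l, x = pos l := by
  obtain _ | ⟨i, j⟩ := x
  · exact .inr ⟨0, rfl⟩
  · induction i using Fin.lastCases with
    | last => exact .inr ⟨(j.cast starWeights_last).succ, rfl⟩
    | cast i =>
      refine .inl ⟨Fin.cases none some i, ?_⟩
      have hi : legIndex (Fin.cases none some i) = i := by
        induction i using Fin.cases with
        | zero => rfl
        | succ i => rfl
      rw [legOf, hi]
      refine congr_arg _ (Fin.ext ?_)
      have := j.2.trans_eq (starWeights_castSucc i)
      change j.1 = 0
      omega

lemma code_injective : Function.Injective (code : StarVertex (starWeights m (N + 3)) → _) := by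
  intro x y h
  obtain ⟨o, rfl⟩ | ⟨j, rfl⟩ := exists_eq x <;> obtain ⟨o', rfl⟩ | ⟨j', rfl⟩ := exists_eq y
  · rw [code_legOf, code_legOf, Sum.inr.injEq] at h
    rw [h]
  · simp at h
  · simp at h
  · rw [code_pos, code_pos, Sum.inl.injEq] at h
    rw [Fin.castSucc_injective _ h]

/-- The label ⊤ is the only one without a vertex. Keeping it lets both algebras be described over
the same chain, with the zero space at ⊤ for the star. -/
lemma eq_top_of_notMem_range {v : Fin (N + 2) ⊕ Option (Fin m)}
    (hv : v ∉ Set.range (code : StarVertex (starWeights m (N + 3)) → _)) : v = .inl ⊤ := by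
  obtain j | o := v
  · induction j using Fin.lastCases with
    | last => rfl
    | cast j => exact absurd ⟨pos j, code_pos j⟩ hv
  · exact absurd ⟨legOf o, code_legOf o⟩ hv

lemma nonempty_hom_pos (j : Fin N) :
    Nonempty ((pos j.castSucc : StarVertex (starWeights m (N + 3))) ⟶ pos j.succ) := by
  obtain _ | N := N
  · exact j.elim0
  · induction j using Fin.cases with
    | zero => exact ⟨PLift.up (show 0 = 0 from rfl)⟩
    | succ j => exact ⟨PLift.up (show Fin.last (m + 1) = Fin.last (m + 1) ∧ j.1 + 1 = j.1 + 1 from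
        ⟨rfl, rfl⟩)⟩

lemma nonempty_path_pos {j l : Fin (N + 1)} (h : j ≤ l) :
    Nonempty (Quiver.Path (pos j : StarVertex (starWeights m (N + 3))) (pos l)) := by
  induction l using Fin.induction with
  | zero =>
    obtain rfl : j = 0 := le_antisymm h bot_le
    exact ⟨.nil⟩
  | succ l ih =>
    obtain rfl | h := h.eq_or_lt
    · exact ⟨.nil⟩
    · obtain ⟨p⟩ := ih (Fin.le_castSucc_iff.2 h)
      obtain ⟨f⟩ := nonempty_hom_pos (m := m) l
      exact ⟨p.cons f⟩

lemma le_of_path {j l : Fin (N + 1)}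
    (p : Quiver.Path (pos j : StarVertex (starWeights m (N + 3))) (pos l)) : j ≤ l := by
  have := level_eq_add_length level level_of_hom p
  rw [level_pos, level_pos] at this
  exact Fin.le_def.2 (by omega)

lemma not_path_leg_pos {i : Fin (m + 1)} {l : Fin (N + 1)}
    (p : Quiver.Path (leg i : StarVertex (starWeights m (N + 3))) (pos l)) : False := by
  obtain ⟨j, hj⟩ := eq_arm_of_path p
  induction l using Fin.cases with
  | zero => cases hj
  | succ l =>
    have := (StarVertex.arm.inj hj).1
    exact (Fin.castSucc_lt_last i).ne this.symm

lemma eq_of_path_leg {x : StarVertex (starWeights m (N + 3))} {i : Fin (m + 1)}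
    (p : Quiver.Path x (leg i)) : x = leg i ∨ x = pos 0 := by
  have := level_eq_add_length level level_of_hom p
  rw [level_leg] at this
  obtain _ | ⟨i', j⟩ := x
  · exact .inr rfl
  · cases p with
    | nil => exact .inl rfl
    | cons p f =>
      simp only [level, Quiver.Path.length_cons] at this
      omega

lemma conn_inl {j l : Fin (N + 2)} (h : j ≤ l) (hl : l ≠ ⊤) :
    Conn (code : StarVertex (starWeights m (N + 3)) → _) (.inl j) (.inl l) := by
  obtain ⟨l, rfl⟩ := Fin.exists_castSucc_eq.2 hl
  obtain ⟨j, rfl⟩ := Fin.exists_castSucc_eq.2 (h.trans_lt (Fin.castSucc_lt_last l)).ne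
  obtain ⟨p⟩ := nonempty_path_pos (m := m) (Fin.castSucc_le_castSucc_iff.1 h)
  exact ⟨_, _, p, code_pos j, code_pos l⟩

lemma conn_inl_inr (o : Option (Fin m)) :
    Conn (code : StarVertex (starWeights m (N + 3)) → _) (.inl ⊥) (.inr o) := by
  have f : (pos 0 : StarVertex (starWeights m (N + 3))) ⟶ legOf o := PLift.up (show 0 = 0 from rfl)
  exact ⟨_, _, f.toPath, rfl, code_legOf o⟩

lemma conn_inr (o : Option (Fin m)) :
    Conn (code : StarVertex (starWeights m (N + 3)) → _) (.inr o) (.inr o) :=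
  ⟨_, _, .nil, code_legOf o, code_legOf o⟩

lemma not_conn_top (v : Fin (N + 2) ⊕ Option (Fin m)) :
    ¬ Conn (code : StarVertex (starWeights m (N + 3)) → _) v (.inl ⊤) := by
  rintro ⟨x, y, q, -, hy⟩
  obtain ⟨o, rfl⟩ | ⟨j, rfl⟩ := exists_eq y
  · simp at hy
  · rw [code_pos, Sum.inl.injEq] at hy
    exact (Fin.castSucc_lt_last j).ne hy

end StarVertex

namespace StarRep

open StarVertex

variable (k : Type u) [Field k] (m N : ℕ)

/-- The presentation of the path algebra of the star. -/
lemma isQuiverPresentation :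
    IsQuiverPresentation (A := PathAlgebra k (StarVertex (starWeights m (N + 3)))) k
    (starSource (Fin (N + 2)) (Fin m)) (starTarget (Fin (N + 2)) (Fin m))
    (fun v ↦ AlgHom.id k _ (pathElt k code v v))
    (fun a ↦ AlgHom.id k _ (pathElt k code (starTarget _ _ a) (starSource _ _ a))) :=
  isQuiverPresentation_of_surjective code_injective (AlgHom.id k _)
    Function.surjective_id _ _ (by
      intro x y f
      have hlev := level_of_hom x y f
      obtain ⟨o, rfl⟩ | ⟨l, rfl⟩ := exists_eq y
      · obtain rfl | rfl := eq_of_path_leg f.toPath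
        · simp at hlev
        · exact ⟨.inr o, (code_legOf o).symm, rfl⟩
      · obtain ⟨o, rfl⟩ | ⟨j, rfl⟩ := exists_eq x
        · exact (not_path_leg_pos f.toPath).elim
        · exact ⟨.inl ⟨(j.castSucc, l.castSucc),
            Fin.castSucc_le_castSucc_iff.2 (le_of_path f.toPath)⟩,
            (code_pos l).symm, (code_pos j).symm⟩)

variable {k m N}

lemma relations_rep (M : FDMod k (PathAlgebra k (StarVertex (starWeights m (N + 3))))) :
    relations k (Fin (N + 2)) (Fin m) ((isQuiverPresentation k m N).rep.obj M) := by
  -- The idempotent attached to ⊤ is zero, since no path ends at that label.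
  have h_top (x : ((isQuiverPresentation k m N).rep.obj M).obj (.inl ⊤)) : x = 0 := by
    refine Subtype.ext (x.2.symm.trans ?_)
    have : pathElt k (code : StarVertex (starWeights m (N + 3)) → _) (.inl ⊤) (.inl ⊤) = 0 :=
      pathElt_of_not_conn (not_conn_top _)
    refine (congr_arg (fun z : PathAlgebra k (StarVertex (starWeights m (N + 3))) ↦
      op z • x.1) this).trans ?_
    rw [MulOpposite.op_zero, zero_smul]
    rfl
  refine ⟨fun v ↦ ?_, fun j x ↦ Subtype.ext x.2, fun i j l h h' x ↦ ?_, h_top⟩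
  · have : Module.Finite k M.obj := M.property
    exact inferInstanceAs (Module.Finite k (IsQuiverPresentation.vertexSubmodule k _ M.obj))
  -- At ⊤ there are no paths to multiply, but the space is zero.
  · by_cases hl : l = ⊤
    · subst hl
      rw [h_top x, map_zero, map_zero, map_zero]
    · refine Subtype.ext ((IsQuiverPresentation.op_smul_op_smul _ _ _).trans ?_)
      rw [← map_mul, pathElt_mul code_injective
        (conn_inl h (h'.trans_lt (lt_top_iff_ne_top.2 hl)).ne) (conn_inl h' hl)]
      rfl

/-- The action of the paths on a representation. -/
def pathMap (W : StarRep k (Fin (N + 2)) (Fin m)) : ∀ v w, W.obj w →ₗ[k] W.obj v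
  | .inl j, .inl l => if h : j ≤ l then W.chain h else 0
  | .inl j, .inr o => if h : j = ⊥ then h ▸ W.root o else 0
  | .inr _, .inl _ => 0
  | .inr o, .inr o' => if h : o' = o then h ▸ LinearMap.id else 0

lemma exists_rep_iso (W : StarRep k (Fin (N + 2)) (Fin m)) (hW : W.Relations) :
    ∃ M, Nonempty ((isQuiverPresentation k m N).rep.obj M ≅ W) := by
  have := hW.finite
  have h_inl {j l : Fin (N + 2)} (h : j ≤ l) (x) :
      pathMap W (.inl j) (.inl l) x = W.chain h x := by simp [pathMap, h]
  have h_inr (o) (x) : pathMap W (.inr o) (.inr o) x = x := by simp [pathMap]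
  have m_self (v x) : pathMap W v v x = x := by
    obtain j | o := v
    · rw [h_inl le_rfl, hW.chain_id]
    · exact h_inr o x
  have h_chain {r l j : Fin (N + 2)} (h : r ≤ l) (h' : l ≤ j) (w) :
      pathMap W (.inl r) (.inl l) (pathMap W (.inl l) (.inl j) w) =
        pathMap W (.inl r) (.inl j) w := by
    rw [h_inl h, h_inl h', h_inl (h.trans h'), hW.chain_comp]
  have m_comp (x y z : StarVertex (starWeights m (N + 3))) (p : Quiver.Path x y)
      (q : Quiver.Path y z) (w) :
      pathMap W (code x) (code y) (pathMap W (code y) (code z) w) =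
        pathMap W (code x) (code z) w := by
    obtain ⟨o, rfl⟩ | ⟨j, rfl⟩ := exists_eq z
    · obtain rfl | rfl := eq_of_path_leg q
      · rw [m_self]
      · obtain ⟨o, rfl⟩ | ⟨r, rfl⟩ := exists_eq x
        · exact (not_path_leg_pos p).elim
        · obtain rfl : r = 0 := le_antisymm (le_of_path p) bot_le
          rw [m_self]
    · obtain ⟨i, rfl⟩ | ⟨l, rfl⟩ := exists_eq y
      · exact (not_path_leg_pos q).elim
      · obtain ⟨i, rfl⟩ | ⟨r, rfl⟩ := exists_eq x
        · exact (not_path_leg_pos p).elim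
        · have hrl := Fin.castSucc_le_castSucc_iff.2 (le_of_path p)
          have hlj := Fin.castSucc_le_castSucc_iff.2 (le_of_path q)
          revert w
          rw [code_pos, code_pos, code_pos]
          exact h_chain hrl hlj
  have h_off (v) (hv : v ∉ Set.range (code : StarVertex (starWeights m (N + 3)) → _)) :
      Subsingleton (W.obj v) := by
    obtain rfl := eq_top_of_notMem_range hv
    exact ⟨fun x y ↦ (hW.top_eq_zero x).trans (hW.top_eq_zero y).symm⟩
  refine exists_rep_iso_of_factorization code_injective W (pathMap W) m_self m_comp h_off
    (AlgHom.id k _) (isQuiverPresentation k m N)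
    (pathAlgebraAction code_injective W (pathMap W) m_self m_comp h_off) (fun _ ↦ rfl) ?_ ?_
  · rintro (⟨⟨j, l⟩, h⟩ | o) x
    · exact h_inl h x
    · simp [pathMap]
  · rintro (j | o) (l | o') h x
    · by_cases hjl : j ≤ l
      · by_cases hl : l = ⊤
        · subst hl
          rw [hW.top_eq_zero x, map_zero]
        · exact absurd (conn_inl hjl hl) h
      · simp [pathMap, hjl]
    · by_cases hj : j = ⊥
      · subst hj
        exact absurd (conn_inl_inr o') h
      · simp [pathMap, hj]
    · rfl
    · by_cases ho : o' = o
      · subst ho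
        exact absurd (conn_inr o') h
      · simp [pathMap, ho]

end StarRep

end PiecewiseHereditary

/-! ### Conclusion -/

namespace PiecewiseHereditary

/-- The truncated path algebra is derived equivalent to the path algebra of the star. -/
lemma triangleEquivalent_lambdaPrime_star (k : Type u) [Field k] (m N : ℕ)
    [HasDerivedCategory (FDMod k (LambdaPrime k m (N + 3)))]
    [HasDerivedCategory (FDMod k (PathAlgebra k (StarVertex (starWeights m (N + 3)))))] :
    TriangleEquivalent k (DerivedCategory.Bounded (FDMod k (LambdaPrime k m (N + 3))))
      (DerivedCategory.Bounded
        (FDMod k (PathAlgebra k (StarVertex (starWeights m (N + 3)))))) := by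
  have h₁ := (LamRep.isQuiverPresentation k m N).preservesHomology_equivalence_comp_ev
    (LamRep.relations k (Fin (N + 2)) (Fin m)) LamRep.relations_rep LamRep.exists_rep_iso
  have h₂ := (StarRep.isQuiverPresentation k m N).preservesHomology_equivalence_comp_ev
    (StarRep.relations k (Fin (N + 2)) (Fin m)) StarRep.relations_rep StarRep.exists_rep_iso
  let e := (LamRep.isQuiverPresentation k m N).equivalence
    (LamRep.relations k (Fin (N + 2)) (Fin m)) LamRep.relations_rep LamRep.exists_rep_iso
  let e' := (StarRep.isQuiverPresentation k m N).equivalence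
    (StarRep.relations k (Fin (N + 2)) (Fin m)) StarRep.relations_rep StarRep.exists_rep_iso
  have : e.functor.Additive := ⟨rfl⟩
  have : e'.functor.Additive := ⟨rfl⟩
  have : e.functor.Linear k := ⟨fun _ _ ↦ rfl⟩
  have : e'.functor.Linear k := ⟨fun _ _ ↦ rfl⟩
  exact triangleEquivalent_bounded_of_resolutions _ _
    (LamRep.leafSurjective_le.trans LamRep.topInjective_le)
    (StarRep.rootSurjective_le.trans StarRep.rootInjective_le)
    (CochainComplex.isLocalizedEquivalence_localizerInclusion_trans _ _ _
      LamRep.isLocalizedEquivalence_leafSurjective LamRep.isLocalizedEquivalence_topInjective)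
    (CochainComplex.isLocalizedEquivalence_localizerInclusion_trans _ _ _
      StarRep.isLocalizedEquivalence_rootSurjective StarRep.isLocalizedEquivalence_rootInjective)
    e e' QRep.isIso_of_forall_ev QRep.isIso_of_forall_ev
    (LamRep.reduction k (Fin (N + 2)) (Fin m)) LamRep.isThick_iff_reduction

end PiecewiseHereditary

end

theorem proposition3p1 (k : Type u) [Field k] (m n : ℕ) (hm : 2 ≤ m) (hn : 3 ≤ n) :
    PiecewiseHereditary.IsPiecewiseHereditaryOfType k
      (PiecewiseHereditary.LambdaPrime k m n)
      (PiecewiseHereditary.FDMod k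
        (PiecewiseHereditary.PathAlgebra k
          (PiecewiseHereditary.StarVertex (PiecewiseHereditary.starWeights m n)))) := by
  -- With n = N + 3 the chain `Fin (N + 2)` is nontrivial, so ⊥ ≠ ⊤, as the resolutions require.
  obtain ⟨N, rfl⟩ := Nat.exists_eq_add_of_le' hn
  refine ⟨?_, ?_, ?_⟩
  · have : Module.Finite k (PiecewiseHereditary.PathAlgebra k
        (PiecewiseHereditary.ExtVertex m (N + 3))) := PiecewiseHereditary.finite_pathAlgebra
    exact Module.Finite.of_surjective (RingCon.mkₐ k (PiecewiseHereditary.lengthIdeal k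
      (PiecewiseHereditary.ExtVertex m (N + 3)) (N + 2)).ringCon).toLinearMap
      (RingCon.mkₐ_surjective (α := k) _)
  · exact PiecewiseHereditary.StarRep.isHereditaryCategory_of_presentation
      (PiecewiseHereditary.StarRep.isQuiverPresentation k m N)
      PiecewiseHereditary.StarRep.relations_rep PiecewiseHereditary.StarRep.exists_rep_iso
  · let _ : HasDerivedCategory (PiecewiseHereditary.FDMod k
      (PiecewiseHereditary.LambdaPrime k m (N + 3))) := HasDerivedCategory.standard _
    let _ : HasDerivedCategory (PiecewiseHereditary.FDMod k (PiecewiseHereditary.PathAlgebra k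
      (PiecewiseHereditary.StarVertex (PiecewiseHereditary.starWeights m (N + 3))))) :=
      HasDerivedCategory.standard _
    exact PiecewiseHereditary.triangleEquivalent_lambdaPrime_star k m N
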